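/- Let $k$ be a field, $A$ an abelian group, and let $S = k[x_0,\dots,x_n]$ be $A$-graded by homogeneous variables; assume the grading is positive, i.e. $S_0 = k$ and there is a homomorphism $\theta : A \to \mathbb{Z}$ with $\theta(\deg x_i) > 0$ for all $i$. Let $E = \Lambda_k(e_0,\dots,e_n)$ be the exterior algebra, $A\oplus\mathbb{Z}$-graded by $\deg e_i = (-\deg x_i; -1)$, and let $\omega_E = \operatorname{Hom}_k(E,k)$ with its dual grading and its right $E$-module structure $(f\cdot y)(z) = f(yz)$. A right graded $E$-module $D$ is also regarded as a left module via $e_i x = (-1)^j x e_i$ for $x \in D_{(a;j)}$. For an $A$-graded $S$-module $M$, let $\mathbf{R}(M) = \bigoplus_{a\in A} M_a \otimes_k \omega_E(-a;0)$ with differential $m\otimes f \mapsto \sum_i x_i m \otimes e_i f$, and for $a \in A$ let $K_a(M) = \ker\bigl(M_a\otimes_k \omega_E(-a;0) \to \mathbf{R}(M)\bigr)$ be the kernel of this differential on the summand indexed by $a$. For a graded $E$-module $N$ (with zero differential) let $\mathbf{L}(N)$ be the complex of graded $S$-modules with $\mathbf{L}(N)_j = \bigoplus_{a\in A} S(-a)\otimes_k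 N_{(a;j)}$ and differential $s\otimes x \mapsto \sum_i x_i s\otimes e_i x$. A complex of free graded $S$-modules is *strongly linear* if its terms have homogeneous bases with respect to which all entries of the matrices of the differentials are $k$-linear combinations of the variables $x_0,\dots,x_n$. A subcomplex $C'$ of a complex $C$ of graded $S$-modules is *quasi-split* if each $C'_j$ is a direct summand of $C_j$ as a graded $S$-module. A *minimal free resolution* of $M$ is a quasi-isomorphism $F \to M$, where $F$ is a complex of free graded $S$-modules with differentials zero modulo $(x_0,\dots,x_n)$, with $F_j = 0$ for $j \ll 0$, and such that for each $j$ there is a homomorphism $\theta: A\to\mathbb{Z}$, positive on all $\deg x_i$, for which the degrees $\theta(a)$ with $(F_j)_a \neq 0$ are bounded below. **Theorem.** Let $M$ be an $A$-graded $S$-module that is generated in a single degree $d \in A$, and let $F$ be a minimal free resolution of $M$. 1. $\mathbf{L}(K_d(M))$ is strongly linear and is isomorphic to a quasi-split subcomplex of $F$. 2. Every strongly linear, quasi-split subcomplex of $F$ is isomorphic to a quasi-split subcomplex of $\mathbf{L}(K_d(M))$. 3. $\mathbf{L}(K_d(M))$ is, up to isomorphism, the unique maximal strongly linear, quasi-split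 subcomplex of $F$: there is a subcomplex of $F$ that is maximal with respect to inclusion among the strongly linear, quasi-split subcomplexes and is isomorphic to $\mathbf{L}(K_d(M))$, and every subcomplex that is maximal in this sense is isomorphic to $\mathbf{L}(K_d(M))$. 4. If $F$ is strongly linear, then $F \cong \mathbf{L}(K_d(M))$. -/

import Mathlib

open scoped TensorProduct

namespace MultigradedBGG

/-! ## Internal gradings of vector spaces -/

section Grading

variable {k : Type*} [Field k] {ι κ l V W : Type*} [AddCommGroup V] [Module k V]
  [AddCommGroup W] [Module k W]

/-- `V` is the internal direct sum of the subspaces `gr i`. -/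
structure IsGrading (gr : ι → Submodule k V) : Prop where
  indep : iSupIndep gr
  iSup_eq_top : ⨆ i, gr i = ⊤

theorem iSupIndep_of_proj (gr : ι → Submodule k V) (p : ι → V →ₗ[k] V)
    (h1 : ∀ i, ∀ x ∈ gr i, p i x = x) (h2 : ∀ i j, j ≠ i → ∀ x ∈ gr j, p i x = 0) :
    iSupIndep gr := by
  intro i
  rw [Submodule.disjoint_def]
  intro x hx hx'
  have : (⨆ j, ⨆ (_ : j ≠ i), gr j) ≤ LinearMap.ker (p i) := by
    refine iSup₂_le fun j hj y hy => ?_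
    exact h2 i j hj y hy
  rw [← h1 i x hx]
  exact this hx'

theorem isGrading_comap {gr : ι → Submodule k V} (hi : iSupIndep gr) {U : Submodule k V}
    (hU : ⨆ i, gr i = U) : IsGrading fun i => (gr i).comap U.subtype := by
  have hle : ∀ i, gr i ≤ LinearMap.range U.subtype := by
    intro i
    rw [Submodule.range_subtype, ← hU]
    exact le_iSup gr i
  refine ⟨?_, ?_⟩
  · intro i
    have h := hi i
    rw [Submodule.disjoint_def] at h ⊢
    intro x hx hx'
    have : (x : V) = 0 := by
      refine h _ hx ?_
      have h3 : (⨆ j, ⨆ (_ : j ≠ i), (gr j).comap U.subtype).map U.subtype ≤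
          ⨆ j, ⨆ (_ : j ≠ i), gr j := by
        simp only [Submodule.map_iSup]
        exact iSup₂_mono fun j _ => Submodule.map_comap_le _ _
      exact h3 ⟨x, hx', rfl⟩
    exact Subtype.ext this
  · apply Submodule.map_injective_of_injective U.injective_subtype
    rw [Submodule.map_iSup, Submodule.map_top, Submodule.range_subtype]
    simp only [Submodule.map_comap_eq_of_le (hle _)]
    exact hU

namespace IsGrading

variable {gr : ι → Submodule k V}

/-- The map sending a vector to the finitely supported family of its homogeneous components. -/
noncomputable def components (h : IsGrading gr) : V →ₗ[k] (ι →₀ V) := by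
  classical
  exact (DirectSum.toModule k ι (ι →₀ V) fun i => (Finsupp.lsingle i) ∘ₗ (gr i).subtype) ∘ₗ
    (LinearEquiv.ofBijective (DirectSum.coeLinearMap gr)
      (DirectSum.isInternal_submodule_of_iSupIndep_of_iSup_eq_top
        h.indep h.iSup_eq_top)).symm.toLinearMap

theorem components_of_mem (h : IsGrading gr) {i : ι} {x : V} (hx : x ∈ gr i) :
    h.components x = Finsupp.single i x := by
  classical
  have : (LinearEquiv.ofBijective (DirectSum.coeLinearMap gr)
      (DirectSum.isInternal_submodule_of_iSupIndep_of_iSup_eq_top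
        h.indep h.iSup_eq_top)).symm x = DirectSum.lof k ι (fun i => gr i) i ⟨x, hx⟩ := by
    rw [LinearEquiv.symm_apply_eq]
    exact (DirectSum.coeLinearMap_lof gr i ⟨x, hx⟩).symm
  simp only [components, LinearMap.comp_apply, LinearEquiv.coe_coe]
  rw [this, DirectSum.toModule_lof]
  simp

/-- The projection onto the homogeneous component of index `i`. -/
noncomputable def proj (h : IsGrading gr) (i : ι) : V →ₗ[k] V := Finsupp.lapply i ∘ₗ h.components

theorem proj_of_mem (h : IsGrading gr) {i : ι} {x : V} (hx : x ∈ gr i) : h.proj i x = x := by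
  simp [proj, h.components_of_mem hx]

theorem proj_of_mem_of_ne (h : IsGrading gr) {i j : ι} (hij : i ≠ j) {x : V} (hx : x ∈ gr i) : h.proj j x = 0 := by
  simp [proj, h.components_of_mem hx, hij]


/-- Induction on homogeneous elements. -/
theorem induction_on (h : IsGrading gr) {P : V → Prop} (x : V) (hom : ∀ i, ∀ x ∈ gr i, P x)
    (zero : P 0) (add : ∀ x y, P x → P y → P (x + y)) : P x := by
  have hx : x ∈ ⨆ i, gr i := h.iSup_eq_top ▸ Submodule.mem_top
  exact Submodule.iSup_induction gr (motive := P) hx hom zero add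

theorem linearMap_ext (h : IsGrading gr) {f g : V →ₗ[k] W} (hfg : ∀ i, ∀ x ∈ gr i, f x = g x) : f = g := by
  ext x
  refine h.induction_on x hfg (by simp) ?_
  intro x y hx hy
  simp [hx, hy]

theorem proj_mem (h : IsGrading gr) (i : ι) (x : V) : h.proj i x ∈ gr i := by
  refine h.induction_on (P := fun x => h.proj i x ∈ gr i) x ?_ (by simp) ?_
  · intro j y hy
    by_cases hij : j = i
    · subst hij
      rwa [h.proj_of_mem hy]
    · rw [h.proj_of_mem_of_ne hij hy]
      exact zero_mem _
  · intro x y hx hy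
    rw [map_add]
    exact add_mem hx hy

theorem mem_iSup_of_proj_mem (h : IsGrading gr) {P : Submodule k V} {x : V} (hx : ∀ i, h.proj i x ∈ P) :
    x ∈ ⨆ i, P ⊓ gr i := by
  have hsum : ∀ x : V, (h.components x).sum (fun _ v => v) = x := by
    intro x
    refine h.induction_on (P := fun x => (h.components x).sum (fun _ v => v) = x) x ?_ (by simp) ?_
    · intro i y hy
      rw [h.components_of_mem hy]
      simp
    · intro x y hx hy
      rw [map_add, Finsupp.sum_add_index' (by simp) (by simp), hx, hy]
  rw [← hsum x]
  refine Submodule.sum_mem _ fun i _ => ?_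
  exact Submodule.mem_iSup_of_mem i ⟨hx i, h.proj_mem i x⟩

end IsGrading

/-- A subspace is homogeneous if it is spanned by its homogeneous elements. -/
def IsHomogeneous (gr : ι → Submodule k V) (P : Submodule k V) : Prop :=
  P ≤ ⨆ i, P ⊓ gr i

theorem IsHomogeneous.iSup_eq {gr : ι → Submodule k V} {P : Submodule k V}
    (hP : IsHomogeneous gr P) : ⨆ i, P ⊓ gr i = P :=
  le_antisymm (iSup_le fun _ => inf_le_left) hP

theorem IsGrading.restrict {gr : ι → Submodule k V} (h : IsGrading gr) {P : Submodule k V}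
    (hP : IsHomogeneous gr P) : IsGrading fun i => (gr i).comap P.subtype := by
  have := isGrading_comap (h.indep.mono fun i => (inf_le_right : P ⊓ gr i ≤ gr i)) hP.iSup_eq
  simpa using this

theorem IsHomogeneous.proj_mem {gr : ι → Submodule k V} (h : IsGrading gr) {P : Submodule k V}
    (hP : IsHomogeneous gr P) (i : ι) {x : V} (hx : x ∈ P) : h.proj i x ∈ P := by
  have hx' := hP hx
  refine Submodule.iSup_induction (fun i => P ⊓ gr i) (motive := fun x => h.proj i x ∈ P) hx'
    ?_ (by simp) ?_
  · intro j y hy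
    by_cases hij : j = i
    · subst hij
      rw [h.proj_of_mem hy.2]
      exact hy.1
    · rw [h.proj_of_mem_of_ne hij hy.2]
      exact zero_mem _
  · intro x y hx hy
    rw [map_add]
    exact add_mem hx hy

/-- The grading on `V ⊗ W` in which the tensor product of elements of degrees `i` and `j` has
degree `g i j`. -/
def tensorGr (grV : ι → Submodule k V) (grW : κ → Submodule k W) (g : ι → κ → l) (c : l) :
    Submodule k (V ⊗[k] W) :=
  Submodule.span k {t | ∃ i j, ∃ v ∈ grV i, ∃ w ∈ grW j, g i j = c ∧ v ⊗ₜ[k] w = t}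

theorem tmul_mem_tensorGr {grV : ι → Submodule k V} {grW : κ → Submodule k W} (g : ι → κ → l)
    {i : ι} {j : κ} {v : V} {w : W} (hv : v ∈ grV i) (hw : w ∈ grW j) :
    v ⊗ₜ[k] w ∈ tensorGr grV grW g (g i j) :=
  Submodule.subset_span ⟨i, j, v, hv, w, hw, rfl, rfl⟩

theorem IsGrading.tensor {grV : ι → Submodule k V} {grW : κ → Submodule k W}
    (hV : IsGrading grV) (hW : IsGrading grW) (g : ι → κ → l) :
    IsGrading (tensorGr grV grW g) := by
  classical
  let c : V ⊗[k] W →ₗ[k] (l →₀ V ⊗[k] W) :=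
    (Finsupp.lmapDomain (V ⊗[k] W) k fun p : ι × κ => g p.1 p.2) ∘ₗ
      (finsuppTensorFinsupp k k V W ι κ).toLinearMap ∘ₗ
        TensorProduct.map hV.components hW.components
  have hc : ∀ a, ∀ t ∈ tensorGr grV grW g a, c t = Finsupp.single a t := by
    intro a t ht
    have : tensorGr grV grW g a ≤ LinearMap.eqLocus c (Finsupp.lsingle a) := by
      refine Submodule.span_le.mpr ?_
      rintro _ ⟨i, j, v, hv, w, hw, rfl, rfl⟩
      simp only [SetLike.mem_coe, LinearMap.mem_eqLocus]
      simp [c, hV.components_of_mem hv, hW.components_of_mem hw, finsuppTensorFinsupp_single,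
        Finsupp.mapDomain_single]
    exact this ht
  refine ⟨iSupIndep_of_proj _ (fun a => Finsupp.lapply a ∘ₗ c) ?_ ?_, ?_⟩
  · intro a t ht
    simp [hc a t ht]
  · intro a b hba t ht
    simp [hc b t ht, hba]
  · rw [eq_top_iff]
    rintro t -
    induction t using TensorProduct.induction_on with
    | zero => exact zero_mem _
    | add x y hx hy => exact add_mem hx hy
    | tmul v w =>
      refine hV.induction_on (P := fun v => v ⊗ₜ[k] w ∈ ⨆ i, tensorGr grV grW g i) v ?_ (by simp) (fun x y hx hy => by
        rw [TensorProduct.add_tmul]; exact add_mem hx hy)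
      intro i v hv
      refine hW.induction_on (P := fun w => v ⊗ₜ[k] w ∈ ⨆ i, tensorGr grV grW g i) w ?_ (by simp) (fun x y hx hy => by
        rw [TensorProduct.tmul_add]; exact add_mem hx hy)
      intro j w hw
      exact Submodule.mem_iSup_of_mem _ (tmul_mem_tensorGr g hv hw)

end Grading

/-! ## The exterior algebra and its dual -/

section Exterior

variable (k : Type*) [Field k] (n : ℕ)

/-- The exterior algebra `E = Λ(e₀, …, eₙ)`. -/
abbrev Ext : Type _ := ExteriorAlgebra k (Fin (n + 1) → k)

variable {n}

/-- The exterior variable `eᵢ`. -/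
noncomputable def e (i : Fin (n + 1)) : Ext k n := ExteriorAlgebra.ι k (Pi.single i 1)

theorem e_mul_self (i : Fin (n + 1)) : e k i * e k i = 0 := ExteriorAlgebra.ι_sq_zero _

theorem e_mul_add (i j : Fin (n + 1)) : e k i * e k j + e k j * e k i = 0 :=
  ExteriorAlgebra.ι_add_mul_swap _ _

theorem ι_eq_sum (v : Fin (n + 1) → k) : ExteriorAlgebra.ι k v = ∑ i, v i • e k i := by
  conv_lhs => rw [pi_eq_sum_univ' v]
  simp only [map_sum, map_smul, e]

variable {A : Type*} [AddCommGroup A] (w : Fin (n + 1) → A)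

/-- The `A ⊕ ℤ`-grading on `E` with `deg eᵢ = (-deg xᵢ; -1)`, where `deg xᵢ = w i`. -/
def extGr (p : A × ℤ) : Submodule k (Ext k n) :=
  Submodule.span k {y | ∃ l : List (Fin (n + 1)),
    (l.map fun i => ((-w i, -1) : A × ℤ)).sum = p ∧ (l.map (e k)).prod = y}

theorem e_mem_extGr (i : Fin (n + 1)) : e k i ∈ extGr k w (-w i, -1) :=
  Submodule.subset_span ⟨[i], by simp, by simp⟩

theorem extGr_mul_mem {p q : A × ℤ} {x y : Ext k n} (hx : x ∈ extGr k w p)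
    (hy : y ∈ extGr k w q) : x * y ∈ extGr k w (p + q) := by
  induction hx using Submodule.span_induction with
  | zero => simp
  | add a b _ _ ha hb => rw [add_mul]; exact add_mem ha hb
  | smul r a _ ha => rw [smul_mul_assoc]; exact Submodule.smul_mem _ _ ha
  | mem x hx =>
    obtain ⟨l, rfl, rfl⟩ := hx
    induction hy using Submodule.span_induction with
    | zero => simp
    | add a b _ _ ha hb => rw [mul_add]; exact add_mem ha hb
    | smul r a _ ha => rw [mul_smul_comm]; exact Submodule.smul_mem _ _ ha
    | mem y hy =>
      obtain ⟨l', rfl, rfl⟩ := hy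
      exact Submodule.subset_span ⟨l ++ l', by simp, by simp⟩

theorem sq_sum_eq_zero {R ι : Type*} [Ring R] [Algebra k R] (T : ι → R)
    (h1 : ∀ i, T i * T i = 0) (h2 : ∀ i j, T i * T j + T j * T i = 0) (v : ι → k)
    (s : Finset ι) : (∑ i ∈ s, v i • T i) * (∑ i ∈ s, v i • T i) = 0 := by
  classical
  induction s using Finset.induction_on with
  | empty => simp
  | insert a s ha ih =>
    rw [Finset.sum_insert ha, add_mul, mul_add, mul_add, ih]
    have h3 : v a • T a * ∑ i ∈ s, v i • T i + (∑ i ∈ s, v i • T i) * v a • T a = 0 := by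
      rw [Finset.mul_sum, Finset.sum_mul, ← Finset.sum_add_distrib]
      refine Finset.sum_eq_zero fun i _ => ?_
      rw [smul_mul_smul_comm, smul_mul_smul_comm, mul_comm (v i), ← smul_add, h2, smul_zero]
    rw [smul_mul_smul_comm, h1, smul_zero, zero_add, add_zero, h3]

theorem extGr_isGrading : IsGrading (extGr k w) := by
  classical
  let T : Fin (n + 1) → AddMonoidAlgebra (Ext k n) (A × ℤ) := fun i =>
    AddMonoidAlgebra.single (-w i, -1) (e k i)
  let f : (Fin (n + 1) → k) →ₗ[k] AddMonoidAlgebra (Ext k n) (A × ℤ) :=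
    ∑ i, (LinearMap.proj i : (Fin (n + 1) → k) →ₗ[k] k).smulRight (T i)
  have hf : ∀ v, f v = ∑ i, v i • T i := by
    intro v
    simp [f]
  have hf0 : ∀ v, f v * f v = 0 := by
    intro v
    rw [hf]
    refine sq_sum_eq_zero k T ?_ ?_ v _
    · intro i
      simp [T, AddMonoidAlgebra.single_mul_single, e_mul_self]
    · intro i j
      simp only [T, AddMonoidAlgebra.single_mul_single]
      rw [add_comm ((-w j, -1) : A × ℤ), ← AddMonoidAlgebra.single_add, e_mul_add]
      simp
  let c : Ext k n →ₐ[k] AddMonoidAlgebra (Ext k n) (A × ℤ) := ExteriorAlgebra.lift k ⟨f, hf0⟩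
  have hce : ∀ i, c (e k i) = T i := by
    intro i
    simp only [c, e, ExteriorAlgebra.lift_ι_apply, hf]
    rw [Finset.sum_eq_single i]
    · simp
    · intro j _ hj
      simp [hj]
    · simp
  have hcl : ∀ l : List (Fin (n + 1)), c ((l.map (e k)).prod) =
      AddMonoidAlgebra.single ((l.map fun i => ((-w i, -1) : A × ℤ)).sum)
        ((l.map (e k)).prod) := by
    intro l
    induction l with
    | nil =>
      simp [AddMonoidAlgebra.one_def]
    | cons i l ih =>
      simp only [List.map_cons, List.prod_cons, List.sum_cons, map_mul, ih, hce, T,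
        AddMonoidAlgebra.single_mul_single]
  have hc : ∀ p, ∀ y ∈ extGr k w p, c y = AddMonoidAlgebra.single p y := by
    intro p y hy
    induction hy using Submodule.span_induction with
    | mem y hy =>
      obtain ⟨l, rfl, rfl⟩ := hy
      exact hcl l
    | zero => simp
    | add x y _ _ hx hy => rw [map_add, hx, hy, AddMonoidAlgebra.single_add]
    | smul r x _ hx => rw [map_smul, hx, AddMonoidAlgebra.smul_single]
  let pr : A × ℤ → Ext k n →ₗ[k] Ext k n := fun p =>
    { toFun := fun y => (c y).coeff p
      map_add' := by intro x y; simp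
      map_smul' := by intro r x; simp }
  refine ⟨iSupIndep_of_proj _ pr ?_ ?_, ?_⟩
  · intro p y hy
    simp [pr, hc p y hy]
  · intro p q hqp y hy
    simp [pr, hc q y hy, hqp]
  · rw [eq_top_iff]
    rintro y -
    have hmul : ∀ x ∈ ⨆ p, extGr k w p, ∀ y ∈ ⨆ p, extGr k w p, x * y ∈ ⨆ p, extGr k w p := by
      intro x hx y hy
      refine Submodule.iSup_induction _ (motive := fun x => x * y ∈ ⨆ p, extGr k w p) hx ?_
        (by simp) (fun a b ha hb => by rw [add_mul]; exact add_mem ha hb)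
      intro p x hx
      refine Submodule.iSup_induction _ (motive := fun y => x * y ∈ ⨆ p, extGr k w p) hy ?_
        (by simp) (fun a b ha hb => by rw [mul_add]; exact add_mem ha hb)
      intro q y hy
      exact Submodule.mem_iSup_of_mem _ (extGr_mul_mem k w hx hy)
    induction y using ExteriorAlgebra.induction with
    | algebraMap r =>
      rw [Algebra.algebraMap_eq_smul_one]
      refine Submodule.smul_mem _ _ (Submodule.mem_iSup_of_mem 0 (Submodule.subset_span ⟨[], ?_⟩))
      simp
    | ι v =>
      rw [ι_eq_sum]
      exact Submodule.sum_mem _ fun i _ => Submodule.smul_mem _ _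
        (Submodule.mem_iSup_of_mem _ (e_mem_extGr k w i))
    | mul a b ha hb => exact hmul a ha b hb
    | add a b ha hb => exact add_mem ha hb

instance : Module.Finite k (Ext k n) :=
  Module.Finite.of_basis (Module.Basis.ExteriorAlgebra (Pi.basisFun k (Fin (n + 1))))

variable (n) in
/-- The vector space `ω_E = Hom_k(E, k)`. -/
def Omega : Type _ := Module.Dual k (Ext k n)

noncomputable instance : AddCommGroup (Omega k n) :=
  inferInstanceAs (AddCommGroup (Module.Dual k (Ext k n)))
noncomputable instance : Module k (Omega k n) :=
  inferInstanceAs (Module k (Module.Dual k (Ext k n)))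

/-- A functional, seen as an element of `ω_E`. -/
noncomputable def Omega.toDual : Omega k n ≃ₗ[k] Module.Dual k (Ext k n) := LinearEquiv.refl k _

/-- The right `E`-module structure `(f · y)(z) = f (y z)` on `ω_E`. -/
noncomputable instance : Module (Ext k n)ᵐᵒᵖ (Omega k n) where
  smul y f := (Omega.toDual k).symm (Omega.toDual k f ∘ₗ LinearMap.mulLeft k y.unop)
  one_smul f := (Omega.toDual k).injective <| LinearMap.ext fun z => by
    change Omega.toDual k f (1 * z) = _
    rw [one_mul]
  mul_smul x y f := (Omega.toDual k).injective <| LinearMap.ext fun z => by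
    change Omega.toDual k f (y.unop * x.unop * z) = Omega.toDual k f (y.unop * (x.unop * z))
    rw [mul_assoc]
  smul_zero y := rfl
  smul_add y f g := rfl
  add_smul x y f := (Omega.toDual k).injective <| LinearMap.ext fun z => by
    change Omega.toDual k f ((x.unop + y.unop) * z) =
      Omega.toDual k f (x.unop * z) + Omega.toDual k f (y.unop * z)
    rw [add_mul, map_add]
  zero_smul f := (Omega.toDual k).injective <| LinearMap.ext fun z => by
    change Omega.toDual k f (0 * z) = 0
    rw [zero_mul, map_zero]

theorem Omega.toDual_smul (y : (Ext k n)ᵐᵒᵖ) (f : Omega k n) (z : Ext k n) :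
    Omega.toDual k (y • f) z = Omega.toDual k f (y.unop * z) := rfl

instance : IsScalarTower k (Ext k n)ᵐᵒᵖ (Omega k n) where
  smul_assoc r y f := (Omega.toDual k).injective <| LinearMap.ext fun z => by
    rw [Omega.toDual_smul, MulOpposite.unop_smul, smul_mul_assoc, map_smul, map_smul,
      LinearMap.smul_apply, Omega.toDual_smul]

/-- The dual grading: `(ω_E)_p` consists of the functionals supported on `E_{-p}`. -/
def omegaGr (p : A × ℤ) : Submodule k (Omega k n) where
  carrier := {f | ∀ q, q ≠ -p → ∀ y ∈ extGr k w q, Omega.toDual k f y = 0}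
  add_mem' {f g} hf hg q hq y hy := by
    rw [map_add, LinearMap.add_apply, hf q hq y hy, hg q hq y hy, add_zero]
  zero_mem' q hq y hy := by simp
  smul_mem' r f hf q hq y hy := by
    rw [map_smul, LinearMap.smul_apply, hf q hq y hy, smul_zero]

theorem omegaGr_isGrading : IsGrading (omegaGr k w) := by
  classical
  have hE := extGr_isGrading k w
  let pr : A × ℤ → Omega k n →ₗ[k] Omega k n := fun p =>
    (Omega.toDual k).symm.toLinearMap ∘ₗ (LinearMap.lcomp k k (hE.proj (-p))) ∘ₗ
      (Omega.toDual k).toLinearMap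
  have hpr : ∀ p f y, Omega.toDual k (pr p f) y = Omega.toDual k f (hE.proj (-p) y) :=
    fun p f y => rfl
  have hmem : ∀ p f, pr p f ∈ omegaGr k w p := by
    intro p f q hq y hy
    rw [hpr, hE.proj_of_mem_of_ne hq hy, map_zero]
  refine ⟨iSupIndep_of_proj _ pr ?_ ?_, ?_⟩
  · intro p f hf
    refine (Omega.toDual k).injective (hE.linearMap_ext fun q y hy => ?_)
    rw [hpr]
    by_cases hq : q = -p
    · subst hq
      rw [hE.proj_of_mem hy]
    · rw [hE.proj_of_mem_of_ne hq hy, map_zero, hf q hq y hy]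
  · intro p p' hp f hf
    refine (Omega.toDual k).injective (hE.linearMap_ext fun q y hy => ?_)
    rw [hpr, map_zero, LinearMap.zero_apply]
    by_cases hq : q = -p
    · subst hq
      rw [hE.proj_of_mem hy]
      exact hf _ (fun h => hp (neg_injective h).symm) y hy
    · rw [hE.proj_of_mem_of_ne hq hy, map_zero]
  · rw [eq_top_iff]
    rintro f -
    have hfin : {p | extGr k w p ≠ ⊥}.Finite := Submodule.finite_ne_bot_of_iSupIndep hE.indep
    have : f = ∑ p ∈ hfin.toFinset, pr (-p) f := by
      refine (Omega.toDual k).injective (hE.linearMap_ext fun q y hy => ?_)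
      rw [map_sum, LinearMap.sum_apply]
      simp only [hpr, neg_neg]
      by_cases hq : q ∈ hfin.toFinset
      · rw [Finset.sum_eq_single q, hE.proj_of_mem hy]
        · intro p _ hp
          rw [hE.proj_of_mem_of_ne hp.symm hy, map_zero]
        · exact fun h => absurd hq h
      · have hy0 : y = 0 := by
          simp only [Set.Finite.mem_toFinset, Set.mem_ofPred_eq, not_not] at hq
          rw [hq] at hy
          exact hy
        simp [hy0]
    rw [this]
    exact Submodule.sum_mem _ fun p _ => Submodule.mem_iSup_of_mem _ (hmem _ _)

end Exterior

/-! ## Graded `S`-modules and graded (differential) `E`-modules -/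

section Objects

universe v

variable (k : Type*) [Field k] {n : ℕ} {A : Type*} [AddCommGroup A] (w : Fin (n + 1) → A)

/-- The polynomial ring `S = k[x₀, …, xₙ]`. It is graded by `A` through `deg xᵢ = w i`; its
component of degree `a` is `MvPolynomial.weightedHomogeneousSubmodule k w a`. -/
abbrev PolyS (n : ℕ) : Type _ := MvPolynomial (Fin (n + 1)) k

/-- The `A`-grading of `S` given by `deg xᵢ = w i` is positive. -/
def IsPositive : Prop :=
  (∀ s ∈ MvPolynomial.weightedHomogeneousSubmodule k w 0, ∃ c : k, s = MvPolynomial.C c) ∧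
    ∃ θ : A →+ ℤ, ∀ i, 0 < θ (w i)

/-- An `A`-graded `S`-module. -/
structure GrMod where
  carrier : Type v
  [addCommGroup : AddCommGroup carrier]
  [moduleK : Module k carrier]
  [moduleS : Module (PolyS k n) carrier]
  [tower : IsScalarTower k (PolyS k n) carrier]
  gr : A → Submodule k carrier
  isGrading : IsGrading gr
  smul_mem : ∀ {a b : A} {s : PolyS k n} {m : carrier},
    s ∈ MvPolynomial.weightedHomogeneousSubmodule k w a → m ∈ gr b → s • m ∈ gr (a + b)

instance : CoeSort (GrMod.{v} k w) (Type v) := ⟨GrMod.carrier⟩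

attribute [instance] GrMod.addCommGroup GrMod.moduleK GrMod.moduleS GrMod.tower

/-- An `A ⊕ ℤ`-graded right `E`-module. -/
structure EMod where
  carrier : Type v
  [addCommGroup : AddCommGroup carrier]
  [moduleK : Module k carrier]
  [moduleE : Module (Ext k n)ᵐᵒᵖ carrier]
  [tower : IsScalarTower k (Ext k n)ᵐᵒᵖ carrier]
  gr : A × ℤ → Submodule k carrier
  isGrading : IsGrading gr
  smul_mem : ∀ {p q : A × ℤ} {y : Ext k n} {m : carrier},
    m ∈ gr p → y ∈ extGr k w q → MulOpposite.op y • m ∈ gr (p + q)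

instance : CoeSort (EMod.{v} k w) (Type v) := ⟨EMod.carrier⟩

attribute [instance] EMod.addCommGroup EMod.moduleK EMod.moduleE EMod.tower

variable {k w}

namespace EMod

variable (D : EMod.{v} k w)

/-- The operator acting on elements of auxiliary degree `j` by `(-1)^j`. -/
noncomputable def auxSign : D →ₗ[k] D :=
  (Finsupp.lsum k fun p : A × ℤ => (p.2.negOnePow : ℤ) • (LinearMap.id : D →ₗ[k] D)) ∘ₗ
    D.isGrading.components

theorem auxSign_of_mem {p : A × ℤ} {x : D} (hx : x ∈ D.gr p) :
    D.auxSign x = (p.2.negOnePow : ℤ) • x := by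
  rw [auxSign, LinearMap.comp_apply, D.isGrading.components_of_mem hx, Finsupp.lsum_single]
  rfl

/-- Left multiplication by `eᵢ`: on elements of auxiliary degree `j`, `eᵢ x = (-1)^j x eᵢ`. -/
noncomputable def lmul (i : Fin (n + 1)) : D →ₗ[k] D :=
  (Algebra.lsmul k k D (MulOpposite.op (e k i))) ∘ₗ D.auxSign

theorem lmul_apply_of_mem (i : Fin (n + 1)) {p : A × ℤ} {x : D} (hx : x ∈ D.gr p) :
    D.lmul i x = (p.2.negOnePow : ℤ) • (MulOpposite.op (e k i) • x) := by
  simp only [lmul, LinearMap.comp_apply, D.auxSign_of_mem hx, map_zsmul]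
  rfl

theorem rmul_mem (i : Fin (n + 1)) {p : A × ℤ} {x : D} (hx : x ∈ D.gr p) :
    MulOpposite.op (e k i) • x ∈ D.gr (p.1 - w i, p.2 - 1) := by
  have := D.smul_mem hx (e_mem_extGr k w i)
  have hp : p + (-w i, -1) = (p.1 - w i, p.2 - 1) := by
    ext <;> simp [sub_eq_add_neg]
  rwa [hp] at this

theorem lmul_mem (i : Fin (n + 1)) {p : A × ℤ} {x : D} (hx : x ∈ D.gr p) :
    D.lmul i x ∈ D.gr (p.1 - w i, p.2 - 1) := by
  rw [D.lmul_apply_of_mem i hx]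
  exact zsmul_mem (D.rmul_mem i hx) _

theorem lmul_rmul (i j : Fin (n + 1)) (x : D) :
    D.lmul i (MulOpposite.op (e k j) • x) = MulOpposite.op (e k j) • D.lmul i x := by
  refine D.isGrading.induction_on (P := fun x => D.lmul i (MulOpposite.op (e k j) • x) =
    MulOpposite.op (e k j) • D.lmul i x) x ?_ (by simp) ?_
  · intro p x hx
    rw [D.lmul_apply_of_mem i hx, D.lmul_apply_of_mem i (D.rmul_mem j hx), smul_smul,
      smul_comm (MulOpposite.op (e k j)) ((p.2.negOnePow : ℤ)), smul_smul,
      ← MulOpposite.op_mul, ← MulOpposite.op_mul, eq_neg_of_add_eq_zero_left (e_mul_add k j i),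
      Int.negOnePow_sub, Int.negOnePow_one, MulOpposite.op_neg, neg_smul]
    simp
  · intro x y hx hy
    simp only [smul_add, map_add, hx, hy]

theorem lmul_smul (i : Fin (n + 1)) (y : (Ext k n)ᵐᵒᵖ) (x : D) :
    D.lmul i (y • x) = y • D.lmul i x := by
  induction y using MulOpposite.rec' with
  | h y =>
  induction y using ExteriorAlgebra.induction generalizing x with
  | algebraMap r =>
    rw [← MulOpposite.algebraMap_apply, algebraMap_smul, algebraMap_smul, map_smul]
  | ι v =>
    rw [ι_eq_sum, ← MulOpposite.opAddEquiv_apply, map_sum, Finset.sum_smul, Finset.sum_smul, map_sum]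
    refine Finset.sum_congr rfl fun j _ => ?_
    rw [MulOpposite.opAddEquiv_apply, MulOpposite.op_smul, smul_assoc, smul_assoc, map_smul, lmul_rmul]
  | mul a b ha hb => rw [MulOpposite.op_mul, mul_smul, mul_smul, hb, ha]
  | add a b ha hb => rw [MulOpposite.op_add, add_smul, add_smul, map_add, ha, hb]

theorem lmul_lmul_self (i : Fin (n + 1)) (x : D) : D.lmul i (D.lmul i x) = 0 := by
  refine D.isGrading.induction_on (P := fun x => D.lmul i (D.lmul i x) = 0) x ?_ (by simp) ?_
  · intro p x hx
    rw [D.lmul_apply_of_mem i hx, map_zsmul, D.lmul_apply_of_mem i (D.rmul_mem i hx),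
      smul_smul (MulOpposite.op (e k i)), ← MulOpposite.op_mul, e_mul_self]
    simp
  · intro x y hx hy
    simp only [map_add, hx, hy, add_zero]

theorem lmul_lmul_add (i j : Fin (n + 1)) (x : D) :
    D.lmul i (D.lmul j x) + D.lmul j (D.lmul i x) = 0 := by
  refine D.isGrading.induction_on (P := fun x => D.lmul i (D.lmul j x) + D.lmul j (D.lmul i x) = 0)
    x ?_ (by simp) ?_
  · intro p x hx
    rw [D.lmul_apply_of_mem i hx, D.lmul_apply_of_mem j hx, map_zsmul, map_zsmul,
      D.lmul_apply_of_mem i (D.rmul_mem j hx), D.lmul_apply_of_mem j (D.rmul_mem i hx),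
      smul_smul (MulOpposite.op (e k i)), smul_smul (MulOpposite.op (e k j)),
      ← MulOpposite.op_mul, ← MulOpposite.op_mul, ← smul_add, ← smul_add, ← add_smul,
      ← MulOpposite.op_add, e_mul_add]
    simp
  · intro x y hx hy
    simp only [map_add]
    rw [add_add_add_comm, hx, hy, add_zero]

end EMod

variable (k w)

/-- A differential `E`-module: an `A ⊕ ℤ`-graded right `E`-module with a square-zero
endomorphism of degree `(0; -1)`. -/
structure DM extends EMod.{v} k w where
  del : carrier →ₗ[(Ext k n)ᵐᵒᵖ] carrier
  del_mem : ∀ {a : A} {j : ℤ} {x : carrier}, x ∈ gr (a, j) → del x ∈ gr (a, j - 1)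
  del_del : ∀ x, del (del x) = 0

/-- The graded right `E`-module `ω_E`. -/
@[reducible] noncomputable def omegaE : EMod k w where
  carrier := Omega k n
  gr := omegaGr k w
  isGrading := omegaGr_isGrading k w
  smul_mem {p q y f} hf hy := by
    intro r hr z hz
    rw [Omega.toDual_smul]
    refine hf (q + r) (fun h => hr ?_) _ (extGr_mul_mem k w hy hz)
    rw [neg_add, ← h]
    abel

variable {k w}

end Objects

/-! ## Complexes of graded `S`-modules -/

section Complexes

universe v v'

variable {k : Type*} [Field k] {n : ℕ} {A : Type*} [AddCommGroup A] {w : Fin (n + 1) → A}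

/-- A homogeneous submodule of a graded `S`-module, with the induced grading. -/
@[reducible] noncomputable def GrMod.sub (M : GrMod.{v} k w) (P : Submodule (PolyS k n) M)
    (hP : IsHomogeneous M.gr (P.restrictScalars k)) : GrMod.{v} k w where
  carrier := P
  tower := ⟨fun r s x => Subtype.ext (smul_assoc r s x.1)⟩
  gr a := (M.gr a).comap (P.restrictScalars k).subtype
  isGrading := M.isGrading.restrict hP
  smul_mem hs hm := M.smul_mem hs hm

/-- A graded module is free if it has a basis of homogeneous elements, that is, if it is a direct
sum of modules of the form `S(-a)`. -/
def GrMod.IsFree (M : GrMod.{v} k w) : Prop :=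
  ∃ (ι : Type v) (b : Module.Basis ι (PolyS k n) M), ∀ i, ∃ a, b i ∈ M.gr a

/-- `M` is bounded below in `A`-degrees. -/
def GrMod.IsBoundedBelow (M : GrMod.{v} k w) : Prop :=
  ∃ θ : A →+ ℤ, (∀ i, 0 < θ (w i)) ∧ ∃ B : ℤ, ∀ a, θ a < B → M.gr a = ⊥

/-- `M` is generated, as an `S`-module, by its homogeneous elements of degree `d`. -/
def GrMod.IsGeneratedInDegree (M : GrMod.{v} k w) (d : A) : Prop :=
  Submodule.span (PolyS k n) (M.gr d : Set M) = ⊤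

variable (k w) in
/-- A complex of `A`-graded `S`-modules, with differentials of homological degree `-1`. -/
structure GrComplex where
  X : ℤ → GrMod.{v} k w
  d : ∀ i j : ℤ, j + 1 = i → (X i →ₗ[PolyS k n] X j)
  d_mem : ∀ i j h (a : A) (x : X i), x ∈ (X i).gr a → d i j h x ∈ (X j).gr a
  d_d : ∀ i j l h h' (x : X i), d j l h' (d i j h x) = 0

namespace GrComplex

/-- Isomorphism of complexes of graded modules. -/
def IsIso (C : GrComplex.{v} k w) (C' : GrComplex.{v'} k w) : Prop :=
  ∃ f : ∀ j, C.X j ≃ₗ[PolyS k n] C'.X j,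
    (∀ j a (x : C.X j), x ∈ (C.X j).gr a ↔ f j x ∈ (C'.X j).gr a) ∧
    ∀ i j h (x : C.X i), f j (C.d i j h x) = C'.d i j h (f i x)

/-- A complex is strongly linear if its terms have bases of homogeneous elements with respect to
which all the entries of the matrices of the differentials are `k`-linear combinations of the
variables. -/
def IsStronglyLinear (C : GrComplex.{v} k w) : Prop :=
  ∃ (ι : ℤ → Type v) (b : ∀ j, Module.Basis (ι j) (PolyS k n) (C.X j)),
    (∀ j s, ∃ a, b j s ∈ (C.X j).gr a) ∧
    ∀ i j h (s : ι i) (t : ι j), (b j).repr (C.d i j h (b i s)) t ∈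
      Submodule.span k (Set.range (MvPolynomial.X : Fin (n + 1) → PolyS k n))

/-- A complex is minimal if its differentials are zero modulo the ideal `(x₀, …, xₙ)`. -/
def IsMinimal (C : GrComplex.{v} k w) : Prop :=
  ∀ i j h (x : C.X i), C.d i j h x ∈
    Ideal.span (Set.range (MvPolynomial.X : Fin (n + 1) → PolyS k n)) •
      (⊤ : Submodule (PolyS k n) (C.X j))

/-- `ε : F₀ → M` makes `F` a minimal free resolution of `M`: the complex `F` is a minimal complex
of free modules, it is bounded below in homological degrees and its terms are bounded below in
`A`-degrees, and `ε` defines a quasi-isomorphism from `F` to `M`, seen as a complex concentrated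
in homological degree `0`. -/
structure IsMinimalFreeResolution (F : GrComplex.{v} k w) (M : GrMod.{v'} k w)
    (ε : F.X 0 →ₗ[PolyS k n] M) : Prop where
  free : ∀ j, (F.X j).IsFree
  minimal : F.IsMinimal
  bounded : ∃ N : ℤ, ∀ j < N, Subsingleton (F.X j)
  boundedBelow : ∀ j, (F.X j).IsBoundedBelow
  map_mem : ∀ a (x : F.X 0), x ∈ (F.X 0).gr a → ε x ∈ M.gr a
  map_d : ∀ x : F.X 1, ε (F.d 1 0 (by norm_num) x) = 0
  surjective_homology : ∀ m : M, ∃ z : F.X 0, F.d 0 (-1) (by norm_num) z = 0 ∧ ε z = m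
  injective_homology : ∀ z : F.X 0, F.d 0 (-1) (by norm_num) z = 0 → ε z = 0 →
    ∃ y : F.X 1, F.d 1 0 (by norm_num) y = z
  acyclic : ∀ i ≠ 0, ∀ z : F.X i, F.d i (i - 1) (by ring) z = 0 →
    ∃ y : F.X (i + 1), F.d (i + 1) i rfl y = z

/-- A subcomplex of a complex of graded modules. -/
structure Subcomplex (C : GrComplex.{v} k w) where
  P : ∀ j, Submodule (PolyS k n) (C.X j)
  homogeneous : ∀ j, IsHomogeneous (C.X j).gr ((P j).restrictScalars k)
  d_mem : ∀ i j h, ∀ x ∈ P i, C.d i j h x ∈ P j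

namespace Subcomplex

variable {C : GrComplex.{v} k w}

/-- A subcomplex, seen as a complex. -/
@[reducible] noncomputable def toComplex (L : C.Subcomplex) : GrComplex.{v} k w where
  X j := (C.X j).sub (L.P j) (L.homogeneous j)
  d i j h := (C.d i j h).restrict (L.d_mem i j h)
  d_mem i j h a x hx := C.d_mem i j h a x.1 hx
  d_d i j l h h' x := Subtype.ext (C.d_d i j l h h' x.1)

/-- A subcomplex is quasi-split if its terms are direct summands of the terms of the ambient
complex as graded modules. -/
def IsQuasiSplit (L : C.Subcomplex) : Prop :=
  ∀ j, ∃ Q : Submodule (PolyS k n) (C.X j),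
    IsHomogeneous (C.X j).gr (Q.restrictScalars k) ∧ IsCompl (L.P j) Q

/-- `L` is maximal, with respect to inclusion, among the strongly linear quasi-split
subcomplexes. -/
def IsMaximalStronglyLinear (L : C.Subcomplex) : Prop :=
  L.toComplex.IsStronglyLinear ∧ L.IsQuasiSplit ∧
    ∀ L' : C.Subcomplex, L'.toComplex.IsStronglyLinear → L'.IsQuasiSplit →
      (∀ j, L.P j ≤ L'.P j) → ∀ j, L'.P j = L.P j

end Subcomplex

end GrComplex

end Complexes

/-! ## The BGG functors and the module `K_a(M)` -/

section BGG

universe v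

variable {k : Type*} [Field k] {n : ℕ} {A : Type*} [AddCommGroup A] {w : Fin (n + 1) → A}

theorem sum_antisymm {ι V : Type*} [Fintype ι] [AddCommGroup V] (B : ι → ι → V)
    (h1 : ∀ i, B i i = 0) (h2 : ∀ i j, B i j + B j i = 0) : ∑ i, ∑ j, B i j = 0 := by
  classical
  rw [← Fintype.sum_prod_type']
  refine Finset.sum_involution (fun p _ => (p.2, p.1)) (fun p _ => h2 _ _) ?_ (by simp) (by simp)
  rintro ⟨i, j⟩ _ hp h
  simp only [Prod.mk.injEq] at h
  obtain ⟨rfl, -⟩ := h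
  exact hp (h1 _)

/-- Left multiplication by `eᵢ`, as a map of right `E`-modules. -/
noncomputable def EMod.lmulE (D : EMod.{v} k w) (i : Fin (n + 1)) : D →ₗ[(Ext k n)ᵐᵒᵖ] D where
  toFun := D.lmul i
  map_add' := map_add _
  map_smul' := D.lmul_smul i

/-- Multiplication by `xᵢ` on a graded module. -/
noncomputable def GrMod.xmul (M : GrMod.{v} k w) (i : Fin (n + 1)) : M →ₗ[k] M :=
  Algebra.lsmul k k M (MvPolynomial.X i : PolyS k n)

theorem GrMod.xmul_apply (M : GrMod.{v} k w) (i : Fin (n + 1)) (m : M) :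
    M.xmul i m = (MvPolynomial.X i : PolyS k n) • m := rfl

/-- The differential `f ⊗ m ↦ ∑ᵢ eᵢ f ⊗ xᵢ m` of `R(M)`. -/
noncomputable def RRdel (M : GrMod.{v} k w) :
    omegaE k w ⊗[k] M →ₗ[(Ext k n)ᵐᵒᵖ] omegaE k w ⊗[k] M :=
  ∑ i, TensorProduct.AlgebraTensorModule.map ((omegaE k w).lmulE i) (M.xmul i)

theorem RRdel_tmul (M : GrMod.{v} k w) (f : omegaE k w) (m : M) :
    RRdel M (f ⊗ₜ m) = ∑ i, (omegaE k w).lmul i f ⊗ₜ[k] ((MvPolynomial.X i : PolyS k n) • m) := by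
  simp only [RRdel, LinearMap.sum_apply, TensorProduct.AlgebraTensorModule.map_tmul]
  rfl

theorem X_mem (i : Fin (n + 1)) :
    (MvPolynomial.X i : PolyS k n) ∈ MvPolynomial.weightedHomogeneousSubmodule k w (w i) :=
  MvPolynomial.isWeightedHomogeneous_X k w i

/-- The differential `E`-module `R(M) = ⨁ₐ Mₐ ⊗ ω_E(-a; 0)` of a graded `S`-module `M`, with
differential `m ⊗ f ↦ ∑ᵢ xᵢ m ⊗ eᵢ f`. The factors are written in the opposite order, and the
direct sum over `a` is written as `ω_E ⊗ M` with the corresponding grading. -/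
@[reducible] noncomputable def RR (M : GrMod.{v} k w) : DM k w where
  carrier := omegaE k w ⊗[k] M
  gr := tensorGr (omegaE k w).gr M.gr fun p a => (p.1 + a, p.2)
  isGrading := (omegaE k w).isGrading.tensor M.isGrading _
  smul_mem {p q y m} hm hy := by
    induction hm using Submodule.span_induction with
    | zero => simp
    | add a b _ _ ha hb => rw [smul_add]; exact add_mem ha hb
    | smul r a _ ha => rw [smul_comm]; exact Submodule.smul_mem _ _ ha
    | mem t ht =>
      obtain ⟨r, a, f, hf, m, hm, rfl, rfl⟩ := ht
      rw [TensorProduct.smul_tmul']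
      have := tmul_mem_tensorGr (fun (p : A × ℤ) (a : A) => (p.1 + a, p.2))
        ((omegaE k w).smul_mem hf hy) hm
      have hpq : ((r + q).1 + a, (r + q).2) = (r.1 + a, r.2) + q := by
        rw [Prod.ext_iff]
        simp [add_right_comm]
      rwa [hpq] at this
  del := RRdel M
  del_mem {a j x} hx := by
    induction hx using Submodule.span_induction with
    | zero => simp
    | add a b _ _ ha hb => rw [map_add]; exact add_mem ha hb
    | smul r a _ ha => rw [LinearMap.map_smul_of_tower]; exact Submodule.smul_mem _ _ ha
    | mem t ht =>
      obtain ⟨r, b, f, hf, m, hm, hr, rfl⟩ := ht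
      rw [RRdel_tmul]
      refine Submodule.sum_mem _ fun i _ => ?_
      have := tmul_mem_tensorGr (fun (p : A × ℤ) (a : A) => (p.1 + a, p.2))
        ((omegaE k w).lmul_mem i hf) (M.smul_mem (X_mem i) hm)
      simp only [Prod.mk.injEq] at hr
      have hpq : (r.1 - w i + (w i + b), r.2 - 1) = (a, j - 1) := by
        rw [← hr.1, ← hr.2, ← add_assoc, sub_add_cancel]
      simp only [hpq] at this
      exact this
  del_del x := by
    induction x using TensorProduct.induction_on with
    | zero => simp
    | add x y hx hy => rw [map_add, map_add, hx, hy, add_zero]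
    | tmul f m =>
      rw [RRdel_tmul, map_sum, Finset.sum_congr rfl fun i _ => RRdel_tmul M _ _]
      refine sum_antisymm (fun i j => (omegaE k w).lmul j ((omegaE k w).lmul i f) ⊗ₜ[k]
        ((MvPolynomial.X j : PolyS k n) • (MvPolynomial.X i : PolyS k n) • m)) ?_ ?_
      · intro i
        rw [EMod.lmul_lmul_self, TensorProduct.zero_tmul]
      · intro i j
        rw [smul_comm (MvPolynomial.X j : PolyS k n), ← TensorProduct.add_tmul,
          EMod.lmul_lmul_add, TensorProduct.zero_tmul]

/-- The summand `Mₐ ⊗ ω_E(-a; 0)` of `R(M)`. -/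
noncomputable def RRsummand (M : GrMod.{v} k w) (a : A) :
    Submodule (Ext k n)ᵐᵒᵖ (RR M).carrier :=
  LinearMap.range (TensorProduct.AlgebraTensorModule.map
    (LinearMap.id : omegaE k w →ₗ[(Ext k n)ᵐᵒᵖ] omegaE k w) (M.gr a).subtype)

theorem DM.del_proj (D : DM.{v} k w) (a : A) (j : ℤ) (x : D.carrier) :
    D.del (D.isGrading.proj (a, j) x) = D.isGrading.proj (a, j - 1) (D.del x) := by
  refine D.isGrading.induction_on (P := fun x => D.del (D.isGrading.proj (a, j) x) =
    D.isGrading.proj (a, j - 1) (D.del x)) x ?_ (by simp) ?_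
  · rintro ⟨b, l⟩ x hx
    by_cases h : (b, l) = (a, j)
    · obtain ⟨rfl, rfl⟩ := Prod.mk.injEq .. ▸ h
      rw [D.isGrading.proj_of_mem hx, D.isGrading.proj_of_mem (D.del_mem hx)]
    · rw [D.isGrading.proj_of_mem_of_ne h hx, map_zero,
        D.isGrading.proj_of_mem_of_ne _ (D.del_mem hx)]
      intro h'
      apply h
      simp only [Prod.mk.injEq, sub_left_inj] at h' ⊢
      exact h'
  · intro x y hx hy
    simp only [map_add, hx, hy]

/-- A homogeneous differential `E`-submodule of a differential `E`-module. -/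
@[reducible] def DM.sub (D : DM.{v} k w) (N : Submodule (Ext k n)ᵐᵒᵖ D.carrier)
    (hN : IsHomogeneous D.gr (N.restrictScalars k)) (hdel : ∀ x ∈ N, D.del x ∈ N) :
    DM.{v} k w where
  carrier := N
  tower := ⟨fun r s x => Subtype.ext (smul_assoc r s x.1)⟩
  gr p := (D.gr p).comap (N.restrictScalars k).subtype
  isGrading := D.isGrading.restrict hN
  smul_mem hm hy := D.smul_mem hm hy
  del := D.del.restrict hdel
  del_mem hx := D.del_mem hx
  del_del x := Subtype.ext (D.del_del x.1)

/-- The kernel of the differential of `R(M)` on the summand `Mₐ ⊗ ω_E(-a; 0)`. -/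
noncomputable def Ksub (M : GrMod.{v} k w) (a : A) : Submodule (Ext k n)ᵐᵒᵖ (RR M).carrier :=
  RRsummand M a ⊓ LinearMap.ker (RR M).del

theorem RRsummand_homogeneous (M : GrMod.{v} k w) (a : A) :
    IsHomogeneous (RR M).gr ((RRsummand M a).restrictScalars k) := by
  rintro x ⟨y, rfl⟩
  induction y using TensorProduct.induction_on with
  | zero => rw [map_zero]; exact zero_mem _
  | add x y hx hy => rw [map_add]; exact add_mem hx hy
  | tmul f m =>
    refine (omegaE k w).isGrading.induction_on (P := fun f =>
      TensorProduct.AlgebraTensorModule.map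
        (LinearMap.id : omegaE k w →ₗ[(Ext k n)ᵐᵒᵖ] omegaE k w) (M.gr a).subtype (f ⊗ₜ[k] m) ∈
        ⨆ i, (RRsummand M a).restrictScalars k ⊓ (RR M).gr i) f ?_ ?_ ?_
    · intro p f hf
      refine Submodule.mem_iSup_of_mem (p.1 + a, p.2) ⟨⟨f ⊗ₜ m, rfl⟩, ?_⟩
      exact tmul_mem_tensorGr (fun (p : A × ℤ) (a : A) => (p.1 + a, p.2)) hf m.2
    · rw [TensorProduct.zero_tmul, map_zero]; exact zero_mem _
    · intro x y hx hy
      rw [TensorProduct.add_tmul, map_add]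
      exact add_mem hx hy

theorem Ksub_homogeneous (M : GrMod.{v} k w) (a : A) :
    IsHomogeneous (RR M).gr ((Ksub M a).restrictScalars k) := by
  intro x hx
  refine (RR M).isGrading.mem_iSup_of_proj_mem fun p => ⟨?_, ?_⟩
  · exact (RRsummand_homogeneous M a).proj_mem (RR M).isGrading p hx.1
  · obtain ⟨b, j⟩ := p
    have h : (RR M).del x = 0 := hx.2
    change (RR M).del _ = 0
    rw [DM.del_proj, h, map_zero]

/-- The differential `E`-module `K_a(M) = ker (Mₐ ⊗ ω_E(-a; 0) → R(M))`; its differential, induced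
by that of `R(M)`, is zero. -/
@[reducible] noncomputable def KK (M : GrMod.{v} k w) (a : A) : DM k w :=
  (RR M).sub (Ksub M a) (Ksub_homogeneous M a) fun x hx => by
    rw [show (RR M).del x = 0 from hx.2]
    exact zero_mem _

theorem KK_del (M : GrMod.{v} k w) (a : A) : (KK M a).del = 0 :=
  LinearMap.ext fun x => Subtype.ext x.2.2

variable (k w) in
theorem poly_isGrading : IsGrading (MvPolynomial.weightedHomogeneousSubmodule k w) := by
  classical
  let _ := MvPolynomial.weightedGradedAlgebra k w
  have := DirectSum.Decomposition.isInternal (MvPolynomial.weightedHomogeneousSubmodule k w)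
  exact ⟨this.submodule_iSupIndep, this.submodule_iSup_eq_top⟩

namespace DM

variable (D : DM.{v} k w)

/-- The part `⨁ₐ D_{(a; j)}` of auxiliary degree `j`. -/
def aux (j : ℤ) : Submodule k D.carrier := ⨆ a, D.gr (a, j)

/-- The subspace `D_{(a; j)}` of `D.aux j`. -/
def auxGr (j : ℤ) (a : A) : Submodule k (D.aux j) := (D.gr (a, j)).comap (D.aux j).subtype

theorem auxGr_isGrading (j : ℤ) : IsGrading (D.auxGr j) :=
  isGrading_comap (D.isGrading.indep.comp fun _ _ h => (Prod.mk.injEq .. ▸ h).1) rfl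

theorem lmul_mem_aux (i : Fin (n + 1)) {j l : ℤ} (h : l + 1 = j) :
    ∀ x ∈ D.aux j, D.lmul i x ∈ D.aux l := by
  intro x hx
  refine Submodule.iSup_induction _ (motive := fun x => D.lmul i x ∈ D.aux l) hx ?_ (by simp)
    (fun x y hx hy => by rw [map_add]; exact add_mem hx hy)
  intro a x hx
  have := D.lmul_mem i hx
  rw [show j - 1 = l by omega] at this
  exact Submodule.mem_iSup_of_mem _ this

theorem del_mem_aux {j l : ℤ} (h : l + 1 = j) : ∀ x ∈ D.aux j, D.del x ∈ D.aux l := by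
  intro x hx
  refine Submodule.iSup_induction _ (motive := fun x => D.del x ∈ D.aux l) hx ?_ (by simp)
    (fun x y hx hy => by rw [map_add]; exact add_mem hx hy)
  intro a x hx
  have := D.del_mem hx
  rw [show j - 1 = l by omega] at this
  exact Submodule.mem_iSup_of_mem _ this

/-- Left multiplication by `eᵢ` from auxiliary degree `j` to auxiliary degree `j - 1`. -/
noncomputable def lmulAux (i : Fin (n + 1)) {j l : ℤ} (h : l + 1 = j) : D.aux j →ₗ[k] D.aux l :=
  (D.lmul i).restrict (D.lmul_mem_aux i h)

/-- The differential from auxiliary degree `j` to auxiliary degree `j - 1`. -/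
noncomputable def delAux {j l : ℤ} (h : l + 1 = j) : D.aux j →ₗ[k] D.aux l :=
  (D.del.restrictScalars k).restrict (D.del_mem_aux h)

theorem lmul_del (i : Fin (n + 1)) (x : D.carrier) :
    D.lmul i (D.del x) + D.del (D.lmul i x) = 0 := by
  refine D.isGrading.induction_on (P := fun x => D.lmul i (D.del x) + D.del (D.lmul i x) = 0)
    x ?_ (by simp) ?_
  · rintro ⟨a, j⟩ x hx
    rw [D.lmul_apply_of_mem i hx, D.lmul_apply_of_mem i (D.del_mem hx), map_zsmul, map_smul,
      Int.negOnePow_sub, Int.negOnePow_one]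
    simp
  · intro x y hx hy
    simp only [map_add]
    rw [add_add_add_comm, hx, hy, add_zero]

/-- The differential `s ⊗ x ↦ ∑ᵢ xᵢ s ⊗ eᵢ x - s ⊗ ∂x` of `L(D)`. -/
noncomputable def LLd {j l : ℤ} (h : l + 1 = j) :
    PolyS k n ⊗[k] D.aux j →ₗ[PolyS k n] PolyS k n ⊗[k] D.aux l :=
  (∑ i, TensorProduct.AlgebraTensorModule.map
    (LinearMap.mulLeft (PolyS k n) (MvPolynomial.X i)) (D.lmulAux i h)) -
  TensorProduct.AlgebraTensorModule.map LinearMap.id (D.delAux h)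

theorem LLd_tmul {j l : ℤ} (h : l + 1 = j) (s : PolyS k n) (x : D.aux j) :
    D.LLd h (s ⊗ₜ x) = ∑ i, (MvPolynomial.X i * s) ⊗ₜ[k] D.lmulAux i h x -
      s ⊗ₜ[k] D.delAux h x := by
  simp [LLd]

theorem LLd_LLd {j l m : ℤ} (h : l + 1 = j) (h' : m + 1 = l) (x : PolyS k n ⊗[k] D.aux j) :
    D.LLd h' (D.LLd h x) = 0 := by
  induction x using TensorProduct.induction_on with
  | zero => simp
  | add x y hx hy => rw [map_add, map_add, hx, hy, add_zero]
  | tmul s x =>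
    have h0 : D.delAux h' (D.delAux h x) = 0 := Subtype.ext (D.del_del _)
    have h1 : ∀ i, D.delAux h' (D.lmulAux i h x) = -D.lmulAux i h' (D.delAux h x) := fun i =>
      Subtype.ext (eq_neg_of_add_eq_zero_right (D.lmul_del i x))
    rw [LLd_tmul, map_sub, map_sum]
    simp only [LLd_tmul, h0, h1, Finset.sum_add_distrib, TensorProduct.tmul_zero, sub_zero,
      TensorProduct.tmul_neg, sub_neg_eq_add, add_sub_cancel_right]
    refine sum_antisymm (fun i i' => (MvPolynomial.X i' * (MvPolynomial.X i * s)) ⊗ₜ[k]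
      D.lmulAux i' h' (D.lmulAux i h x)) ?_ ?_
    · intro i
      rw [show D.lmulAux i h' (D.lmulAux i h x) = 0 from Subtype.ext (D.lmul_lmul_self i x),
        TensorProduct.tmul_zero]
    · intro i i'
      rw [mul_left_comm, ← TensorProduct.tmul_add,
        show D.lmulAux i' h' (D.lmulAux i h x) + D.lmulAux i h' (D.lmulAux i' h x) = 0 from
          Subtype.ext (D.lmul_lmul_add i' i x), TensorProduct.tmul_zero]

/-- The grading of `⨁ₐ S(-a) ⊗ D_{(a; j)}`, written as `S ⊗ (⨁ₐ D_{(a; j)})`: the element `s ⊗ x`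
has degree `deg s + a` for `x` in `D_{(a; j)}`. -/
noncomputable def LLgr (j : ℤ) : A → Submodule k (PolyS k n ⊗[k] D.aux j) :=
  tensorGr (MvPolynomial.weightedHomogeneousSubmodule k w) (D.auxGr j) fun b a => b + a

theorem LLgr_smul_mem {j : ℤ} {a b : A} {s : PolyS k n} {m : PolyS k n ⊗[k] D.aux j}
    (hs : s ∈ MvPolynomial.weightedHomogeneousSubmodule k w a) (hm : m ∈ D.LLgr j b) :
    s • m ∈ D.LLgr j (a + b) := by
  induction hm using Submodule.span_induction with
  | zero => rw [smul_zero]; exact zero_mem _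
  | add a b _ _ ha hb => rw [smul_add]; exact add_mem ha hb
  | smul r a _ ha => rw [smul_comm]; exact Submodule.smul_mem _ _ ha
  | mem t ht =>
    obtain ⟨c, c', s', hs', x, hx, rfl, rfl⟩ := ht
    have hss : s * s' ∈ MvPolynomial.weightedHomogeneousSubmodule k w (a + c) :=
      MvPolynomial.IsWeightedHomogeneous.mul hs hs'
    have := tmul_mem_tensorGr (fun b a : A => b + a) hss hx
    rw [TensorProduct.smul_tmul', ← add_assoc]
    exact this

theorem LLd_mem {i j : ℤ} (h : j + 1 = i) {a : A} {x : PolyS k n ⊗[k] D.aux i}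
    (hx : x ∈ D.LLgr i a) : D.LLd h x ∈ D.LLgr j a := by
  induction hx using Submodule.span_induction with
  | zero => rw [map_zero]; exact zero_mem _
  | add a b _ _ ha hb => rw [map_add]; exact add_mem ha hb
  | smul r a _ ha => rw [LinearMap.map_smul_of_tower]; exact Submodule.smul_mem _ _ ha
  | mem t ht =>
    obtain ⟨c, c', s, hs, x, hx, rfl, rfl⟩ := ht
    rw [LLd_tmul]
    have hij : i - 1 = j := by omega
    refine sub_mem (Submodule.sum_mem _ fun l _ => ?_) ?_
    · have hx' : D.lmulAux l h x ∈ D.auxGr j (c' - w l) := by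
        have := D.lmul_mem l hx
        rw [hij] at this
        exact this
      have hss : MvPolynomial.X l * s ∈ MvPolynomial.weightedHomogeneousSubmodule k w (w l + c) :=
        MvPolynomial.IsWeightedHomogeneous.mul (X_mem l) hs
      have := tmul_mem_tensorGr (fun b a : A => b + a) hss hx'
      rwa [show w l + c + (c' - w l) = c + c' by abel] at this
    · have hx' : D.delAux h x ∈ D.auxGr j c' := by
        have := D.del_mem hx
        rw [hij] at this
        exact this
      exact tmul_mem_tensorGr (fun b a : A => b + a) hs hx'

/-- The complex `L(D)` of graded `S`-modules, with terms `L(D)_j = ⨁ₐ S(-a) ⊗ D_{(a; j)}` and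
differential `s ⊗ x ↦ ∑ᵢ xᵢ s ⊗ eᵢ x - s ⊗ ∂x`. -/
@[reducible] noncomputable def LL : GrComplex k w where
  X j :=
    { carrier := PolyS k n ⊗[k] D.aux j
      gr := D.LLgr j
      isGrading := (poly_isGrading k w).tensor (D.auxGr_isGrading j) _
      smul_mem := D.LLgr_smul_mem }
  d _ _ h := D.LLd h
  d_mem _ _ h _ _ hx := D.LLd_mem h hx
  d_d _ _ _ h h' x := D.LLd_LLd h h' x

end DM

end BGG

end MultigradedBGG

open MultigradedBGG

/-! Write 𝔪 for the ideal (x₀, …, xₙ). Two descriptions carry the proof. First, ω_E ⊗ N is Hom_k(E,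
N), so an element of K_d(M) is a functional φ : E → M_d with ∑ xᵢ φ(eᵢ z) = 0 for all z. Its value
on a monomial is, up to sign, the value at 1 of a product of the eᵢ with φ. Hence an element of
auxiliary degree j ≠ 0 killed by all eᵢ is zero, an element of auxiliary degree 0 is determined by
its value at 1, and nothing lives in negative auxiliary degree (`KK_aux_ext`). Second, a strongly
linear complex is S ⊗ V with differential v ↦ ∑ xₚ Tₚ(v), and d² = 0 says exactly that the Tₚ
anticommute and square to zero (`IsLinearFrame`), so V is a graded E-module.

Coinduction gives maps into K_d(M): a map V₀ → M_d respecting the linear relations extends to V →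
K_d(M) by letting x act as the functional z ↦ ε((x z)₀). For a strongly linear, quasi-split
subcomplex of F the resulting map is injective, by induction on the homological degree: a frame
vector in its kernel is a cycle of F, so a boundary, so in 𝔪F by minimality, so zero. An injection V
→ K_d(M) of graded spaces gives a quasi-split inclusion of S ⊗ V into L(K_d(M)).

Conversely, exactness of F lifts the evaluation K_d(M)₀ → M to a map of complexes L(K_d(M)) → F, and
the lift can be prescribed on a graded submodule of K_d(M) (`exists_lift_KK`). It is injective
modulo 𝔪: in degree 0 because F₀ is generated in degree d, and then inductively by comparing linear
coefficients, since d(𝔪F) lies in 𝔪²F (`eq_zero_of_mem`). Graded Nakayama turns injectivity modulo 𝔪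
into a splitting; only boundedness of the degrees is used, so the ranks may be infinite.

If a strongly linear, quasi-split subcomplex contains the image of such a split injection, its frame
both contains and embeds into K_d(M), compatibly, and Nakayama gives equality; so the image is
maximal. If L is maximal, extending the inclusion of L to L(K_d(M)) produces an image that contains
L, hence equals it. When F is strongly linear, F itself is the maximal subcomplex. -/

namespace MultigradedBGG

/-! ### Degree-preserving maps of graded vector spaces -/

section GradedMaps

variable {k : Type*} [Field k] {ι κ V W Z : Type*} [AddCommGroup V] [Module k V]
  [AddCommGroup W] [Module k W] [AddCommGroup Z] [Module k Z]

namespace IsGrading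

variable {gr : ι → Submodule k V} {grW : ι → Submodule k W} {grZ : ι → Submodule k Z}

theorem mem_span_proj (h : IsGrading gr) (x : V) :
    x ∈ Submodule.span k (Set.range fun i => h.proj i x) := by
  have := h.mem_iSup_of_proj_mem (P := Submodule.span k (Set.range fun i => h.proj i x)) (x := x)
    fun i => Submodule.subset_span ⟨i, rfl⟩
  exact (iSup_le fun _ => inf_le_left :
    ⨆ i, Submodule.span k (Set.range fun i => h.proj i x) ⊓ gr i ≤ _) this

theorem mem_of_proj (h : IsGrading gr) {i : ι} {x : V} (hx : ∀ j, j ≠ i → h.proj j x = 0) :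
    x ∈ gr i := by
  have h1 := h.mem_span_proj x
  refine (Submodule.span_le.mpr ?_) h1
  rintro _ ⟨j, rfl⟩
  by_cases hj : j = i
  · subst hj
    exact h.proj_mem j x
  · simp [hx j hj]

theorem map_proj {grW : κ → Submodule k W} (hV : IsGrading gr) (hW : IsGrading grW)
    {f : V →ₗ[k] W} {σ : ι → κ} (hσ : Function.Injective σ)
    (hf : ∀ i, ∀ x ∈ gr i, f x ∈ grW (σ i)) (i : ι) (x : V) :
    f (hV.proj i x) = hW.proj (σ i) (f x) := by
  refine hV.induction_on (P := fun x => f (hV.proj i x) = hW.proj (σ i) (f x)) x ?_ (by simp)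
    (fun x y hx hy => by simp only [map_add, hx, hy])
  intro j x hx
  by_cases hj : j = i
  · subst hj
    rw [hV.proj_of_mem hx, hW.proj_of_mem (hf j x hx)]
  · rw [hV.proj_of_mem_of_ne hj hx, map_zero,
      hW.proj_of_mem_of_ne (fun h => hj (hσ h)) (hf j x hx)]

/-- The part of degree zero of a linear map between graded vector spaces. -/
noncomputable def homogenize (hV : IsGrading gr) (hW : IsGrading grW) (f : V →ₗ[k] W) :
    V →ₗ[k] W :=
  Finsupp.lsum k (fun i => hW.proj i ∘ₗ f) ∘ₗ hV.components

theorem homogenize_of_mem (hV : IsGrading gr) (hW : IsGrading grW) (f : V →ₗ[k] W) {i : ι}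
    {x : V} (hx : x ∈ gr i) : hV.homogenize hW f x = hW.proj i (f x) := by
  rw [homogenize, LinearMap.comp_apply, hV.components_of_mem hx, Finsupp.lsum_single]
  rfl

theorem homogenize_mem (hV : IsGrading gr) (hW : IsGrading grW) (f : V →ₗ[k] W) (i : ι)
    (x : V) (hx : x ∈ gr i) : hV.homogenize hW f x ∈ grW i := by
  rw [hV.homogenize_of_mem hW f hx]
  exact hW.proj_mem i _

/-- Vector spaces are projective, so some linear lift exists; its degree-zero part is still a lift
because `g` and `z` preserve degrees. The same correction makes a retraction graded in
`exists_retraction`. -/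
theorem exists_lift (hV : IsGrading gr) (hW : IsGrading grW) (hZ : IsGrading grZ)
    (g : W →ₗ[k] Z) (hg : ∀ i, ∀ x ∈ grW i, g x ∈ grZ i) (z : V →ₗ[k] Z)
    (hz : ∀ i, ∀ x ∈ gr i, z x ∈ grZ i) (hr : ∀ v, ∃ x, g x = z v) :
    ∃ h : V →ₗ[k] W, (∀ i, ∀ x ∈ gr i, h x ∈ grW i) ∧ ∀ v, g (h v) = z v := by
  obtain ⟨h, hh⟩ := Module.projective_lifting_property g.rangeRestrict
    (z.codRestrict (LinearMap.range g) fun v => hr v) g.surjective_rangeRestrict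
  have hh' : ∀ v, g (h v) = z v := fun v => congrArg Subtype.val (LinearMap.congr_fun hh v)
  refine ⟨hV.homogenize hW h, hV.homogenize_mem hW h, fun v => ?_⟩
  refine hV.induction_on (P := fun v => g (hV.homogenize hW h v) = z v) v ?_ (by simp)
    (fun x y hx hy => by simp only [map_add, hx, hy])
  intro i x hx
  rw [hV.homogenize_of_mem hW h hx, hW.map_proj hZ Function.injective_id hg, hh']
  exact hZ.proj_of_mem (hz i x hx)

theorem exists_retraction (hV : IsGrading gr) (hW : IsGrading grW) (g : V →ₗ[k] W)
    (hg : ∀ i, ∀ x ∈ gr i, g x ∈ grW i) (hinj : Function.Injective g) :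
    ∃ r : W →ₗ[k] V, (∀ i, ∀ x ∈ grW i, r x ∈ gr i) ∧ ∀ v, r (g v) = v := by
  obtain ⟨r, hr⟩ := g.exists_leftInverse_of_injective (LinearMap.ker_eq_bot.mpr hinj)
  have hr' : ∀ v, r (g v) = v := fun v => LinearMap.congr_fun hr v
  refine ⟨hW.homogenize hV r, hW.homogenize_mem hV r, fun v => ?_⟩
  refine hV.induction_on (P := fun v => hW.homogenize hV r (g v) = v) v ?_ (by simp)
    (fun x y hx hy => by simp only [map_add, hx, hy])
  intro i x hx
  rw [hW.homogenize_of_mem hV r (hg i x hx), hr', hV.proj_of_mem hx]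

/-- Injectivity suffices: the components of `x` outside degree `i` map to the corresponding
components of `f x`, which vanish. -/
theorem mem_iff_of_bijective (hV : IsGrading gr) (hW : IsGrading grW) {f : V →ₗ[k] W}
    (hinj : Function.Injective f) (hf : ∀ i, ∀ x ∈ gr i, f x ∈ grW i) (i : ι) (x : V) :
    x ∈ gr i ↔ f x ∈ grW i := by
  refine ⟨hf i x, fun hx => hV.mem_of_proj fun j hj => hinj ?_⟩
  rw [hV.map_proj hW Function.injective_id hf, map_zero]
  exact hW.proj_of_mem_of_ne (Ne.symm hj) hx

end IsGrading

/-- A graded vector space has a basis of homogeneous elements. -/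
theorem IsGrading.exists_basis {gr : ι → Submodule k V} (h : IsGrading gr) :
    ∃ (s : Set V) (b : Module.Basis s k V), ∀ i, ∃ a, b i ∈ gr a := by
  classical
  have hi : DirectSum.IsInternal gr :=
    DirectSum.isInternal_submodule_of_iSupIndep_of_iSup_eq_top h.indep h.iSup_eq_top
  let b := hi.collectedBasis fun i => Module.Basis.ofVectorSpace k (gr i)
  refine ⟨Set.range b, b.reindexRange, ?_⟩
  rintro ⟨_, i, rfl⟩
  exact ⟨i.1, by rw [Module.Basis.reindexRange_apply]; exact hi.collectedBasis_mem _ i⟩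

theorem isHomogeneous_of_proj_mem {gr : ι → Submodule k V} (h : IsGrading gr) {P : Submodule k V}
    (hP : ∀ x ∈ P, ∀ i, h.proj i x ∈ P) : IsHomogeneous gr P :=
  fun x hx => h.mem_iSup_of_proj_mem fun i => hP x hx i

theorem isHomogeneous_range {gr : ι → Submodule k V} {grW : ι → Submodule k W} (h : IsGrading gr)
    (hW : IsGrading grW) {f : V →ₗ[k] W} (hf : ∀ i, ∀ x ∈ gr i, f x ∈ grW i) :
    IsHomogeneous grW (LinearMap.range f) := by
  refine isHomogeneous_of_proj_mem hW ?_
  rintro _ ⟨x, rfl⟩ i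
  exact ⟨h.proj i x, h.map_proj hW Function.injective_id hf i x⟩

theorem isHomogeneous_ker {gr : ι → Submodule k V} {grW : ι → Submodule k W} (h : IsGrading gr)
    (hW : IsGrading grW) {f : V →ₗ[k] W} (hf : ∀ i, ∀ x ∈ gr i, f x ∈ grW i) :
    IsHomogeneous gr (LinearMap.ker f) := by
  refine isHomogeneous_of_proj_mem h fun x hx i => ?_
  rw [LinearMap.mem_ker, h.map_proj hW Function.injective_id hf i x, LinearMap.mem_ker.mp hx,
    map_zero]

end GradedMaps

/-! ### Free graded modules as S ⊗ V, and coefficients in V -/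

section Frames

universe v v'

variable {k : Type*} [Field k] {n : ℕ} {A : Type*} [AddCommGroup A] {w : Fin (n + 1) → A}

theorem sub_C_coeff_zero_mem (s : PolyS k n) : s - MvPolynomial.C (s.coeff 0) ∈
    Ideal.span (Set.range (MvPolynomial.X : Fin (n + 1) → PolyS k n)) := by
  rw [← Set.image_univ, MvPolynomial.mem_ideal_span_X_image]
  intro m hm
  by_contra! hm'
  have : m = 0 := by ext i; exact hm' i trivial
  subst this
  simp [MvPolynomial.mem_support_iff] at hm

/-- Membership in the submodule generated by the multiples of the variables. -/
theorem mem_vars_smul_top {X : Type*} [AddCommGroup X] [Module (PolyS k n) X] {x : X} :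
    x ∈ Ideal.span (Set.range (MvPolynomial.X : Fin (n + 1) → PolyS k n)) •
      (⊤ : Submodule (PolyS k n) X) ↔
    ∃ y : Fin (n + 1) → X, x = ∑ i, (MvPolynomial.X i : PolyS k n) • y i := by
  classical
  constructor
  · intro hx
    refine Submodule.smul_induction_on hx ?_ ?_
    · intro r hr m _
      obtain ⟨c, rfl⟩ := (Ideal.mem_span_range_iff_exists_fun).mp hr
      refine ⟨fun i => c i • m, ?_⟩
      rw [Finset.sum_smul]
      exact Finset.sum_congr rfl fun i _ => by rw [mul_comm, mul_smul]
    · rintro _ _ ⟨y, rfl⟩ ⟨y', rfl⟩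
      exact ⟨y + y', by simp [smul_add, Finset.sum_add_distrib]⟩
  · rintro ⟨y, rfl⟩
    exact Submodule.sum_mem _ fun i _ =>
      Submodule.smul_mem_smul (Ideal.subset_span ⟨i, rfl⟩) trivial

theorem map_mem_vars_smul_top {X Y : Type*} [AddCommGroup X] [Module (PolyS k n) X]
    [AddCommGroup Y] [Module (PolyS k n) Y] (f : X →ₗ[PolyS k n] Y) {x : X}
    (hx : x ∈ Ideal.span (Set.range (MvPolynomial.X : Fin (n + 1) → PolyS k n)) •
      (⊤ : Submodule (PolyS k n) X)) :
    f x ∈ Ideal.span (Set.range (MvPolynomial.X : Fin (n + 1) → PolyS k n)) •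
      (⊤ : Submodule (PolyS k n) Y) := by
  obtain ⟨y, rfl⟩ := mem_vars_smul_top.mp hx
  exact mem_vars_smul_top.mpr ⟨fun i => f (y i), by simp⟩

/-- `u : V → X` exhibits the graded module `X` as the free graded module `S ⊗ V` on the graded
vector space `V`. -/
structure GrMod.IsFrame (X : GrMod.{v} k w) {V : Type*} [AddCommGroup V] [Module k V]
    (gr : A → Submodule k V) (u : V →ₗ[k] X) : Prop where
  isGrading : IsGrading gr
  mem : ∀ a, ∀ x ∈ gr a, u x ∈ X.gr a
  bijective : Function.Bijective (u.liftBaseChange (PolyS k n))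

theorem GrMod.liftBaseChange_mem (X : GrMod.{v} k w) {V : Type*} [AddCommGroup V] [Module k V]
    {gr : A → Submodule k V} {u : V →ₗ[k] X} (hu : ∀ a, ∀ x ∈ gr a, u x ∈ X.gr a) (a : A)
    (t : PolyS k n ⊗[k] V)
    (ht : t ∈ tensorGr (MvPolynomial.weightedHomogeneousSubmodule k w) gr (fun b a => b + a) a) :
    u.liftBaseChange (PolyS k n) t ∈ X.gr a := by
  induction ht using Submodule.span_induction with
  | zero => rw [map_zero]; exact zero_mem _
  | add a b _ _ ha hb => rw [map_add]; exact add_mem ha hb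
  | smul r a _ ha => rw [LinearMap.map_smul_of_tower]; exact Submodule.smul_mem _ _ ha
  | mem t ht =>
    obtain ⟨b, c, s, hs, x, hx, rfl, rfl⟩ := ht
    rw [LinearMap.liftBaseChange_tmul]
    exact X.smul_mem hs (hu _ _ hx)

namespace GrMod.IsFrame

variable {X : GrMod.{v} k w} {Y : GrMod.{v'} k w} {V : Type*} [AddCommGroup V] [Module k V]
  {gr : A → Submodule k V} {u : V →ₗ[k] X}

/-- The isomorphism `S ⊗ V ≅ X` given by a frame. -/
noncomputable def equiv (h : X.IsFrame gr u) : (PolyS k n ⊗[k] V) ≃ₗ[PolyS k n] X :=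
  LinearEquiv.ofBijective _ h.bijective

theorem equiv_tmul (h : X.IsFrame gr u) (s : PolyS k n) (x : V) : h.equiv (s ⊗ₜ x) = s • u x :=
  LinearMap.liftBaseChange_tmul _ _ _ _

theorem equiv_symm_smul (h : X.IsFrame gr u) (s : PolyS k n) (x : V) :
    h.equiv.symm (s • u x) = s ⊗ₜ x := by
  rw [← h.equiv_tmul, LinearEquiv.symm_apply_apply]

theorem mem_iff (h : X.IsFrame gr u) (a : A) (t : PolyS k n ⊗[k] V) :
    t ∈ tensorGr (MvPolynomial.weightedHomogeneousSubmodule k w) gr (fun b a => b + a) a ↔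
      h.equiv t ∈ X.gr a :=
  ((poly_isGrading k w).tensor h.isGrading _).mem_iff_of_bijective X.isGrading
    (f := (h.equiv.toLinearMap.restrictScalars k)) h.equiv.injective
    (X.liftBaseChange_mem h.mem) a t

theorem induction_on (h : X.IsFrame gr u) {P : X → Prop} (x : X)
    (smul : ∀ (s : PolyS k n) (v : V), P (s • u v)) (add : ∀ x y, P x → P y → P (x + y)) : P x := by
  rw [← h.equiv.apply_symm_apply x]
  induction h.equiv.symm x using TensorProduct.induction_on with
  | zero => rw [map_zero]; simpa using smul 0 0
  | add x y hx hy => rw [map_add]; exact add _ _ hx hy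
  | tmul s v => rw [h.equiv_tmul]; exact smul s v

theorem linearMap_ext (h : X.IsFrame gr u) {Z : Type*} [AddCommGroup Z] [Module (PolyS k n) Z]
    {f g : X →ₗ[PolyS k n] Z} (hfg : ∀ v, f (u v) = g (u v)) : f = g := by
  ext x
  refine h.induction_on (P := fun x => f x = g x) x (fun s v => ?_)
    (fun x y hx hy => by rw [map_add, map_add, hx, hy])
  rw [map_smul, map_smul, hfg]

/-- The map of graded modules extending a map on a frame. -/
noncomputable def lift (h : X.IsFrame gr u) (g : V →ₗ[k] Y) : X →ₗ[PolyS k n] Y :=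
  g.liftBaseChange (PolyS k n) ∘ₗ h.equiv.symm.toLinearMap

theorem lift_apply (h : X.IsFrame gr u) (g : V →ₗ[k] Y) (x : V) : h.lift g (u x) = g x := by
  have := h.equiv_symm_smul 1 x
  rw [one_smul] at this
  simp [lift, this]

theorem lift_mem (h : X.IsFrame gr u) {g : V →ₗ[k] Y} (hg : ∀ a, ∀ x ∈ gr a, g x ∈ Y.gr a)
    (a : A) (x : X) (hx : x ∈ X.gr a) : h.lift g x ∈ Y.gr a := by
  refine Y.liftBaseChange_mem hg a _ ?_
  rw [h.mem_iff]
  simpa using hx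

/-- The coefficient in `V` of a monomial. -/
noncomputable def coeff (h : X.IsFrame gr u) (m : Fin (n + 1) →₀ ℕ) : X →ₗ[k] V :=
  (TensorProduct.lid k V).toLinearMap ∘ₗ LinearMap.rTensor V (MvPolynomial.lcoeff k m) ∘ₗ
    h.equiv.symm.toLinearMap.restrictScalars k

theorem coeff_smul (h : X.IsFrame gr u) (m : Fin (n + 1) →₀ ℕ) (s : PolyS k n) (x : V) :
    h.coeff m (s • u x) = s.coeff m • x := by
  simp [coeff, h.equiv_symm_smul]

theorem coeff_zero_apply (h : X.IsFrame gr u) (x : V) : h.coeff 0 (u x) = x := by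
  simpa using h.coeff_smul 0 1 x

theorem injective (h : X.IsFrame gr u) : Function.Injective u :=
  Function.LeftInverse.injective h.coeff_zero_apply

theorem coeff_X_smul [DecidableEq (Fin (n + 1))] (h : X.IsFrame gr u) (m : Fin (n + 1) →₀ ℕ)
    (i : Fin (n + 1)) (x : X) :
    h.coeff m ((MvPolynomial.X i : PolyS k n) • x) =
      if i ∈ m.support then h.coeff (m - Finsupp.single i 1) x else 0 := by
  refine h.induction_on (P := fun x => h.coeff m ((MvPolynomial.X i : PolyS k n) • x) =
      if i ∈ m.support then h.coeff (m - Finsupp.single i 1) x else 0) x (fun s v => ?_)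
    (fun x y hx hy => by rw [smul_add, map_add, hx, hy]; split_ifs <;> simp)
  rw [smul_smul, h.coeff_smul, h.coeff_smul, MvPolynomial.coeff_X_mul', ite_smul, zero_smul]

theorem coeff_zero_X_smul (h : X.IsFrame gr u) (i : Fin (n + 1)) (x : X) :
    h.coeff 0 ((MvPolynomial.X i : PolyS k n) • x) = 0 := by
  rw [h.coeff_X_smul]; simp

theorem coeff_single_X_smul (h : X.IsFrame gr u) (i l : Fin (n + 1)) (x : X) :
    h.coeff (Finsupp.single i 1) ((MvPolynomial.X l : PolyS k n) • x) =
      if l = i then h.coeff 0 x else 0 := by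
  rw [h.coeff_X_smul]
  by_cases hl : l = i
  · subst hl; simp
  · simp [hl]

/-- Only the constant term of `y i` can contribute to the coefficient of xᵢ. This is how the
operators of a linear differential are read off. -/
theorem coeff_single_sum (h : X.IsFrame gr u) (i : Fin (n + 1)) (y : Fin (n + 1) → X) :
    h.coeff (Finsupp.single i 1) (∑ l, (MvPolynomial.X l : PolyS k n) • y l) =
      h.coeff 0 (y i) := by
  simp [map_sum, h.coeff_single_X_smul]

/-- Together with `mem_of_coeff_zero`, this identifies 𝔪X with the kernel of the constant
coefficient, so that V is a copy of X/𝔪X. -/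
theorem coeff_zero_of_mem (h : X.IsFrame gr u) {x : X}
    (hx : x ∈ Ideal.span (Set.range (MvPolynomial.X : Fin (n + 1) → PolyS k n)) •
      (⊤ : Submodule (PolyS k n) X)) : h.coeff 0 x = 0 := by
  obtain ⟨y, rfl⟩ := mem_vars_smul_top.mp hx
  simp [map_sum, h.coeff_zero_X_smul]

theorem sub_coeff_zero_mem (h : X.IsFrame gr u) (x : X) :
    x - u (h.coeff 0 x) ∈ Ideal.span (Set.range (MvPolynomial.X : Fin (n + 1) → PolyS k n)) •
      (⊤ : Submodule (PolyS k n) X) := by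
  refine h.induction_on (P := fun x => x - u (h.coeff 0 x) ∈
    Ideal.span (Set.range (MvPolynomial.X : Fin (n + 1) → PolyS k n)) •
      (⊤ : Submodule (PolyS k n) X)) x (fun s v => ?_) (fun x y hx hy => ?_)
  · have := Submodule.smul_mem_smul (sub_C_coeff_zero_mem s) (Submodule.mem_top (x := u v))
    rwa [sub_smul, show (MvPolynomial.C (s.coeff 0) : PolyS k n) • u v = s.coeff 0 • u v by
      rw [← MvPolynomial.algebraMap_eq, algebraMap_smul], ← map_smul u (s.coeff 0), ← h.coeff_smul] at this
  · rw [map_add, map_add, add_sub_add_comm]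
    exact add_mem hx hy

theorem mem_of_coeff_zero (h : X.IsFrame gr u) {x : X} (hx : h.coeff 0 x = 0) :
    x ∈ Ideal.span (Set.range (MvPolynomial.X : Fin (n + 1) → PolyS k n)) •
      (⊤ : Submodule (PolyS k n) X) := by
  simpa [hx] using h.sub_coeff_zero_mem x

/-- A monomial occurs in a homogeneous polynomial only if its weight is the degree of the
polynomial; the remaining degree belongs to the vector in V. -/
theorem coeff_mem (h : X.IsFrame gr u) (m : Fin (n + 1) →₀ ℕ) (a : A) (x : X) (hx : x ∈ X.gr a) :
    h.coeff m x ∈ gr (a - Finsupp.weight w m) := by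
  obtain ⟨t, rfl⟩ := h.equiv.surjective x
  rw [← h.mem_iff] at hx
  induction hx using Submodule.span_induction with
  | zero => simp
  | add a b _ _ ha hb => rw [map_add, map_add]; exact add_mem ha hb
  | smul r a _ ha =>
    rw [← LinearEquiv.coe_coe, LinearMap.map_smul_of_tower, map_smul]; exact Submodule.smul_mem _ _ ha
  | mem t ht =>
    obtain ⟨b, c, s, hs, x, hx, rfl, rfl⟩ := ht
    rw [h.equiv_tmul, h.coeff_smul]
    by_cases hm : s.coeff m = 0
    · rw [hm, zero_smul]; exact zero_mem _
    · have : Finsupp.weight w m = b := hs hm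
      rw [this, add_sub_cancel_left]
      exact Submodule.smul_mem _ _ hx

theorem coeff_zero_mem (h : X.IsFrame gr u) (a : A) (x : X) (hx : x ∈ X.gr a) :
    h.coeff 0 x ∈ gr a := by
  simpa using h.coeff_mem 0 a x hx

theorem coeff_single_mem (h : X.IsFrame gr u) (i : Fin (n + 1)) (a : A) (x : X)
    (hx : x ∈ X.gr a) : h.coeff (Finsupp.single i 1) x ∈ gr (a - w i) := by
  simpa [Finsupp.weight_single] using h.coeff_mem (Finsupp.single i 1) a x hx

end GrMod.IsFrame

/-- The frame given by a homogeneous basis. -/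
theorem GrMod.isFrame_of_basis {X : GrMod.{v} k w} {ι : Type*}
    (b : Module.Basis ι (PolyS k n) X) {deg : ι → A} (hb : ∀ i, b i ∈ X.gr (deg i)) :
    X.IsFrame (fun a => Finsupp.supported k k {i | deg i = a}) (Finsupp.linearCombination k b) := by
  classical
  refine ⟨⟨?_, ?_⟩, ?_, ?_⟩
  · refine iSupIndep_of_proj _
      (fun a => (Finsupp.supported k k {i | deg i = a}).subtype ∘ₗ
        Finsupp.restrictDom k k {i | deg i = a}) ?_ ?_
    · intro a x hx
      ext i
      simp only [LinearMap.comp_apply, Submodule.subtype_apply, Finsupp.restrictDom_apply,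
        Finsupp.filter_apply]
      split_ifs with hi
      · rfl
      · exact ((Finsupp.mem_supported' k x).mp hx i hi).symm
    · intro a b hab x hx
      ext i
      simp only [LinearMap.comp_apply, Submodule.subtype_apply, Finsupp.restrictDom_apply,
        Finsupp.filter_apply]
      split_ifs with hi
      · refine (Finsupp.mem_supported' k x).mp hx i fun h => hab ?_
        exact h.symm.trans hi
      · rfl
  · rw [eq_top_iff]
    rintro x -
    induction x using Finsupp.induction_linear with
    | zero => exact zero_mem _
    | add f g hf hg => exact add_mem hf hg
    | single i r =>
      exact Submodule.mem_iSup_of_mem (deg i) (Finsupp.single_mem_supported k r rfl)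
  · intro a x hx
    rw [Finsupp.linearCombination_apply]
    refine Submodule.sum_mem _ fun i hi => Submodule.smul_mem _ _ ?_
    have : deg i = a := hx hi
    exact this ▸ hb i
  · have : (Finsupp.linearCombination k b).liftBaseChange (PolyS k n) =
        ((Algebra.TensorProduct.basis (PolyS k n)
          (Finsupp.basisSingleOne (R := k) (ι := ι))).equiv b (Equiv.refl ι)).toLinearMap := by
      refine (Algebra.TensorProduct.basis (PolyS k n)
          (Finsupp.basisSingleOne (R := k) (ι := ι))).ext fun i => ?_
      rw [LinearEquiv.coe_coe, Module.Basis.equiv_apply]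
      simp [Algebra.TensorProduct.basis_apply, LinearMap.liftBaseChange_tmul]
    rw [this]
    exact LinearEquiv.bijective _

theorem GrMod.IsFree.exists_isFrame {X : GrMod.{v} k w} (h : X.IsFree) :
    ∃ (ι : Type v) (gr : A → Submodule k (ι →₀ k)) (u : (ι →₀ k) →ₗ[k] X), X.IsFrame gr u := by
  obtain ⟨ι, b, hb⟩ := h
  choose deg hdeg using hb
  exact ⟨ι, _, _, X.isFrame_of_basis b hdeg⟩

end Frames

/-! ### Graded Nakayama lemma and splittings of free modules -/

section Nakayama

universe v v'

variable {k : Type*} [Field k] {n : ℕ} {A : Type*} [AddCommGroup A] {w : Fin (n + 1) → A}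

theorem GrMod.proj_X_smul (X : GrMod.{v} k w) (i : Fin (n + 1)) (a : A) (y : X) :
    X.isGrading.proj a ((MvPolynomial.X i : PolyS k n) • y) =
      (MvPolynomial.X i : PolyS k n) • X.isGrading.proj (a - w i) y := by
  have := X.isGrading.map_proj X.isGrading (f := X.xmul i) (σ := fun b => w i + b)
    (add_right_injective (w i)) (fun b x hx => X.smul_mem (X_mem i) hx) (a - w i) y
  rw [GrMod.xmul_apply, GrMod.xmul_apply, add_sub_cancel] at this
  exact this.symm

theorem GrMod.proj_mem_vars_smul_top (X : GrMod.{v} k w) (a : A) {x : X}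
    (hx : x ∈ Ideal.span (Set.range (MvPolynomial.X : Fin (n + 1) → PolyS k n)) •
      (⊤ : Submodule (PolyS k n) X)) :
    X.isGrading.proj a x ∈ Ideal.span (Set.range (MvPolynomial.X : Fin (n + 1) → PolyS k n)) •
      (⊤ : Submodule (PolyS k n) X) := by
  obtain ⟨y, rfl⟩ := mem_vars_smul_top.mp hx
  refine mem_vars_smul_top.mpr ⟨fun i => X.isGrading.proj (a - w i) (y i), ?_⟩
  rw [map_sum]
  exact Finset.sum_congr rfl fun i _ => X.proj_X_smul i a (y i)

/-- The graded Nakayama lemma. -/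
theorem GrMod.IsBoundedBelow.eq_top {X : GrMod.{v} k w} (hX : X.IsBoundedBelow)
    {P : Submodule (PolyS k n) X} (hP : IsHomogeneous X.gr (P.restrictScalars k))
    (h : ∀ x, ∃ p ∈ P, x - p ∈
      Ideal.span (Set.range (MvPolynomial.X : Fin (n + 1) → PolyS k n)) •
      (⊤ : Submodule (PolyS k n) X)) : P = ⊤ := by
  obtain ⟨θ, hθ, B, hB⟩ := hX
  -- Induction on the distance of θ(a) from the lower bound: modulo `P`, a homogeneous element of
  -- degree a is ∑ xᵢ yᵢ with yᵢ in degree a - deg xᵢ, where θ is strictly smaller.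
  have key : ∀ N : ℕ, ∀ a, θ a < B + N → ∀ x ∈ X.gr a, x ∈ P := by
    intro N
    induction N with
    | zero =>
      intro a ha x hx
      rw [hB a (by simpa using ha)] at hx
      rw [(Submodule.mem_bot k).mp hx]
      exact zero_mem _
    | succ N ih =>
      intro a ha x hx
      obtain ⟨p, hp, hxp⟩ := h x
      obtain ⟨y, hy⟩ := mem_vars_smul_top.mp hxp
      rw [sub_eq_iff_eq_add] at hy
      rw [← X.isGrading.proj_of_mem hx, hy, map_add, map_sum]
      refine add_mem (Submodule.sum_mem _ fun i _ => ?_) (hP.proj_mem X.isGrading a hp)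
      rw [X.proj_X_smul]
      refine P.smul_mem _ (ih (a - w i) ?_ _ (X.isGrading.proj_mem _ _))
      have := hθ i
      rw [map_sub]
      push_cast at ha
      omega
  rw [eq_top_iff]
  rintro x -
  refine X.isGrading.induction_on (P := fun x => x ∈ P) x ?_ (zero_mem _)
    (fun x y hx hy => add_mem hx hy)
  intro a x hx
  refine key (θ a - B + 1).toNat a ?_ x hx
  have := Int.self_le_toNat (θ a - B + 1)
  omega

theorem GrMod.IsBoundedBelow.subsingleton {X : GrMod.{v} k w} (hX : X.IsBoundedBelow)
    (h : ∀ x : X, x ∈ Ideal.span (Set.range (MvPolynomial.X : Fin (n + 1) → PolyS k n)) •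
      (⊤ : Submodule (PolyS k n) X)) : Subsingleton X := by
  have : (⊥ : Submodule (PolyS k n) X) = ⊤ := hX.eq_top
    (isHomogeneous_of_proj_mem X.isGrading fun x hx i => by
      rw [Submodule.restrictScalars_mem, Submodule.mem_bot] at *
      rw [hx, map_zero])
    fun x => ⟨0, zero_mem _, by simpa using h x⟩
  exact (Submodule.subsingleton_iff (PolyS k n)).mp (subsingleton_of_bot_eq_top this)

theorem GrMod.IsBoundedBelow.sub {X : GrMod.{v} k w} (hX : X.IsBoundedBelow)
    {P : Submodule (PolyS k n) X} (hP : IsHomogeneous X.gr (P.restrictScalars k)) :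
    (X.sub P hP).IsBoundedBelow := by
  obtain ⟨θ, hθ, B, hB⟩ := hX
  refine ⟨θ, hθ, B, fun a ha => ?_⟩
  rw [eq_bot_iff]
  intro x hx
  have hx' : (x : X) ∈ X.gr a := hx
  rw [hB a ha] at hx'
  exact Subtype.ext hx'

theorem map_weight_nonneg {θ : A →+ ℤ} (hθ : ∀ i, 0 < θ (w i)) (m : Fin (n + 1) →₀ ℕ) :
    0 ≤ θ (Finsupp.weight w m) := by
  rw [Finsupp.weight_apply, Finsupp.sum, map_sum]
  refine Finset.sum_nonneg fun i _ => ?_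
  rw [map_nsmul]
  exact nsmul_nonneg (hθ i).le _

/-- Monomials have nonnegative θ-degree, so S ⊗ V starts no lower than V. -/
theorem GrMod.IsFrame.isBoundedBelow {X : GrMod.{v} k w} {V : Type*} [AddCommGroup V] [Module k V]
    {gr : A → Submodule k V} {u : V →ₗ[k] X} (h : X.IsFrame gr u) {θ : A →+ ℤ}
    (hθ : ∀ i, 0 < θ (w i)) {B : ℤ} (hB : ∀ a, θ a < B → gr a = ⊥) : X.IsBoundedBelow := by
  refine ⟨θ, hθ, B, fun a ha => ?_⟩
  rw [eq_bot_iff]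
  intro x hx
  obtain ⟨t, rfl⟩ := h.equiv.surjective x
  rw [← h.mem_iff] at hx
  have : tensorGr (MvPolynomial.weightedHomogeneousSubmodule k w) gr (fun b a => b + a) a ≤ ⊥ := by
    refine Submodule.span_le.mpr ?_
    rintro _ ⟨b, c, s, hs, x, hx, hbc, rfl⟩
    rw [SetLike.mem_coe, Submodule.mem_bot]
    by_cases hs0 : s = 0
    · rw [hs0, TensorProduct.zero_tmul]
    · obtain ⟨m, hm⟩ := MvPolynomial.ne_zero_iff.mp hs0
      have hb : Finsupp.weight w m = b := hs hm
      have := map_weight_nonneg hθ m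
      rw [hb] at this
      rw [← hbc, map_add] at ha
      rw [hB c (by omega)] at hx
      rw [(Submodule.mem_bot k).mp hx, TensorProduct.tmul_zero]
  rw [(Submodule.mem_bot k).mp (this hx), map_zero]
  exact zero_mem _

/-- Modulo 𝔪X every element is congruent to one of degree d. Taking components of degree a ≠ d kills
the latter and preserves 𝔪X. -/
theorem GrMod.IsGeneratedInDegree.mem_vars_smul_top {X : GrMod.{v} k w} {d : A}
    (hX : X.IsGeneratedInDegree d) {a : A} (ha : a ≠ d) {x : X} (hx : x ∈ X.gr a) :
    x ∈ Ideal.span (Set.range (MvPolynomial.X : Fin (n + 1) → PolyS k n)) •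
      (⊤ : Submodule (PolyS k n) X) := by
  have key : ∀ x : X, ∃ v ∈ X.gr d, x - v ∈
      Ideal.span (Set.range (MvPolynomial.X : Fin (n + 1) → PolyS k n)) •
      (⊤ : Submodule (PolyS k n) X) := by
    intro x
    have hx : x ∈ Submodule.span (PolyS k n) (X.gr d : Set X) := hX ▸ Submodule.mem_top
    induction hx using Submodule.span_induction with
    | mem v hv => exact ⟨v, hv, by simp⟩
    | zero => exact ⟨0, zero_mem _, by simp⟩
    | add x y _ _ hx hy =>
      obtain ⟨v, hv, hxv⟩ := hx
      obtain ⟨v', hv', hyv⟩ := hy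
      exact ⟨v + v', add_mem hv hv', by rw [add_sub_add_comm]; exact add_mem hxv hyv⟩
    | smul s x _ hx =>
      obtain ⟨v, hv, hxv⟩ := hx
      refine ⟨s.coeff 0 • v, Submodule.smul_mem _ _ hv, ?_⟩
      have h1 := Submodule.smul_mem_smul (sub_C_coeff_zero_mem s) (Submodule.mem_top (x := v))
      rw [sub_smul, ← MvPolynomial.algebraMap_eq, algebraMap_smul] at h1
      have h2 := add_mem (Submodule.smul_mem _ s hxv) h1
      rwa [smul_sub, sub_add_sub_cancel] at h2
  obtain ⟨v, hv, hxv⟩ := key x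
  have := X.proj_mem_vars_smul_top a hxv
  rwa [map_sub, X.isGrading.proj_of_mem hx, X.isGrading.proj_of_mem_of_ne ha.symm hv,
    sub_zero] at this

/-- Nothing lies in θ-degrees below θ(d), whereas an element ∑ xᵢ yᵢ of degree d would need
components of yᵢ in degree d - deg xᵢ. -/
theorem GrMod.IsGeneratedInDegree.eq_zero {X : GrMod.{v} k w} {d : A}
    (hX : X.IsGeneratedInDegree d) {θ : A →+ ℤ} (hθ : ∀ i, 0 < θ (w i)) {x : X} (hx : x ∈ X.gr d)
    (hx' : x ∈ Ideal.span (Set.range (MvPolynomial.X : Fin (n + 1) → PolyS k n)) •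
      (⊤ : Submodule (PolyS k n) X)) : x = 0 := by
  have key : ∀ x : X, ∀ b, θ b < θ d → X.isGrading.proj b x = 0 := by
    intro x
    have hx : x ∈ Submodule.span (PolyS k n) (X.gr d : Set X) := hX ▸ Submodule.mem_top
    induction hx using Submodule.span_induction with
    | mem v hv =>
      intro b hb
      exact X.isGrading.proj_of_mem_of_ne (by rintro rfl; exact lt_irrefl _ hb) hv
    | zero => simp
    | add x y _ _ hx hy => intro b hb; rw [map_add, hx b hb, hy b hb, add_zero]
    | smul s x _ hx =>
      induction s using MvPolynomial.induction_on with
      | C r =>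
        intro b hb
        rw [← MvPolynomial.algebraMap_eq, algebraMap_smul, map_smul, hx b hb, smul_zero]
      | add p q hp hq => intro b hb; rw [add_smul, map_add, hp b hb, hq b hb, add_zero]
      | mul_X p i hp =>
        intro b hb
        rw [mul_comm, mul_smul, X.proj_X_smul, hp, smul_zero]
        have := hθ i
        rw [map_sub]
        omega
  obtain ⟨y, hy⟩ := MultigradedBGG.mem_vars_smul_top.mp hx'
  rw [← X.isGrading.proj_of_mem hx, hy, map_sum]
  refine Finset.sum_eq_zero fun i _ => ?_
  rw [X.proj_X_smul, key, smul_zero]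
  have := hθ i
  rw [map_sub]
  omega

theorem GrMod.IsBoundedBelow.surjective_of_sub_mem {X : GrMod.{v} k w} (hX : X.IsBoundedBelow)
    {g : X →ₗ[PolyS k n] X} (hg : ∀ a, ∀ x ∈ X.gr a, g x ∈ X.gr a)
    (h : ∀ x, x - g x ∈ Ideal.span (Set.range (MvPolynomial.X : Fin (n + 1) → PolyS k n)) •
      (⊤ : Submodule (PolyS k n) X)) : Function.Surjective g :=
  LinearMap.range_eq_top.mp (hX.eq_top
    (isHomogeneous_range X.isGrading X.isGrading (f := g.restrictScalars k) hg)
    fun x => ⟨g x, ⟨x, rfl⟩, h x⟩)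

/-- Nakayama makes `g` surjective, and freeness gives a graded section. The section is again the
identity modulo 𝔪, hence surjective by Nakayama too, and this makes `g` injective. No finiteness of
the rank is needed. -/
theorem GrMod.IsFrame.bijective_of_sub_mem {X : GrMod.{v} k w} {V : Type*} [AddCommGroup V]
    [Module k V] {gr : A → Submodule k V} {u : V →ₗ[k] X} (hu : X.IsFrame gr u)
    (hX : X.IsBoundedBelow)
    {g : X →ₗ[PolyS k n] X} (hg : ∀ a, ∀ x ∈ X.gr a, g x ∈ X.gr a)
    (h : ∀ x, x - g x ∈ Ideal.span (Set.range (MvPolynomial.X : Fin (n + 1) → PolyS k n)) •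
      (⊤ : Submodule (PolyS k n) X)) : Function.Bijective g := by
  have hs := hX.surjective_of_sub_mem hg h
  refine ⟨?_, hs⟩
  obtain ⟨f, hf, hfu⟩ := hu.isGrading.exists_lift X.isGrading X.isGrading (g.restrictScalars k) hg u
    hu.mem (fun v => hs _)
  have hgf : ∀ x, g (hu.lift f x) = x := by
    have : g ∘ₗ hu.lift f = LinearMap.id := hu.linearMap_ext fun v => by
      rw [LinearMap.comp_apply, hu.lift_apply]
      exact hfu v
    exact fun x => LinearMap.congr_fun this x
  have hs' := hX.surjective_of_sub_mem (hu.lift_mem hf) fun x => by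
    have := h (hu.lift f x)
    rw [hgf] at this
    rw [← neg_sub]
    exact neg_mem this
  intro x y hxy
  obtain ⟨x, rfl⟩ := hs' x
  obtain ⟨y, rfl⟩ := hs' y
  rw [hgf, hgf] at hxy
  rw [hxy]

/-- A map of free graded modules which is injective modulo the variables splits. -/
theorem GrMod.IsFrame.exists_splitting {X : GrMod.{v} k w} {Y : GrMod.{v'} k w} {V V' : Type*}
    [AddCommGroup V] [Module k V] [AddCommGroup V'] [Module k V']
    {gr : A → Submodule k V} {u : V →ₗ[k] X} (hu : X.IsFrame gr u)
    {gr' : A → Submodule k V'} {u' : V' →ₗ[k] Y} (hu' : Y.IsFrame gr' u')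
    (hY : Y.IsBoundedBelow) {f : X →ₗ[PolyS k n] Y} (hf : ∀ a, ∀ x ∈ X.gr a, f x ∈ Y.gr a)
    (hinj : ∀ v, f (u v) ∈ Ideal.span (Set.range (MvPolynomial.X : Fin (n + 1) → PolyS k n)) •
      (⊤ : Submodule (PolyS k n) Y) → v = 0) :
    ∃ r : Y →ₗ[PolyS k n] X, (∀ a, ∀ y ∈ Y.gr a, r y ∈ X.gr a) ∧ Function.Bijective (r ∘ₗ f) := by
  let g : V →ₗ[k] V' := hu'.coeff 0 ∘ₗ f.restrictScalars k ∘ₗ u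
  have hg : ∀ a, ∀ x ∈ gr a, g x ∈ gr' a :=
    fun a x hx => hu'.coeff_zero_mem a _ (hf a _ (hu.mem a x hx))
  have hginj : Function.Injective g := by
    rw [injective_iff_map_eq_zero]
    exact fun v hv => hinj v (hu'.mem_of_coeff_zero hv)
  -- The bound passes from Y back to X: a frame vector in a degree where Y vanishes maps to 0, so it
  -- is zero by `hinj`.
  have hX : X.IsBoundedBelow := by
    obtain ⟨θ, hθ, B, hB⟩ := hY
    refine hu.isBoundedBelow hθ (B := B) fun a ha => ?_
    rw [eq_bot_iff]
    intro v hv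
    refine (Submodule.mem_bot k).mpr (hinj v ?_)
    have := hf a _ (hu.mem a v hv)
    rw [hB a ha] at this
    rw [(Submodule.mem_bot k).mp this]
    exact zero_mem _
  obtain ⟨r, hr, hrg⟩ := hu.isGrading.exists_retraction hu'.isGrading g hg hginj
  have hur : ∀ a, ∀ x ∈ gr' a, (u ∘ₗ r) x ∈ X.gr a := fun a x hx => hu.mem a _ (hr a x hx)
  -- The S-linear extension of the retraction on constants need not be a left inverse of `f`; the
  -- composite is the identity modulo 𝔪, hence bijective, which is enough for a splitting.
  refine ⟨hu'.lift (u ∘ₗ r), hu'.lift_mem hur, hu.bijective_of_sub_mem hX ?_ ?_⟩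
  · exact fun a x hx => hu'.lift_mem hur a _ (hf a x hx)
  · intro x
    refine hu.induction_on (P := fun x => x - (hu'.lift (u ∘ₗ r) ∘ₗ f) x ∈
      Ideal.span (Set.range (MvPolynomial.X : Fin (n + 1) → PolyS k n)) •
      (⊤ : Submodule (PolyS k n) X)) x (fun s v => ?_) (fun x y hx hy => ?_)
    · rw [map_smul, ← smul_sub]
      refine Submodule.smul_mem _ _ ?_
      have h1 := map_mem_vars_smul_top (hu'.lift (u ∘ₗ r)) (hu'.sub_coeff_zero_mem (f (u v)))
      rw [map_sub, hu'.lift_apply, LinearMap.comp_apply, show hu'.coeff 0 (f (u v)) = g v from rfl,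
        hrg] at h1
      rw [← neg_sub]
      exact neg_mem h1
    · rw [map_add, add_sub_add_comm]
      exact add_mem hx hy

theorem isCompl_range_ker {R X Y : Type*} [Ring R] [AddCommGroup X] [Module R X] [AddCommGroup Y]
    [Module R Y] {f : X →ₗ[R] Y} {r : Y →ₗ[R] X} (h : Function.Bijective (r ∘ₗ f)) :
    IsCompl (LinearMap.range f) (LinearMap.ker r) := by
  refine ⟨?_, ?_⟩
  · rw [Submodule.disjoint_def]
    rintro _ ⟨x, rfl⟩ hx
    have : (r ∘ₗ f) x = (r ∘ₗ f) 0 := by rw [map_zero]; exact hx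
    rw [h.1 this, map_zero]
  · rw [codisjoint_iff, eq_top_iff]
    rintro y -
    obtain ⟨x, hx⟩ := h.2 (r y)
    rw [← add_sub_cancel (f x) y]
    refine Submodule.add_mem_sup ⟨x, rfl⟩ ?_
    rw [LinearMap.mem_ker, map_sub, ← hx, LinearMap.comp_apply, sub_self]

end Nakayama

/-! ### Linear complexes and anticommuting operators -/

section LinearComplexes

universe v v'

variable {k : Type*} [Field k] {n : ℕ} {A : Type*} [AddCommGroup A] {w : Fin (n + 1) → A}

namespace GrComplex

theorem IsIso.symm {C : GrComplex.{v} k w} {C' : GrComplex.{v'} k w} (h : C.IsIso C') :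
    C'.IsIso C := by
  obtain ⟨f, hf, hd⟩ := h
  refine ⟨fun j => (f j).symm, fun j a x => ?_, fun i j h x => ?_⟩
  · rw [hf, LinearEquiv.apply_symm_apply]
  · rw [LinearEquiv.symm_apply_eq, hd, LinearEquiv.apply_symm_apply]

/-- A map of complexes of graded modules. -/
structure Hom (C : GrComplex.{v} k w) (C' : GrComplex.{v'} k w) where
  f : ∀ j, C.X j →ₗ[PolyS k n] C'.X j
  mem : ∀ j a, ∀ x ∈ (C.X j).gr a, f j x ∈ (C'.X j).gr a
  comm : ∀ i j h x, f j (C.d i j h x) = C'.d i j h (f i x)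

namespace Hom

variable {C : GrComplex.{v} k w} {C' : GrComplex.{v'} k w}

/-- The image of a map of complexes. -/
@[reducible] noncomputable def range (φ : Hom C C') : C'.Subcomplex where
  P j := LinearMap.range (φ.f j)
  homogeneous j := isHomogeneous_range (C.X j).isGrading (C'.X j).isGrading
    (f := (φ.f j).restrictScalars k) (φ.mem j)
  d_mem i j h := by
    rintro _ ⟨x, rfl⟩
    exact ⟨C.d i j h x, φ.comm i j h x⟩

theorem isIso_of_range_eq (φ : Hom C C') (hinj : ∀ j, Function.Injective (φ.f j))
    {L : C'.Subcomplex} (hL : ∀ j, L.P j = LinearMap.range (φ.f j)) : C.IsIso L.toComplex := by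
  have hmem : ∀ j x, φ.f j x ∈ L.P j := fun j x => by rw [hL]; exact ⟨x, rfl⟩
  refine ⟨fun j => LinearEquiv.ofBijective ((φ.f j).codRestrict (L.P j) (hmem j)) ⟨?_, ?_⟩, ?_, ?_⟩
  · intro x y hxy
    exact hinj j (congrArg Subtype.val hxy)
  · rintro ⟨y, hy⟩
    have hy' := hy
    rw [hL] at hy'
    obtain ⟨x, rfl⟩ := hy'
    exact ⟨x, rfl⟩
  · intro j a x
    exact (C.X j).isGrading.mem_iff_of_bijective (C'.X j).isGrading
      (f := (φ.f j).restrictScalars k) (hinj j) (φ.mem j) a x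
  · intro i j h x
    exact Subtype.ext (φ.comm i j h x)

theorem range_isQuasiSplit (φ : Hom C C')
    (hs : ∀ j, ∃ r : C'.X j →ₗ[PolyS k n] C.X j, (∀ a, ∀ y ∈ (C'.X j).gr a, r y ∈ (C.X j).gr a) ∧
      Function.Bijective (r ∘ₗ φ.f j)) : φ.range.IsQuasiSplit := by
  intro j
  obtain ⟨r, hr, hb⟩ := hs j
  exact ⟨LinearMap.ker r, isHomogeneous_ker (C'.X j).isGrading (C.X j).isGrading
    (f := r.restrictScalars k) hr, isCompl_range_ker hb⟩

end Hom

/-- Compatible frames of the terms of a complex in which the differential is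
`v ↦ ∑ᵢ xᵢ (Tᵢ v)`. -/
structure IsLinearFrame (C : GrComplex.{v} k w) {V : ℤ → Type*} [∀ j, AddCommGroup (V j)]
    [∀ j, Module k (V j)] (gr : ∀ j, A → Submodule k (V j)) (u : ∀ j, V j →ₗ[k] C.X j)
    (T : Fin (n + 1) → ∀ {j l : ℤ}, l + 1 = j → (V j →ₗ[k] V l)) : Prop where
  frame : ∀ j, (C.X j).IsFrame (gr j) (u j)
  d_apply : ∀ i j h x, C.d i j h (u i x) = ∑ p, (MvPolynomial.X p : PolyS k n) • u j (T p h x)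

namespace IsLinearFrame

variable {C : GrComplex.{v} k w} {V : ℤ → Type*} [∀ j, AddCommGroup (V j)]
  [∀ j, Module k (V j)] {gr : ∀ j, A → Submodule k (V j)} {u : ∀ j, V j →ₗ[k] C.X j}
  {T : Fin (n + 1) → ∀ {j l : ℤ}, l + 1 = j → (V j →ₗ[k] V l)}

theorem of_isIso (hC : C.IsLinearFrame gr u T) {C' : GrComplex.{v'} k w} (h : C.IsIso C') :
    ∃ u' : ∀ j, V j →ₗ[k] C'.X j, C'.IsLinearFrame gr u' T := by
  obtain ⟨f, hf, hd⟩ := h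
  refine ⟨fun j => (f j).toLinearMap.restrictScalars k ∘ₗ u j, fun j => ⟨(hC.frame j).isGrading,
    fun a x hx => (hf j a _).mp ((hC.frame j).mem a x hx), ?_⟩, fun i j h x => ?_⟩
  · have : ((f j).toLinearMap.restrictScalars k ∘ₗ u j).liftBaseChange (PolyS k n) =
        (f j).toLinearMap ∘ₗ (u j).liftBaseChange (PolyS k n) := by
      refine TensorProduct.AlgebraTensorModule.ext fun s x => ?_
      simp
    rw [this]
    exact (f j).bijective.comp (hC.frame j).bijective
  · have := hd i j h (u i x)
    rw [hC.d_apply, map_sum] at this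
    simp only [map_smul] at this
    exact this.symm

/-- Since the differential raises polynomial degree by exactly one, the xₚ-coefficient of d y
depends only on the constant term of y. In particular the operators are determined by the
differential and inherit its homogeneity. -/
theorem apply_coeff_zero (hC : C.IsLinearFrame gr u T) (p : Fin (n + 1)) {j l : ℤ} (h : l + 1 = j)
    (y : C.X j) : T p h ((hC.frame j).coeff 0 y) =
      (hC.frame l).coeff (Finsupp.single p 1) (C.d j l h y) := by
  refine (hC.frame j).induction_on (P := fun y => T p h ((hC.frame j).coeff 0 y) =
      (hC.frame l).coeff (Finsupp.single p 1) (C.d j l h y)) y (fun s x => ?_)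
    (fun x y hx hy => by simp only [map_add, hx, hy])
  rw [map_smul (C.d j l h), hC.d_apply, (hC.frame j).coeff_smul, map_smul, Finset.smul_sum]
  simp only [smul_comm s]
  rw [(hC.frame l).coeff_single_sum, (hC.frame l).coeff_smul]

theorem eq_coeff (hC : C.IsLinearFrame gr u T) (p : Fin (n + 1)) {j l : ℤ} (h : l + 1 = j)
    (x : V j) : T p h x = (hC.frame l).coeff (Finsupp.single p 1) (C.d j l h (u j x)) := by
  rw [← hC.apply_coeff_zero, (hC.frame j).coeff_zero_apply]

theorem apply_mem (hC : C.IsLinearFrame gr u T) (p : Fin (n + 1)) {j l : ℤ} (h : l + 1 = j)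
    (a : A) (x : V j) (hx : x ∈ gr j a) : T p h x ∈ gr l (a - w p) := by
  rw [hC.eq_coeff]
  exact (hC.frame l).coeff_single_mem p a _ (C.d_mem j l h a _ ((hC.frame j).mem a x hx))

theorem sum_sum_eq_zero (hC : C.IsLinearFrame gr u T) {j l m : ℤ} (h : l + 1 = j) (h' : m + 1 = l)
    (x : V j) : ∑ q, (MvPolynomial.X q : PolyS k n) •
      ∑ p, (MvPolynomial.X p : PolyS k n) • u m (T p h' (T q h x)) = 0 := by
  have := C.d_d j l m h h' (u j x)
  rw [hC.d_apply, map_sum] at this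
  simpa only [map_smul, hC.d_apply] using this

/-- This is the coefficient of xₚ² in d² = 0. -/
theorem apply_apply_self (hC : C.IsLinearFrame gr u T) {j l m : ℤ} (h : l + 1 = j)
    (h' : m + 1 = l) (p : Fin (n + 1)) (x : V j) : T p h' (T p h x) = 0 := by
  classical
  have := congrArg ((hC.frame m).coeff (Finsupp.single p 1 + Finsupp.single p 1))
    (hC.sum_sum_eq_zero h h' x)
  rw [map_sum, map_zero, Finset.sum_eq_single p] at this
  · rw [(hC.frame m).coeff_X_smul, if_pos (by simp), add_tsub_cancel_right,
      (hC.frame m).coeff_single_sum, (hC.frame m).coeff_zero_apply] at this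
    exact this
  · intro q _ hq
    rw [(hC.frame m).coeff_X_smul, if_neg]
    simp [hq.symm]
  · simp

/-- For p ≠ q this is the coefficient of xₚ x_q in d² = 0, to which the two orders of multiplication
contribute. -/
theorem apply_apply_add (hC : C.IsLinearFrame gr u T) {j l m : ℤ} (h : l + 1 = j)
    (h' : m + 1 = l) (p q : Fin (n + 1)) (x : V j) :
    T p h' (T q h x) + T q h' (T p h x) = 0 := by
  classical
  by_cases hpq : p = q
  · subst hpq
    rw [hC.apply_apply_self, add_zero]
  have := congrArg ((hC.frame m).coeff (Finsupp.single p 1 + Finsupp.single q 1))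
    (hC.sum_sum_eq_zero h h' x)
  rw [map_sum, map_zero, Finset.sum_eq_add q p (Ne.symm hpq)] at this
  · rw [(hC.frame m).coeff_X_smul, (hC.frame m).coeff_X_smul,
      if_pos (by simp), if_pos (by simp), add_tsub_cancel_right, add_tsub_cancel_left,
      (hC.frame m).coeff_single_sum, (hC.frame m).coeff_zero_apply,
      (hC.frame m).coeff_single_sum, (hC.frame m).coeff_zero_apply] at this
    exact this
  · rintro r _ ⟨hq, hp⟩
    rw [(hC.frame m).coeff_X_smul, if_neg]
    simp [hp.symm, hq.symm]
  · simp
  · simp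

theorem isStronglyLinear (hC : C.IsLinearFrame gr u T) : C.IsStronglyLinear := by
  choose s b hb using fun j => (hC.frame j).isGrading.exists_basis
  let b' : ∀ j, Module.Basis (s j) (PolyS k n) (C.X j) := fun j =>
    (Algebra.TensorProduct.basis (PolyS k n) (b j)).map (hC.frame j).equiv
  have hb' : ∀ j i, b' j i = u j (b j i) := fun j i => by
    simp only [b', Module.Basis.map_apply, Algebra.TensorProduct.basis_apply,
      (hC.frame j).equiv_tmul, one_smul]
  have hrepr : ∀ j x t, (b' j).repr (u j x) t = MvPolynomial.C ((b j).repr x t) := by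
    intro j x t
    have : (hC.frame j).equiv.symm (u j x) = 1 ⊗ₜ[k] x := by
      simpa using (hC.frame j).equiv_symm_smul 1 x
    simp [b', this, Algebra.TensorProduct.basis_repr_tmul, MvPolynomial.algebraMap_eq]
  -- Indexing the basis by its set of vectors puts the index type in the universe of `C.X j`, as
  -- `IsStronglyLinear` demands.
  refine ⟨fun j => Set.range (b' j), fun j => (b' j).reindexRange, ?_, ?_⟩
  · rintro j ⟨_, i, rfl⟩
    obtain ⟨a, ha⟩ := hb j i
    refine ⟨a, ?_⟩
    rw [Module.Basis.reindexRange_apply]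
    change b' j i ∈ _
    rw [hb']
    exact (hC.frame j).mem a _ ha
  · rintro i j h ⟨_, p, rfl⟩ ⟨_, q, rfl⟩
    rw [Module.Basis.reindexRange_repr, Module.Basis.reindexRange_apply]
    change ((b' j).repr (C.d i j h (b' i p))) q ∈ _
    rw [hb', hC.d_apply, map_sum, Finsupp.finsetSum_apply]
    refine Submodule.sum_mem _ fun r _ => ?_
    rw [map_smul, Finsupp.smul_apply, hrepr, smul_eq_mul, mul_comm, ← MvPolynomial.smul_eq_C_mul]
    exact Submodule.smul_mem _ _ (Submodule.subset_span ⟨r, rfl⟩)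

end IsLinearFrame

/-- The k-span of the given homogeneous basis is the frame, and `T p` extracts the xₚ-coefficient of
the differential on it; the entries being linear forms, nothing else is left of the differential. -/
theorem IsStronglyLinear.exists_isLinearFrame {C : GrComplex.{v} k w} (hC : C.IsStronglyLinear) :
    ∃ (ι : ℤ → Type v) (gr : ∀ j, A → Submodule k (ι j →₀ k)) (u : ∀ j, (ι j →₀ k) →ₗ[k] C.X j)
      (T : Fin (n + 1) → ∀ {j l : ℤ}, l + 1 = j → ((ι j →₀ k) →ₗ[k] (ι l →₀ k))),
      C.IsLinearFrame gr u T := by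
  obtain ⟨ι, b, hb, hd⟩ := hC
  choose deg hdeg using hb
  have hfr := fun j => GrMod.isFrame_of_basis (b j) (hdeg j)
  refine ⟨ι, _, _, fun p {j l} h => (hfr l).coeff (Finsupp.single p 1) ∘ₗ
    (C.d j l h).restrictScalars k ∘ₗ Finsupp.linearCombination k (b j), hfr, ?_⟩
  intro i j h x
  -- A linear form is the sum of its xₚ-coefficients times xₚ, here with a frame vector as second
  -- factor.
  have key : ∀ s ∈ Submodule.span k (Set.range (MvPolynomial.X : Fin (n + 1) → PolyS k n)),
      ∀ t : ι j →₀ k, s • Finsupp.linearCombination k (b j) t =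
        ∑ p, (MvPolynomial.X p : PolyS k n) • Finsupp.linearCombination k (b j)
          ((hfr j).coeff (Finsupp.single p 1) (s • Finsupp.linearCombination k (b j) t)) := by
    intro s hs t
    induction hs using Submodule.span_induction with
    | zero => simp
    | add x y _ _ hx hy =>
      rw [add_smul]
      simp only [map_add, smul_add, Finset.sum_add_distrib]
      rw [← hx, ← hy]
    | smul r x _ hx =>
      rw [smul_assoc]
      simp only [map_smul, smul_comm _ r]
      rw [← Finset.smul_sum, ← hx]
    | mem s hs =>
      obtain ⟨q, rfl⟩ := hs
      rw [Finset.sum_eq_single q]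
      · rw [(hfr j).coeff_single_X_smul, if_pos rfl, (hfr j).coeff_zero_apply]
      · intro p _ hp
        rw [(hfr j).coeff_single_X_smul, if_neg (Ne.symm hp), map_zero, smul_zero]
      · simp
  simp only [LinearMap.comp_apply, LinearMap.restrictScalars_apply]
  induction x using Finsupp.induction_linear with
  | zero => simp
  | add f g hf hg =>
    simp only [map_add, smul_add, Finset.sum_add_distrib]
    rw [← hf, ← hg]
  | single s r =>
    rw [Finsupp.linearCombination_single, LinearMap.map_smul_of_tower]
    simp only [map_smul, smul_comm _ r]
    rw [← Finset.smul_sum]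
    congr 1
    have hsum := (b j).linearCombination_repr (C.d i j h (b i s))
    rw [Finsupp.linearCombination_apply, Finsupp.sum] at hsum
    rw [← hsum]
    simp only [map_sum, Finset.smul_sum]
    rw [Finset.sum_comm]
    refine Finset.sum_congr rfl fun t _ => ?_
    have := key _ (hd i j h s t) (Finsupp.single t 1)
    rwa [Finsupp.linearCombination_single, one_smul] at this

end GrComplex

theorem DM.lmulAux_mem (D : DM.{v} k w) (i : Fin (n + 1)) {j l : ℤ} (h : l + 1 = j) {a : A}
    {x : D.aux j} (hx : x ∈ D.auxGr j a) : D.lmulAux i h x ∈ D.auxGr l (a - w i) := by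
  have := D.lmul_mem i hx
  rwa [show j - 1 = l by omega] at this

/-- With ∂ = 0 only the terms xᵢ s ⊗ eᵢ x of the differential remain, so the vectors 1 ⊗ x form a
frame whose operators are left multiplications by the eᵢ. -/
theorem DM.LL_isLinearFrame (D : DM.{v} k w) (hD : D.del = 0) :
    D.LL.IsLinearFrame D.auxGr (fun j => TensorProduct.mk k (PolyS k n) (D.aux j) 1)
      (fun i => D.lmulAux i) := by
  refine ⟨fun j => ⟨D.auxGr_isGrading j, fun a x hx => ?_, ?_⟩, fun i j h x => ?_⟩
  · have h1 : (1 : PolyS k n) ∈ MvPolynomial.weightedHomogeneousSubmodule k w 0 :=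
      MvPolynomial.isWeightedHomogeneous_one k w
    have := tmul_mem_tensorGr (fun b a : A => b + a) h1 hx
    rwa [zero_add] at this
  · have : (TensorProduct.mk k (PolyS k n) (D.aux j) 1).liftBaseChange (PolyS k n) =
        LinearMap.id := by
      refine TensorProduct.AlgebraTensorModule.ext fun s x => ?_
      simp [TensorProduct.smul_tmul']
    exact this ▸ Function.bijective_id
  · have h0 : D.delAux h x = 0 := Subtype.ext (by
      change D.del _ = 0
      rw [hD]; rfl)
    change D.LLd h (1 ⊗ₜ x) = _
    rw [D.LLd_tmul, h0, TensorProduct.tmul_zero, sub_zero]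
    exact Finset.sum_congr rfl fun p _ => by
      rw [TensorProduct.mk_apply, TensorProduct.smul_tmul']
      rfl

end LinearComplexes

/-! ### K_d(M) as a space of functionals on E -/

section Kernel

universe v v'

variable {k : Type*} [Field k] {n : ℕ} {A : Type*} [AddCommGroup A] {w : Fin (n + 1) → A}

theorem Ext.linearMap_ext {N : Type*} [AddCommGroup N] [Module k N] {f g : Ext k n →ₗ[k] N}
    (h : ∀ l : List (Fin (n + 1)), f (l.map (e k)).prod = g (l.map (e k)).prod) : f = g := by
  -- The weights are irrelevant: any grading of this form shows that the monomials in the eᵢ span E.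
  refine (extGr_isGrading k (fun _ : Fin (n + 1) => (0 : ℤ))).linearMap_ext fun p x hx => ?_
  induction hx using Submodule.span_induction with
  | mem y hy =>
    obtain ⟨l, -, rfl⟩ := hy
    exact h l
  | zero => simp
  | add x y _ _ hx hy => rw [map_add, map_add, hx, hy]
  | smul r x _ hx => rw [map_smul, map_smul, hx]

theorem one_mem_extGr : (1 : Ext k n) ∈ extGr k w 0 :=
  Submodule.subset_span ⟨[], by simp, by simp⟩

/-- The isomorphism `ω_E ⊗ N ≅ Hom_k(E, N)`. -/
noncomputable def omegaHom (N : Type*) [AddCommGroup N] [Module k N] :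
    (Omega k n ⊗[k] N) ≃ₗ[k] (Ext k n →ₗ[k] N) :=
  (TensorProduct.congr (Omega.toDual k) (LinearEquiv.refl k N)).trans
    (dualTensorHomEquiv k (Ext k n) N)

theorem omegaHom_tmul {N : Type*} [AddCommGroup N] [Module k N] (f : Omega k n) (m : N)
    (z : Ext k n) : omegaHom N (f ⊗ₜ m) z = Omega.toDual k f z • m := by
  simp [omegaHom, dualTensorHomEquiv, dualTensorHom_apply]

theorem omegaHom_lTensor {N N' : Type*} [AddCommGroup N] [Module k N] [AddCommGroup N']
    [Module k N'] (g : N →ₗ[k] N') (t : Omega k n ⊗[k] N) (z : Ext k n) :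
    omegaHom N' (LinearMap.lTensor (Omega k n) g t) z = g (omegaHom N t z) := by
  induction t using TensorProduct.induction_on with
  | zero => simp
  | add x y hx hy => simp only [map_add, LinearMap.add_apply, hx, hy]
  | tmul f m => simp [omegaHom_tmul]

variable (M : GrMod.{v} k w)

theorem omegaHom_op_smul (y : Ext k n) (t : (RR M).carrier) (z : Ext k n) :
    omegaHom (k := k) (n := n) M.carrier (MulOpposite.op y • t) z =
      omegaHom (k := k) (n := n) M.carrier t (y * z) := by
  induction t using TensorProduct.induction_on with
  | zero => simp
  | add x y hx hy => simp only [smul_add, map_add, LinearMap.add_apply, hx, hy]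
  | tmul f m =>
    rw [TensorProduct.smul_tmul', omegaHom_tmul, omegaHom_tmul, Omega.toDual_smul]
    rfl

theorem RR_lmul_tmul (i : Fin (n + 1)) (f : omegaE k w) (m : M) :
    (RR M).lmul i (f ⊗ₜ[k] m) = (omegaE k w).lmul i f ⊗ₜ[k] m := by
  refine (omegaE k w).isGrading.induction_on (P := fun f =>
    (RR M).lmul i (f ⊗ₜ[k] m) = (omegaE k w).lmul i f ⊗ₜ[k] m) f ?_ ?_ ?_
  · intro p f hf
    refine M.isGrading.induction_on (P := fun m =>
      (RR M).lmul i (f ⊗ₜ[k] m) = (omegaE k w).lmul i f ⊗ₜ[k] m) m ?_ ?_ ?_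
    · intro a m hm
      have := tmul_mem_tensorGr (fun (p : A × ℤ) (a : A) => (p.1 + a, p.2)) hf hm
      rw [(RR M).lmul_apply_of_mem i this, (omegaE k w).lmul_apply_of_mem i hf,
        TensorProduct.smul_tmul']
      exact TensorProduct.smul_tmul' _ _ _
    · rw [TensorProduct.tmul_zero, map_zero, TensorProduct.tmul_zero]
    · intro x y hx hy
      rw [TensorProduct.tmul_add, map_add, hx, hy, TensorProduct.tmul_add]
  · rw [TensorProduct.zero_tmul, map_zero, map_zero, TensorProduct.zero_tmul]
  · intro x y hx hy
    rw [TensorProduct.add_tmul, map_add, hx, hy, map_add, TensorProduct.add_tmul]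

theorem omegaHom_RRdel (t : (RR M).carrier) (z : Ext k n) :
    omegaHom (k := k) (n := n) M.carrier (RRdel M t) z = ∑ i, (MvPolynomial.X i : PolyS k n) •
      omegaHom (k := k) (n := n) M.carrier ((RR M).lmul i t) z := by
  induction t using TensorProduct.induction_on with
  | zero => simp
  | add x y hx hy =>
    simp only [map_add, LinearMap.add_apply, hx, hy, smul_add, Finset.sum_add_distrib]
  | tmul f m =>
    rw [RRdel_tmul, map_sum, LinearMap.sum_apply]
    refine Finset.sum_congr rfl fun i _ => ?_
    rw [RR_lmul_tmul, omegaHom_tmul, omegaHom_tmul, smul_comm]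

theorem omegaHom_lmul {p : A × ℤ} {t : (RR M).carrier} (ht : t ∈ (RR M).gr p)
    (i : Fin (n + 1)) (z : Ext k n) :
    omegaHom (k := k) (n := n) M.carrier ((RR M).lmul i t) z =
      (p.2.negOnePow : ℤ) • omegaHom (k := k) (n := n) M.carrier t (e k i * z) := by
  rw [(RR M).lmul_apply_of_mem i ht, map_zsmul, LinearMap.smul_apply, omegaHom_op_smul]

theorem omegaHom_eq_zero {p : A × ℤ} {t : (RR M).carrier} (ht : t ∈ (RR M).gr p) {q : A × ℤ}
    {z : Ext k n} (hz : z ∈ extGr k w q) (hq : q.2 ≠ -p.2) :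
    omegaHom (k := k) (n := n) M.carrier t z = 0 := by
  induction ht using Submodule.span_induction with
  | zero => simp
  | add x y _ _ hx hy => rw [map_add, LinearMap.add_apply, hx, hy, add_zero]
  | smul r x _ hx => rw [map_smul, LinearMap.smul_apply, hx, smul_zero]
  | mem t ht =>
    obtain ⟨p', b, f, hf, m, hm, rfl, rfl⟩ := ht
    rw [omegaHom_tmul, hf q (fun h => hq (by rw [h]; rfl)) z hz, zero_smul]

theorem omegaHom_mem {p : A × ℤ} {t : (RR M).carrier} (ht : t ∈ (RR M).gr p) {q : A × ℤ}
    {z : Ext k n} (hz : z ∈ extGr k w q) :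
    omegaHom (k := k) (n := n) M.carrier t z ∈ M.gr (p.1 + q.1) := by
  induction ht using Submodule.span_induction with
  | zero => simp
  | add x y _ _ hx hy => rw [map_add, LinearMap.add_apply]; exact add_mem hx hy
  | smul r x _ hx => rw [map_smul, LinearMap.smul_apply]; exact Submodule.smul_mem _ _ hx
  | mem t ht =>
    obtain ⟨p', b, f, hf, m, hm, rfl, rfl⟩ := ht
    rw [omegaHom_tmul]
    by_cases hq : q = -p'
    · subst hq
      refine Submodule.smul_mem _ _ ?_
      simpa using hm
    · rw [hf q hq z hz, zero_smul]
      exact zero_mem _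

theorem omegaHom_proj (t : (RR M).carrier) (p : A × ℤ) {q : A × ℤ} {z : Ext k n}
    (hz : z ∈ extGr k w q) :
    omegaHom (k := k) (n := n) M.carrier ((RR M).isGrading.proj p t) z =
      if q.2 = -p.2 then M.isGrading.proj (p.1 + q.1)
        (omegaHom (k := k) (n := n) M.carrier t z) else 0 := by
  refine (RR M).isGrading.induction_on (P := fun t =>
    omegaHom (k := k) (n := n) M.carrier ((RR M).isGrading.proj p t) z =
      if q.2 = -p.2 then M.isGrading.proj (p.1 + q.1)
        (omegaHom (k := k) (n := n) M.carrier t z) else 0) t ?_ (by simp) ?_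
  · intro p' t ht
    by_cases hp : p' = p
    · subst hp
      rw [(RR M).isGrading.proj_of_mem ht]
      split_ifs with hq
      · rw [M.isGrading.proj_of_mem (omegaHom_mem M ht hz)]
      · exact omegaHom_eq_zero M ht hz hq
    · rw [(RR M).isGrading.proj_of_mem_of_ne hp ht, map_zero, LinearMap.zero_apply]
      split_ifs with hq
      · by_cases h2 : p'.2 = p.2
        · rw [M.isGrading.proj_of_mem_of_ne _ (omegaHom_mem M ht hz)]
          exact fun h => hp (Prod.ext (add_right_cancel h) h2)
        · rw [omegaHom_eq_zero M ht hz, map_zero]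
          rw [hq]
          exact fun h => h2 (neg_injective h).symm
      · rfl
  · intro x y hx hy
    simp only [map_add, LinearMap.add_apply, hx, hy]
    split_ifs <;> simp

/-- Degrees in R(M) can be tested on values: the conditions force every component of `t` other than
the one of degree p to vanish on homogeneous elements of E. -/
theorem mem_RR_gr {p : A × ℤ} {t : (RR M).carrier}
    (h1 : ∀ q, ∀ z ∈ extGr k w q, q.2 ≠ -p.2 → omegaHom (k := k) (n := n) M.carrier t z = 0)
    (h2 : ∀ q, ∀ z ∈ extGr k w q, omegaHom (k := k) (n := n) M.carrier t z ∈ M.gr (p.1 + q.1)) :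
    t ∈ (RR M).gr p := by
  refine (RR M).isGrading.mem_of_proj fun p' hp => ?_
  refine (omegaHom (k := k) (n := n) M.carrier).injective
    ((extGr_isGrading k w).linearMap_ext fun q z hz => ?_)
  rw [omegaHom_proj M t p' hz, map_zero, LinearMap.zero_apply]
  split_ifs with hq
  · by_cases h : p'.2 = p.2
    · rw [M.isGrading.proj_of_mem_of_ne _ (h2 q z hz)]
      exact fun h' => hp (Prod.ext (add_right_cancel h').symm h)
    · rw [h1 q z hz, map_zero]
      rw [hq]
      exact fun h' => h (neg_injective h')
  · rfl

variable (d : A)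

/-- The embedding of `K_d(M)` in auxiliary degree `j` into `Hom_k(E, M)`. -/
noncomputable def KKhom (j : ℤ) : (KK M d).aux j →ₗ[k] (Ext k n →ₗ[k] M) :=
  (omegaHom (k := k) (n := n) M.carrier).toLinearMap ∘ₗ
    (((Ksub M d).subtype.restrictScalars k : Ksub M d →ₗ[k] (RR M).carrier) ∘ₗ
      ((KK M d).aux j).subtype)

theorem KKhom_apply {j : ℤ} (x : (KK M d).aux j) :
    KKhom M d j x = omegaHom (k := k) (n := n) M.carrier x.1.1 := rfl

theorem KKhom_injective (j : ℤ) : Function.Injective (KKhom M d j) := by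
  intro x y hxy
  exact Subtype.ext (Subtype.ext ((omegaHom (k := k) (n := n) M.carrier).injective hxy))

theorem KKhom_mem_gr {j : ℤ} {a : A} {x : (KK M d).aux j} (hx : x ∈ (KK M d).auxGr j a)
    {q : A × ℤ} {z : Ext k n} (hz : z ∈ extGr k w q) : KKhom M d j x z ∈ M.gr (a + q.1) :=
  omegaHom_mem M (p := (a, j)) hx hz

theorem KKhom_eq_zero {j : ℤ} (x : (KK M d).aux j) {q : A × ℤ} {z : Ext k n}
    (hz : z ∈ extGr k w q) (hq : q.2 ≠ -j) : KKhom M d j x z = 0 := by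
  refine ((KK M d).auxGr_isGrading j).induction_on (P := fun x => KKhom M d j x z = 0) x
    (fun a x hx => omegaHom_eq_zero M (p := (a, j)) hx hz hq) (by simp)
    (fun x y hx hy => by rw [map_add, LinearMap.add_apply, hx, hy, add_zero])

theorem KKhom_mem {j : ℤ} (x : (KK M d).aux j) (z : Ext k n) : KKhom M d j x z ∈ M.gr d := by
  obtain ⟨t, ht⟩ := x.1.2.1
  rw [KKhom_apply, ← ht]
  have := omegaHom_lTensor (k := k) (n := n) (M.gr d).subtype t z
  exact this.symm ▸ (omegaHom (k := k) (n := n) (M.gr d) t z).2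

theorem KKhom_lmulAux (i : Fin (n + 1)) {j l : ℤ} (h : l + 1 = j) (x : (KK M d).aux j)
    (z : Ext k n) :
    KKhom M d l ((KK M d).lmulAux i h x) z =
      (j.negOnePow : ℤ) • KKhom M d j x (e k i * z) := by
  refine ((KK M d).auxGr_isGrading j).induction_on (P := fun x =>
    KKhom M d l ((KK M d).lmulAux i h x) z = (j.negOnePow : ℤ) • KKhom M d j x (e k i * z)) x
    (fun a x hx => ?_) (by simp)
    (fun x y hx hy => by simp only [map_add, LinearMap.add_apply, hx, hy, smul_add])
  have hx' : x.1 ∈ (KK M d).gr (a, j) := hx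
  have h1 : ((KK M d).lmulAux i h x).1 = (KK M d).lmul i x.1 := rfl
  rw [KKhom_apply, h1, (KK M d).lmul_apply_of_mem i hx']
  have h2 : (((j.negOnePow : ℤ) • (MulOpposite.op (e k i) • x.1) : (KK M d).carrier) :
      Ksub M d).1 = (j.negOnePow : ℤ) • (MulOpposite.op (e k i) • x.1.1) := rfl
  rw [h2, map_zsmul, LinearMap.smul_apply, omegaHom_op_smul]
  rfl

/-- This is the equation defining the kernel of the differential of R(M), evaluated at z. -/
theorem sum_X_smul_KKhom {j l : ℤ} (h : l + 1 = j) (x : (KK M d).aux j) (z : Ext k n) :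
    ∑ i, (MvPolynomial.X i : PolyS k n) • KKhom M d l ((KK M d).lmulAux i h x) z = 0 := by
  refine ((KK M d).auxGr_isGrading j).induction_on (P := fun x =>
    ∑ i, (MvPolynomial.X i : PolyS k n) • KKhom M d l ((KK M d).lmulAux i h x) z = 0) x
    (fun a x hx => ?_) (by simp)
    (fun x y hx hy => by
      simp only [map_add, LinearMap.add_apply, smul_add, Finset.sum_add_distrib, hx, hy, add_zero])
  have h0 : RRdel M x.1.1 = 0 := x.1.2.2
  have h1 := omegaHom_RRdel M x.1.1 z
  rw [h0, map_zero, LinearMap.zero_apply] at h1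
  rw [h1]
  refine Finset.sum_congr rfl fun i _ => ?_
  have hx' : x.1.1 ∈ (RR M).gr (a, j) := hx
  rw [KKhom_lmulAux, omegaHom_lmul M hx']
  rfl

/-- The value of x at eᵢ z is, up to sign, the value of eᵢ x at z. Hence all values on nonempty
monomials are governed by the products eᵢ x, and only the value at 1 remains. -/
theorem KK_aux_ext {j : ℤ} {x : (KK M d).aux j} (h1 : KKhom M d j x 1 = 0)
    (h2 : ∀ (i : Fin (n + 1)) (l : ℤ) (h : l + 1 = j), (KK M d).lmulAux i h x = 0) : x = 0 := by
  refine KKhom_injective M d j (Ext.linearMap_ext fun l => ?_)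
  rw [map_zero, LinearMap.zero_apply]
  cases l with
  | nil => simpa using h1
  | cons i l =>
    have := KKhom_lmulAux M d i (sub_add_cancel j 1) x (l.map (e k)).prod
    rw [h2, map_zero, LinearMap.zero_apply] at this
    rw [List.map_cons, List.prod_cons]
    rcases Int.even_or_odd j with hj | hj
    · rw [Int.negOnePow_even j hj] at this
      simpa using this.symm
    · rw [Int.negOnePow_odd j hj] at this
      simpa using this.symm

theorem KK_aux_ext_of_ne {j : ℤ} (hj : j ≠ 0) {x : (KK M d).aux j}
    (h2 : ∀ (i : Fin (n + 1)) (l : ℤ) (h : l + 1 = j), (KK M d).lmulAux i h x = 0) : x = 0 :=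
  KK_aux_ext M d (KKhom_eq_zero M d x one_mem_extGr (by simpa using hj)) h2

/-- A monomial of length m in E has auxiliary degree -m, so a functional of negative auxiliary
degree j would need a monomial of negative length. -/
theorem KK_aux_eq_zero {j : ℤ} (hj : j < 0) (x : (KK M d).aux j) : x = 0 := by
  refine KKhom_injective M d j (Ext.linearMap_ext fun l => ?_)
  rw [map_zero, LinearMap.zero_apply]
  refine KKhom_eq_zero M d x (q := (l.map fun i => ((-w i, -1) : A × ℤ)).sum)
    (Submodule.subset_span ⟨l, rfl, rfl⟩) ?_
  have : ((l.map fun i => ((-w i, -1) : A × ℤ)).sum).2 = -(l.length : ℤ) := by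
    induction l with
    | nil => simp
    | cons i l ih => simp only [List.map_cons, List.sum_cons, Prod.snd_add, ih,
        List.length_cons]; push_cast; ring
  omega

/-- This supplies elements of K_d(M): the conditions say that φ takes values in M_d, satisfies the
kernel equation and has degree (a; j). -/
theorem exists_KKhom_eq {j : ℤ} {a : A} (φ : Ext k n →ₗ[k] M) (hd : ∀ z, φ z ∈ M.gr d)
    (hsum : ∀ z, ∑ i, (MvPolynomial.X i : PolyS k n) • φ (e k i * z) = 0)
    (h1 : ∀ q, ∀ z ∈ extGr k w q, q.2 ≠ -j → φ z = 0)
    (h2 : ∀ q, ∀ z ∈ extGr k w q, φ z ∈ M.gr (a + q.1)) :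
    ∃ x ∈ (KK M d).auxGr j a, KKhom M d j x = φ := by
  let s : Omega k n ⊗[k] M.gr d := (omegaHom (M.gr d)).symm (φ.codRestrict (M.gr d) hd)
  let t : (RR M).carrier := TensorProduct.AlgebraTensorModule.map
    (LinearMap.id : omegaE k w →ₗ[(Ext k n)ᵐᵒᵖ] omegaE k w) (M.gr d).subtype s
  have ht : omegaHom (k := k) (n := n) M.carrier t = φ := by
    refine LinearMap.ext fun z => ?_
    have := omegaHom_lTensor (k := k) (n := n) (M.gr d).subtype s z
    refine Eq.trans this ?_
    simp [s]
  have htg : t ∈ (RR M).gr (a, j) := mem_RR_gr M (by rwa [ht]) (by rwa [ht])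
  have htK : t ∈ Ksub M d := by
    refine ⟨⟨s, rfl⟩, ?_⟩
    change RRdel M t = 0
    refine (omegaHom (k := k) (n := n) M.carrier).injective (LinearMap.ext fun z => ?_)
    rw [omegaHom_RRdel, map_zero, LinearMap.zero_apply]
    simp only [omegaHom_lmul M htg, ht, smul_comm (_ : PolyS k n) (_ : ℤ)]
    rw [← Finset.smul_sum, hsum, smul_zero]
  have htK' : (⟨t, htK⟩ : Ksub M d) ∈ (KK M d).gr (a, j) := htg
  exact ⟨⟨⟨t, htK⟩, Submodule.mem_iSup_of_mem a htK'⟩, htK', ht⟩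

end Kernel

/-! ### Coinduction: from anticommuting operators to K_d(M) -/

section Comparison

universe v v'

variable {k : Type*} [Field k] {n : ℕ} {A : Type*} [AddCommGroup A] {w : Fin (n + 1) → A}
  {V : ℤ → Type*} [∀ j, AddCommGroup (V j)] [∀ j, Module k (V j)]

/-- The right multiplication by `eₚ` on `∏ⱼ Vⱼ` corresponding to the left multiplication `Tₚ`. -/
def rightMul (T : Fin (n + 1) → ∀ {j l : ℤ}, l + 1 = j → (V j →ₗ[k] V l)) (p : Fin (n + 1)) :
    Module.End k (∀ j, V j) :=
  -- The sign is that of eₚ x = (-1)^j x eₚ, for the source index j = l + 1.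
  LinearMap.pi fun l => ((l + 1).negOnePow : ℤ) • T p (rfl : l + 1 = l + 1) ∘ₗ
    LinearMap.proj (l + 1)

variable {T : Fin (n + 1) → ∀ {j l : ℤ}, l + 1 = j → (V j →ₗ[k] V l)}

theorem rightMul_apply (p : Fin (n + 1)) (x : ∀ j, V j) (l : ℤ) :
    rightMul T p x l = ((l + 1).negOnePow : ℤ) • T p rfl (x (l + 1)) := by
  simp [rightMul]

theorem rightMul_single (p : Fin (n + 1)) {j l : ℤ} (h : l + 1 = j) (x : V j) :
    rightMul T p (Pi.single j x) = Pi.single l ((j.negOnePow : ℤ) • T p h x) := by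
  subst h
  funext m
  rw [rightMul_apply]
  by_cases hm : m = l
  · subst hm
    rw [Pi.single_eq_same, Pi.single_eq_same]
  · rw [Pi.single_eq_of_ne hm, Pi.single_eq_of_ne (fun h => hm (by omega)), map_zero, smul_zero]

/-- The right `E`-module structure on `∏ⱼ Vⱼ` determined by anticommuting operators. -/
noncomputable def rightAction
    (T : Fin (n + 1) → ∀ {j l : ℤ}, l + 1 = j → (V j →ₗ[k] V l))
    (h1 : ∀ {j l m : ℤ} (h : l + 1 = j) (h' : m + 1 = l) p (x : V j), T p h' (T p h x) = 0)
    (h2 : ∀ {j l m : ℤ} (h : l + 1 = j) (h' : m + 1 = l) p q (x : V j),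
      T p h' (T q h x) + T q h' (T p h x) = 0) :
    Ext k n →ₐ[k] (Module.End k (∀ j, V j))ᵐᵒᵖ :=
  ExteriorAlgebra.lift k ⟨∑ i, (LinearMap.proj i : (Fin (n + 1) → k) →ₗ[k] k).smulRight
    (MulOpposite.op (rightMul T i)), by
      intro v
      simp only [LinearMap.sum_apply, LinearMap.smulRight_apply, LinearMap.proj_apply]
      refine sq_sum_eq_zero k _ ?_ ?_ v _
      · intro i
        rw [← MulOpposite.op_mul, MulOpposite.op_eq_zero_iff]
        refine LinearMap.ext fun x => funext fun l => ?_
        rw [Module.End.mul_apply, rightMul_apply, rightMul_apply, map_zsmul, h1]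
        simp
      · intro i j
        rw [← MulOpposite.op_mul, ← MulOpposite.op_mul, ← MulOpposite.op_add,
          MulOpposite.op_eq_zero_iff]
        -- The two products carry the same sign, so the right multiplications anticommute because
        -- the operators `T` do.
        refine LinearMap.ext fun x => funext fun l => ?_
        rw [LinearMap.add_apply, Pi.add_apply, Module.End.mul_apply, Module.End.mul_apply,
          rightMul_apply, rightMul_apply, rightMul_apply, rightMul_apply, map_zsmul, map_zsmul,
          ← smul_add, ← smul_add, h2]
        simp⟩

theorem rightAction_e
    (h1 : ∀ {j l m : ℤ} (h : l + 1 = j) (h' : m + 1 = l) p (x : V j), T p h' (T p h x) = 0)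
    (h2 : ∀ {j l m : ℤ} (h : l + 1 = j) (h' : m + 1 = l) p q (x : V j),
      T p h' (T q h x) + T q h' (T p h x) = 0) (p : Fin (n + 1)) :
    rightAction T h1 h2 (e k p) = MulOpposite.op (rightMul T p) := by
  rw [rightAction, e, ExteriorAlgebra.lift_ι_apply]
  simp only [LinearMap.sum_apply, LinearMap.smulRight_apply, LinearMap.proj_apply]
  rw [Finset.sum_eq_single p]
  · simp
  · intro q _ hq
    simp [hq]
  · simp

/-- A map from `V₀` to the degree `d` part of `M` which annihilates the linear relations given by
anticommuting operators on `V` extends to a map from `V` to `K_d(M)`. -/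
theorem exists_map_KK (M : GrMod.{v} k w) (d : A) {gr : ∀ j, A → Submodule k (V j)}
    (hgr : ∀ j, IsGrading (gr j))
    (h1 : ∀ {j l m : ℤ} (h : l + 1 = j) (h' : m + 1 = l) p (x : V j), T p h' (T p h x) = 0)
    (h2 : ∀ {j l m : ℤ} (h : l + 1 = j) (h' : m + 1 = l) p q (x : V j),
      T p h' (T q h x) + T q h' (T p h x) = 0)
    (hT : ∀ (p : Fin (n + 1)) {j l : ℤ} (h : l + 1 = j) (a : A), ∀ x ∈ gr j a,
      T p h x ∈ gr l (a - w p))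
    (ε : V 0 →ₗ[k] M) (hd : ∀ x, ε x ∈ M.gr d) (hε : ∀ a, ∀ x ∈ gr 0 a, ε x ∈ M.gr a)
    (hrel : ∀ (j : ℤ) (h : 0 + 1 = j) (x : V j),
      ∑ p, (MvPolynomial.X p : PolyS k n) • ε (T p h x) = 0) :
    ∃ β : ∀ j, V j →ₗ[k] (KK M d).aux j, (∀ j a, ∀ x ∈ gr j a, β j x ∈ (KK M d).auxGr j a) ∧
      (∀ p {j l : ℤ} (h : l + 1 = j) x, β l (T p h x) = (KK M d).lmulAux p h (β j x)) ∧
      ∀ x, KKhom M d 0 (β 0 x) 1 = ε x := by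
  let r := rightAction T h1 h2
  -- The coinduced functional: φ x z applies ε to the component of index 0 of the right product x z.
  let φ : (∀ j, V j) →ₗ[k] Ext k n →ₗ[k] M := LinearMap.mk₂ k (fun x z => ε ((r z).unop x 0))
    (fun x y z => by simp) (fun c x z => by simp) (fun x y z => by simp) (fun c x z => by simp)
  have hφ1 : ∀ x, φ x 1 = ε (x 0) := fun x => by simp [φ]
  have hφe : ∀ x p z, φ x (e k p * z) = φ (rightMul T p x) z := by
    intro x p z
    simp only [φ, LinearMap.mk₂_apply, map_mul]
    rw [show r (e k p) = _ from rightAction_e h1 h2 p]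
    simp
  have hφsum : ∀ x z, ∑ p, (MvPolynomial.X p : PolyS k n) • φ x (e k p * z) = 0 := by
    intro x z
    let g : Ext k n →ₗ[k] M := ∑ p, M.xmul p ∘ₗ φ x ∘ₗ LinearMap.mulLeft k (e k p)
    have hg : g = 0 := by
      refine Ext.linearMap_ext fun l => ?_
      simp only [g, LinearMap.sum_apply, LinearMap.comp_apply, GrMod.xmul_apply,
        LinearMap.mulLeft_apply, LinearMap.zero_apply]
      induction l generalizing x with
      | nil =>
        have := hrel (0 + 1) rfl (x (0 + 1))
        simp only [List.map_nil, List.prod_nil, hφe, hφ1, rightMul_apply, map_zsmul,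
          smul_comm (_ : PolyS k n) (_ : ℤ)]
        rw [← Finset.smul_sum, this, smul_zero]
      -- For z = e_q z' the sum is, up to the sign from eₚ e_q = -e_q eₚ, the one for the vector x
      -- e_q and the shorter monomial z'. The relations `hrel` are needed only at z = 1.
      | cons q l ih =>
        have := ih (rightMul T q x)
        rw [← neg_eq_zero, ← Finset.sum_neg_distrib, ← this]
        refine Finset.sum_congr rfl fun p _ => ?_
        rw [← hφe, ← smul_neg, ← map_neg, List.map_cons, List.prod_cons, ← mul_assoc, ← mul_assoc,
          ← neg_mul, eq_neg_of_add_eq_zero_right (e_mul_add k p q)]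
    simpa [g, GrMod.xmul_apply] using LinearMap.congr_fun hg z
  -- Each eₚ lowers the index by one and the A-degree by deg xₚ, so on V_j only monomials of length
  -- j reach index 0, where ε preserves the degree.
  have hφgr : ∀ l : List (Fin (n + 1)), ∀ j a, ∀ x ∈ gr j a,
      (((l.map fun i => ((-w i, -1) : A × ℤ)).sum).2 ≠ -j →
        φ (Pi.single j x) (l.map (e k)).prod = 0) ∧
      φ (Pi.single j x) (l.map (e k)).prod ∈
        M.gr (a + ((l.map fun i => ((-w i, -1) : A × ℤ)).sum).1) := by
    intro l
    induction l with
    | nil =>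
      intro j a x hx
      by_cases hj : j = 0
      · subst hj
        simp [hφ1, hε a x hx]
      · simp [hφ1, Pi.single_eq_of_ne (Ne.symm hj)]
    | cons p l ih =>
      intro j a x hx
      have h := ih (j - 1) (a - w p) ((j.negOnePow : ℤ) • T p (sub_add_cancel j 1) x)
        (zsmul_mem (hT p _ a x hx) _)
      rw [← rightMul_single, ← hφe, ← List.prod_cons, ← List.map_cons] at h
      refine ⟨fun hne => h.1 fun h' => hne ?_, ?_⟩
      · simp only [List.map_cons, List.sum_cons, Prod.snd_add, h']
        ring
      · have := h.2
        rwa [show a - w p + ((l.map fun i => ((-w i, -1) : A × ℤ)).sum).1 =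
          a + (((p :: l).map fun i => ((-w i, -1) : A × ℤ)).sum).1 by simp; abel] at this
  have hex : ∀ j a, ∀ x ∈ gr j a, ∃ y ∈ (KK M d).auxGr j a, KKhom M d j y = φ (Pi.single j x) := by
    intro j a x hx
    refine exists_KKhom_eq M d _ (fun z => hd _) (hφsum _) ?_ ?_
    · intro q z hz hq
      induction hz using Submodule.span_induction with
      | zero => simp
      | add x y _ _ hx hy => rw [map_add, hx, hy, add_zero]
      | smul r x _ hx => rw [map_smul, hx, smul_zero]
      | mem z hz =>
        obtain ⟨l, rfl, rfl⟩ := hz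
        exact (hφgr l j a x hx).1 hq
    · intro q z hz
      induction hz using Submodule.span_induction with
      | zero => simp
      | add x y _ _ hx hy => rw [map_add]; exact add_mem hx hy
      | smul r x _ hx => rw [map_smul]; exact Submodule.smul_mem _ _ hx
      | mem z hz =>
        obtain ⟨l, rfl, rfl⟩ := hz
        exact (hφgr l j a x hx).2
  have hex' : ∀ j (x : V j), ∃ y, KKhom M d j y = φ (Pi.single j x) := by
    intro j x
    refine (hgr j).induction_on (P := fun x => ∃ y, KKhom M d j y = φ (Pi.single j x)) x ?_ ?_ ?_
    · intro a x hx
      obtain ⟨y, -, hy⟩ := hex j a x hx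
      exact ⟨y, hy⟩
    · exact ⟨0, by simp⟩
    · rintro x y ⟨x', hx⟩ ⟨y', hy⟩
      exact ⟨x' + y', by rw [map_add, hx, hy, Pi.single_add, map_add]⟩
  -- The chosen preimages are unique because `KKhom` is injective, so linearity, gradedness and
  -- compatibility with the operators can all be checked on functionals.
  choose β hβ using hex'
  refine ⟨fun j =>
    { toFun := β j
      map_add' := fun x y => KKhom_injective M d j (by simp only [map_add, hβ, Pi.single_add])
      map_smul' := fun c x => KKhom_injective M d j (by
        simp only [map_smul, hβ, Pi.single_smul, RingHom.id_apply]) }, ?_, ?_, ?_⟩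
  · intro j a x hx
    obtain ⟨y, hy, hy'⟩ := hex j a x hx
    have : β j x = y := KKhom_injective M d j (by rw [hβ, hy'])
    change β j x ∈ _
    rwa [this]
  · intro p j l h x
    refine KKhom_injective M d l (LinearMap.ext fun z => ?_)
    change KKhom M d l (β l (T p h x)) z = KKhom M d l ((KK M d).lmulAux p h (β j x)) z
    rw [KKhom_lmulAux, hβ, hβ, hφe, rightMul_single p h, ← LinearMap.smul_apply, ← map_zsmul,
      ← Pi.single_smul, smul_smul]
    rcases Int.even_or_odd j with hj | hj
    · rw [Int.negOnePow_even j hj]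
      simp
    · rw [Int.negOnePow_odd j hj]
      simp
  · intro x
    change KKhom M d 0 (β 0 x) 1 = ε x
    rw [hβ, hφ1, Pi.single_eq_same]

end Comparison

/-! ### Maps between K_d(M) and a minimal free resolution -/

section Resolution

universe v v'

variable {k : Type*} [Field k] {n : ℕ} {A : Type*} [AddCommGroup A] {w : Fin (n + 1) → A}

namespace GrComplex

theorem IsIso.trans {C : GrComplex k w} {C' : GrComplex k w}
    {C'' : GrComplex k w} (h : C.IsIso C') (h' : C'.IsIso C'') : C.IsIso C'' := by
  obtain ⟨f, hf, hd⟩ := h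
  obtain ⟨g, hg, hd'⟩ := h'
  refine ⟨fun j => (f j).trans (g j), fun j a x => ?_, fun i j h x => ?_⟩
  · rw [hf, hg]
    rfl
  · rw [LinearEquiv.trans_apply, LinearEquiv.trans_apply, hd, hd']

/-- The projection onto a direct summand preserves multiples of the variables, so L ∩ 𝔪C = 𝔪L. In
this form quasi-splitness enters the comparison with K_d(M). -/
theorem Subcomplex.IsQuasiSplit.mem_vars_smul_top {C : GrComplex.{v} k w} {L : C.Subcomplex}
    (hL : L.IsQuasiSplit) {j : ℤ} {x : L.toComplex.X j}
    (hx : (x : C.X j) ∈ Ideal.span (Set.range (MvPolynomial.X : Fin (n + 1) → PolyS k n)) •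
      (⊤ : Submodule (PolyS k n) (C.X j))) :
    x ∈ Ideal.span (Set.range (MvPolynomial.X : Fin (n + 1) → PolyS k n)) •
      (⊤ : Submodule (PolyS k n) (L.toComplex.X j)) := by
  obtain ⟨Q, -, hQ⟩ := hL j
  have := map_mem_vars_smul_top (Submodule.projectionOnto (L.P j) Q hQ) hx
  rwa [Submodule.projectionOnto_apply_left] at this

/-- A complex, seen as a subcomplex of itself. -/
@[reducible] noncomputable def topSubcomplex (C : GrComplex.{v} k w) : C.Subcomplex where
  P _ := ⊤
  homogeneous j := isHomogeneous_of_proj_mem (C.X j).isGrading fun _ _ _ => trivial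
  d_mem _ _ _ _ _ := trivial

theorem isIso_topSubcomplex (C : GrComplex.{v} k w) : C.IsIso C.topSubcomplex.toComplex :=
  Hom.isIso_of_range_eq (C := C) (C' := C)
    ⟨fun _ => LinearMap.id, fun _ _ _ hx => hx, fun _ _ _ _ => rfl⟩
    (fun _ => Function.injective_id) fun _ => LinearMap.range_id.symm

namespace IsMinimalFreeResolution

variable {F : GrComplex.{v} k w} {M : GrMod.{v'} k w} {ε : F.X 0 →ₗ[PolyS k n] M}

/-- Induction upwards from the vanishing range: if F_{j-1} = 0 with j < 0, then every element of F_j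
is a cycle, so a boundary, so in 𝔪F_j, and Nakayama applies. -/
theorem subsingleton (hF : F.IsMinimalFreeResolution M ε) {j : ℤ} (hj : j < 0) :
    Subsingleton (F.X j) := by
  obtain ⟨N, hN⟩ := hF.bounded
  have key : ∀ m : ℕ, ∀ j < N + m, j < 0 → Subsingleton (F.X j) := by
    intro m
    induction m with
    | zero => exact fun j hj _ => hN j (by simpa using hj)
    | succ m ih =>
      intro j hj hj0
      have := ih (j - 1) (by push_cast at hj; omega) (by omega)
      refine (hF.boundedBelow j).subsingleton fun z => ?_
      obtain ⟨y, rfl⟩ := hF.acyclic j hj0.ne z (Subsingleton.elim _ _)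
      exact hF.minimal _ _ _ y
  refine key (j - N + 1).toNat j ?_ hj
  have := Int.self_le_toNat (j - N + 1)
  omega

theorem surjective (hF : F.IsMinimalFreeResolution M ε) : Function.Surjective ε := fun m => by
  obtain ⟨z, -, hz⟩ := hF.surjective_homology m
  exact ⟨z, hz⟩

theorem exists_d_eq_of_map_eq_zero (hF : F.IsMinimalFreeResolution M ε) {z : F.X 0} (hz : ε z = 0)
    {j : ℤ} (h : 0 + 1 = j) : ∃ y : F.X j, F.d j 0 h y = z := by
  obtain rfl : j = 1 := by omega
  have := hF.subsingleton (show (-1 : ℤ) < 0 by norm_num)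
  exact hF.injective_homology z (Subsingleton.elim _ _) hz

theorem exists_d_eq (hF : F.IsMinimalFreeResolution M ε) {i j l : ℤ} (hj : j ≠ 0)
    (h : l + 1 = j) (h' : j + 1 = i) {z : F.X j} (hz : F.d j l h z = 0) :
    ∃ y : F.X i, F.d i j h' y = z := by
  obtain rfl : l = j - 1 := by omega
  subst h'
  exact hF.acyclic j hj z hz

theorem mem_of_map_eq_zero (hF : F.IsMinimalFreeResolution M ε) {z : F.X 0} (hz : ε z = 0) :
    z ∈ Ideal.span (Set.range (MvPolynomial.X : Fin (n + 1) → PolyS k n)) •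
      (⊤ : Submodule (PolyS k n) (F.X 0)) := by
  obtain ⟨y, rfl⟩ := hF.exists_d_eq_of_map_eq_zero hz rfl
  exact hF.minimal _ _ _ y

theorem mem_of_d_eq_zero (hF : F.IsMinimalFreeResolution M ε) {j l : ℤ} (hj : j ≠ 0)
    (h : l + 1 = j) {z : F.X j} (hz : F.d j l h z = 0) :
    z ∈ Ideal.span (Set.range (MvPolynomial.X : Fin (n + 1) → PolyS k n)) •
      (⊤ : Submodule (PolyS k n) (F.X j)) := by
  obtain ⟨y, rfl⟩ := hF.exists_d_eq hj h rfl hz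
  exact hF.minimal _ _ _ y

/-- If x is a frame vector of degree a ≠ d, then ε x lies in 𝔪M. Subtracting a lift of it from 𝔪F₀
leaves an element of ker ε, which lies in 𝔪F₀ by minimality; so x is in 𝔪F₀ and vanishes. -/
theorem isGeneratedInDegree (hF : F.IsMinimalFreeResolution M ε) {d : A}
    (hM : M.IsGeneratedInDegree d) : (F.X 0).IsGeneratedInDegree d := by
  obtain ⟨ι, gr, u, hu⟩ := (hF.free 0).exists_isFrame
  have hgr : ∀ a, a ≠ d → ∀ x ∈ gr a, x = 0 := by
    intro a ha x hx
    obtain ⟨y, hy⟩ := mem_vars_smul_top.mp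
      (hM.mem_vars_smul_top ha (hF.map_mem a _ (hu.mem a x hx)))
    choose z hz using fun i => hF.surjective (y i)
    have h1 := hF.mem_of_map_eq_zero
      (z := u x - ∑ i, (MvPolynomial.X i : PolyS k n) • z i) (by simp [hy, hz])
    have h2 := add_mem h1 (mem_vars_smul_top.mpr ⟨z, rfl⟩)
    rw [sub_add_cancel] at h2
    rw [← hu.coeff_zero_apply x, hu.coeff_zero_of_mem h2]
  have hgr' : ∀ x, x ∈ gr d := fun x => hu.isGrading.mem_of_proj fun a ha =>
    hgr a ha _ (hu.isGrading.proj_mem a x)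
  rw [GrMod.IsGeneratedInDegree, eq_top_iff]
  rintro x -
  refine hu.induction_on (P := fun x => x ∈ Submodule.span (PolyS k n) ((F.X 0).gr d : Set (F.X 0)))
    x (fun s x => ?_) (fun x y hx hy => add_mem hx hy)
  exact Submodule.smul_mem _ _ (Submodule.subset_span (hu.mem d x (hgr' x)))

/-- The comparison map from a strongly linear, quasi-split subcomplex to `K_d(M)`. -/
theorem exists_map_KK (hF : F.IsMinimalFreeResolution M ε) {d : A}
    (hM : M.IsGeneratedInDegree d) {L : F.Subcomplex} (hL : L.IsQuasiSplit) {V : ℤ → Type*}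
    [∀ j, AddCommGroup (V j)] [∀ j, Module k (V j)] {gr : ∀ j, A → Submodule k (V j)}
    {u : ∀ j, V j →ₗ[k] L.toComplex.X j}
    {T : Fin (n + 1) → ∀ {j l : ℤ}, l + 1 = j → (V j →ₗ[k] V l)}
    (hu : L.toComplex.IsLinearFrame gr u T) :
    ∃ β : ∀ j, V j →ₗ[k] (KK M d).aux j, (∀ j a, ∀ x ∈ gr j a, β j x ∈ (KK M d).auxGr j a) ∧
      (∀ p {j l : ℤ} (h : l + 1 = j) x, β l (T p h x) = (KK M d).lmulAux p h (β j x)) ∧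
      (∀ x, KKhom M d 0 (β 0 x) 1 = ε (u 0 x).1) ∧ ∀ j, Function.Injective (β j) := by
  have hzero : ∀ j x, ((u j x).1 : F.X j) ∈
      Ideal.span (Set.range (MvPolynomial.X : Fin (n + 1) → PolyS k n)) •
        (⊤ : Submodule (PolyS k n) (F.X j)) → x = 0 := by
    intro j x hx
    exact ((hu.frame j).coeff_zero_apply x).symm.trans
      ((hu.frame j).coeff_zero_of_mem (hL.mem_vars_smul_top hx))
  let ε' : V 0 →ₗ[k] M := ε.restrictScalars k ∘ₗ (L.P 0).subtype.restrictScalars k ∘ₗ u 0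
  have hε' : ∀ a, ∀ x ∈ gr 0 a, ε' x ∈ M.gr a :=
    fun a x hx => hF.map_mem a _ ((hu.frame 0).mem a x hx)
  have hd : ∀ x, ε' x ∈ M.gr d := by
    -- A frame vector of L₀ of degree other than d would lie in 𝔪F₀, since F₀ is generated in degree
    -- d.
    have : ∀ x, x ∈ gr 0 d := fun x => (hu.frame 0).isGrading.mem_of_proj fun a ha =>
      hzero 0 _ ((hF.isGeneratedInDegree hM).mem_vars_smul_top ha
        ((hu.frame 0).mem a _ ((hu.frame 0).isGrading.proj_mem a x)))
    exact fun x => hε' d x (this x)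
  have hdu : ∀ {j l : ℤ} (h : l + 1 = j) (x : V j), F.d j l h (u j x).1 =
      ∑ p, (MvPolynomial.X p : PolyS k n) • (u l (T p h x)).1 := by
    intro j l h x
    have := congrArg Subtype.val (hu.d_apply j l h x)
    rw [AddSubmonoidClass.coe_finsetSum] at this
    exact this
  obtain ⟨β, hβ, hβT, hβε⟩ := MultigradedBGG.exists_map_KK M d
    (fun j => (hu.frame j).isGrading) hu.apply_apply_self hu.apply_apply_add
    -- The relations required of the augmentation in the last argument are ε ∘ d = 0 on F₁.
    (fun p j l h a x hx => hu.apply_mem p h a x hx) ε' hd hε' (by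
      intro j h x
      obtain rfl : j = 1 := by omega
      have := hF.map_d (u 1 x).1
      rw [hdu, map_sum] at this
      simp only [map_smul] at this
      exact this)
  refine ⟨β, hβ, hβT, hβε, fun j => ?_⟩
  rcases lt_or_ge j 0 with hj | hj
  · have := hF.subsingleton hj
    exact fun x y _ => (hu.frame j).injective (Subtype.ext (Subsingleton.elim _ _))
  · obtain ⟨m, rfl⟩ := Int.eq_ofNat_of_zero_le hj
    induction m with
    | zero =>
      rw [injective_iff_map_eq_zero]
      intro x hx
      refine hzero _ x (hF.mem_of_map_eq_zero ?_)
      have := hβε x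
      rw [show β 0 x = 0 from hx, map_zero, LinearMap.zero_apply] at this
      exact this.symm
    -- If β kills x, it kills every Tₚ x, so these vanish by induction. Then the frame vector is a
    -- cycle, hence in 𝔪F, hence zero.
    | succ m ih =>
      rw [injective_iff_map_eq_zero]
      intro x hx
      have h : (m : ℤ) + 1 = ((m + 1 : ℕ) : ℤ) := by push_cast; rfl
      refine hzero _ x (hF.mem_of_d_eq_zero (by omega) h ?_)
      rw [hdu]
      refine Finset.sum_eq_zero fun p _ => ?_
      have : T p h x = 0 := by
        refine ih (by omega) ?_
        rw [hβT, hx, map_zero, map_zero]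
      rw [this, map_zero, Submodule.coe_zero, smul_zero]

end IsMinimalFreeResolution

end GrComplex

/-- Graded lifts can be prescribed on a graded subspace. -/
theorem IsGrading.exists_lift_extending {ι U V W Z : Type*} [AddCommGroup U] [Module k U]
    [AddCommGroup V] [Module k V] [AddCommGroup W] [Module k W] [AddCommGroup Z] [Module k Z]
    {grU : ι → Submodule k U} {gr : ι → Submodule k V} {grW : ι → Submodule k W}
    {grZ : ι → Submodule k Z} (hU : IsGrading grU)
    (hV : IsGrading gr) (hW : IsGrading grW) (hZ : IsGrading grZ)
    (g : W →ₗ[k] Z) (hg : ∀ i, ∀ x ∈ grW i, g x ∈ grZ i) (z : V →ₗ[k] Z)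
    (hz : ∀ i, ∀ x ∈ gr i, z x ∈ grZ i) (hr : ∀ v, ∃ x, g x = z v)
    (β : U →ₗ[k] V) (hβ : ∀ i, ∀ x ∈ grU i, β x ∈ gr i) (hinj : Function.Injective β)
    (f : U →ₗ[k] W) (hf : ∀ i, ∀ x ∈ grU i, f x ∈ grW i) (hgf : ∀ x, g (f x) = z (β x)) :
    ∃ h : V →ₗ[k] W, (∀ i, ∀ x ∈ gr i, h x ∈ grW i) ∧ (∀ v, g (h v) = z v) ∧
      ∀ x, h (β x) = f x := by
  obtain ⟨h, hh, hgh⟩ := hV.exists_lift hW hZ g hg z hz hr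
  obtain ⟨r, hr, hrβ⟩ := hU.exists_retraction hV β hβ hinj
  -- An arbitrary lift is corrected by its error on U, extended to V through a retraction of β. The
  -- error takes values in ker g, so the lifting property survives.
  refine ⟨h - (h ∘ₗ β - f) ∘ₗ r, fun i x hx => ?_, fun v => ?_, fun x => ?_⟩
  · exact sub_mem (hh i x hx) (sub_mem (hh i _ (hβ i _ (hr i x hx))) (hf i _ (hr i x hx)))
  · simp [hgh, hgf]
  · simp [hrβ]

variable (M : GrMod.{v'} k w) (d : A)

theorem KK_aux_zero_ext {x : (KK M d).aux 0} (h : KKhom M d 0 x 1 = 0) : x = 0 :=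
  KK_aux_ext M d h fun _ _ hl => KK_aux_eq_zero M d (by omega) _

/-- The component of degree a has its value at 1 both in M_a and in M_d, so it vanishes unless a =
d. -/
theorem mem_KK_auxGr_zero (x : (KK M d).aux 0) : x ∈ (KK M d).auxGr 0 d := by
  refine ((KK M d).auxGr_isGrading 0).mem_of_proj fun a ha => KK_aux_zero_ext M d ?_
  have h1 := KKhom_mem_gr M d (((KK M d).auxGr_isGrading 0).proj_mem a x) one_mem_extGr
  have h2 := KKhom_mem M d (((KK M d).auxGr_isGrading 0).proj a x) 1
  rw [Prod.fst_zero, add_zero] at h1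
  rw [← M.isGrading.proj_of_mem h1, M.isGrading.proj_of_mem_of_ne ha.symm h2]

/-- The functional `K_d(M)₀ → M_d`. -/
noncomputable def KKeval : (KK M d).aux 0 →ₗ[k] M := LinearMap.applyₗ 1 ∘ₗ KKhom M d 0

theorem KKeval_apply (x : (KK M d).aux 0) : KKeval M d x = KKhom M d 0 x 1 := rfl

theorem KKeval_mem (a : A) (x : (KK M d).aux 0) (hx : x ∈ (KK M d).auxGr 0 a) :
    KKeval M d x ∈ M.gr a := by
  have := KKhom_mem_gr M d hx one_mem_extGr
  rwa [Prod.fst_zero, add_zero] at this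

variable {M d} {F : GrComplex.{v} k w} {ε : F.X 0 →ₗ[PolyS k n] M}

open GrComplex

/-- A map from a subspace of `K_d(M)` to a resolution of `M` extends to `K_d(M)`. -/
theorem GrComplex.IsMinimalFreeResolution.exists_lift_KK (hF : F.IsMinimalFreeResolution M ε)
    {V : ℤ → Type*} [∀ j, AddCommGroup (V j)] [∀ j, Module k (V j)]
    {gr : ∀ j, A → Submodule k (V j)} (hgr : ∀ j, IsGrading (gr j))
    {T : Fin (n + 1) → ∀ {j l : ℤ}, l + 1 = j → (V j →ₗ[k] V l)}
    {β : ∀ j, V j →ₗ[k] (KK M d).aux j} (hβ : ∀ j a, ∀ x ∈ gr j a, β j x ∈ (KK M d).auxGr j a)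
    (hβT : ∀ p {j l : ℤ} (h : l + 1 = j) x, β l (T p h x) = (KK M d).lmulAux p h (β j x))
    (hinj : ∀ j, Function.Injective (β j))
    {f : ∀ j, V j →ₗ[k] F.X j} (hf : ∀ j a, ∀ x ∈ gr j a, f j x ∈ (F.X j).gr a)
    (hfd : ∀ {j l : ℤ} (h : l + 1 = j) (x : V j), F.d j l h (f j x) =
      ∑ p, (MvPolynomial.X p : PolyS k n) • f l (T p h x))
    (hfε : ∀ x, ε (f 0 x) = KKeval M d (β 0 x)) :
    ∃ φ : ∀ j, (KK M d).aux j →ₗ[k] F.X j,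
      (∀ j a, ∀ x ∈ (KK M d).auxGr j a, φ j x ∈ (F.X j).gr a) ∧
      (∀ {j l : ℤ} (h : l + 1 = j) (x : (KK M d).aux j), F.d j l h (φ j x) =
        ∑ p, (MvPolynomial.X p : PolyS k n) • φ l ((KK M d).lmulAux p h x)) ∧
      (∀ x, ε (φ 0 x) = KKeval M d x) ∧ ∀ j x, φ j (β j x) = f j x := by
  let D := KK M d
  let Z : ∀ {j l : ℤ}, l + 1 = j → (D.aux l →ₗ[k] F.X l) → (D.aux j →ₗ[k] F.X l) :=
    fun {j l} h φ => ∑ p, (F.X l).xmul p ∘ₗ φ ∘ₗ D.lmulAux p h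
  have hZ : ∀ {j l : ℤ} (h : l + 1 = j) (φ : D.aux l →ₗ[k] F.X l) x, Z h φ x =
      ∑ p, (MvPolynomial.X p : PolyS k n) • φ (D.lmulAux p h x) := by
    intro j l h φ x
    simp only [Z, LinearMap.sum_apply, LinearMap.comp_apply, GrMod.xmul_apply]
  have hDT : ∀ (p : Fin (n + 1)) {j l : ℤ} (h : l + 1 = j) (a : A), ∀ x ∈ D.auxGr j a,
      D.lmulAux p h x ∈ D.auxGr l (a - w p) :=
    fun p j l h a x hx => D.lmulAux_mem p h hx
  have hZmem : ∀ {j l : ℤ} (h : l + 1 = j) (φ : D.aux l →ₗ[k] F.X l),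
      (∀ a, ∀ x ∈ D.auxGr l a, φ x ∈ (F.X l).gr a) → ∀ a, ∀ x ∈ D.auxGr j a,
        Z h φ x ∈ (F.X l).gr a := by
    intro j l h φ hφ a x hx
    rw [hZ]
    refine Submodule.sum_mem _ fun p _ => ?_
    have := (F.X l).smul_mem (X_mem p) (hφ _ _ (hDT p h a x hx))
    rwa [add_sub_cancel] at this
  -- The last clause says that the element which the next stage must hit under d is a boundary, so
  -- the construction can continue.
  let Good : ∀ m : ℕ, (D.aux m →ₗ[k] F.X m) → Prop := fun m φ =>
    (∀ a, ∀ x ∈ D.auxGr m a, φ x ∈ (F.X m).gr a) ∧ (∀ x, φ (β m x) = f m x) ∧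
      ∀ (j : ℤ) (h : (m : ℤ) + 1 = j) x, ∃ y, F.d j m h y = Z h φ x
  have base : ∃ φ : D.aux ((0 : ℕ) : ℤ) →ₗ[k] F.X ((0 : ℕ) : ℤ), Good 0 φ ∧
      ∀ x, ε (φ x) = KKeval M d x := by
    obtain ⟨φ, h1, h2, h3⟩ := (hgr 0).exists_lift_extending (D.auxGr_isGrading 0)
      (F.X 0).isGrading M.isGrading (ε.restrictScalars k) hF.map_mem (KKeval M d)
      (KKeval_mem M d) (fun v => hF.surjective _) (β 0) (hβ 0) (hinj 0) (f 0) (hf 0) hfε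
    refine ⟨φ, ⟨h1, h3, fun j h x => hF.exists_d_eq_of_map_eq_zero ?_ h⟩, h2⟩
    -- Applied to the obstruction, ε gives the kernel equation of K_d(M) at z = 1.
    have := sum_X_smul_KKhom M d h x 1
    rw [show Z h φ x = _ from hZ h φ x, map_sum, ← this]
    refine Finset.sum_congr rfl fun p _ => ?_
    rw [map_smul]
    exact congrArg _ (h2 _)
  have step : ∀ (m : ℕ) (φ : D.aux m →ₗ[k] F.X m), Good m φ →
      ∃ φ' : D.aux ((m + 1 : ℕ) : ℤ) →ₗ[k] F.X ((m + 1 : ℕ) : ℤ), Good (m + 1) φ' ∧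
        ∀ x, F.d _ m (Nat.cast_succ m).symm (φ' x) = Z (Nat.cast_succ m).symm φ x := by
    intro m φ ⟨h1, h2, h3⟩
    have hm : (m : ℤ) + 1 = ((m + 1 : ℕ) : ℤ) := (Nat.cast_succ m).symm
    obtain ⟨φ', h1', h2', h3'⟩ := (hgr (m + 1 : ℕ)).exists_lift_extending
      (D.auxGr_isGrading (m + 1 : ℕ)) (F.X (m + 1 : ℕ)).isGrading (F.X m).isGrading
      ((F.d _ m hm).restrictScalars k) (F.d_mem _ _ hm) (Z hm φ) (hZmem hm φ h1)
      (h3 _ hm) (β (m + 1 : ℕ)) (hβ _) (hinj _) (f (m + 1 : ℕ)) (hf _) (by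
        intro x
        rw [LinearMap.restrictScalars_apply, hfd, hZ]
        refine Finset.sum_congr rfl fun p _ => ?_
        rw [← hβT, h2])
    refine ⟨φ', ⟨h1', h3', fun j h x => ?_⟩, h2'⟩
    -- The next obstruction is a cycle: its differential is ∑ xₚ x_q φ(e_q eₚ x), which cancels in
    -- pairs. Exactness in the positive degree m + 1 makes it a boundary.
    refine hF.exists_d_eq (by omega) hm h ?_
    rw [hZ, map_sum]
    simp only [map_smul]
    have h2'' : ∀ x, F.d _ m hm (φ' x) = Z hm φ x := h2'
    simp only [h2'', hZ, Finset.smul_sum]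
    refine sum_antisymm (fun p q => (MvPolynomial.X p : PolyS k n) •
      (MvPolynomial.X q : PolyS k n) • φ (D.lmulAux q hm (D.lmulAux p h x))) ?_ ?_
    · intro p
      rw [show D.lmulAux p hm (D.lmulAux p h x) = 0 from Subtype.ext (D.lmul_lmul_self p _),
        map_zero, smul_zero, smul_zero]
    · intro p q
      rw [smul_comm (MvPolynomial.X q : PolyS k n), ← smul_add, ← smul_add, ← map_add,
        show D.lmulAux q hm (D.lmulAux p h x) + D.lmulAux p hm (D.lmulAux q h x) = 0 from
          Subtype.ext (D.lmul_lmul_add q p _), map_zero, smul_zero, smul_zero]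
  obtain ⟨φ₀, hφ₀, hφ₀ε⟩ := base
  choose next hnext hnextd using step
  let seq : ∀ m : ℕ, { φ : D.aux m →ₗ[k] F.X m // Good m φ } := fun m =>
    Nat.rec (motive := fun m : ℕ => { φ : D.aux m →ₗ[k] F.X m // Good m φ }) ⟨φ₀, hφ₀⟩
      (fun m φ => ⟨next m φ.1 φ.2, hnext m φ.1 φ.2⟩) m
  let φ : ∀ j : ℤ, D.aux j →ₗ[k] F.X j := fun j =>
    Int.rec (motive := fun j : ℤ => D.aux j →ₗ[k] F.X j) (fun m => (seq m).1) (fun _ => 0) j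
  have hφ : ∀ m : ℕ, φ m = (seq m).1 := fun _ => rfl
  refine ⟨φ, ?_, ?_, ?_, ?_⟩
  · intro j a x hx
    rcases lt_or_ge j 0 with hj | hj
    · rw [KK_aux_eq_zero M d hj x, map_zero]
      exact zero_mem _
    · obtain ⟨m, rfl⟩ := Int.eq_ofNat_of_zero_le hj
      exact (seq m).2.1 a x hx
  · intro j l h x
    rcases lt_or_ge l 0 with hl | hl
    · have := hF.subsingleton hl
      exact Subsingleton.elim _ _
    · obtain ⟨m, rfl⟩ := Int.eq_ofNat_of_zero_le hl
      obtain rfl : j = ((m + 1 : ℕ) : ℤ) := by omega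
      exact (hnextd m (seq m).1 (seq m).2 x).trans (hZ _ _ _)
  · exact hφ₀ε
  · intro j x
    rcases lt_or_ge j 0 with hj | hj
    · obtain rfl : x = 0 := hinj j (by rw [KK_aux_eq_zero M d hj (β j x), map_zero])
      rw [map_zero, map_zero, map_zero]
    · obtain ⟨m, rfl⟩ := Int.eq_ofNat_of_zero_le hj
      exact (seq m).2.2.1 x

end Resolution

/-! ### The split embedding of L(K_d(M)) and its maximality -/

section LinearStrand

universe v v'

variable {k : Type*} [Field k] {n : ℕ} {A : Type*} [AddCommGroup A] {w : Fin (n + 1) → A}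

open GrComplex

namespace DM

variable (D : DM.{v'} k w) {C : GrComplex.{v} k w}

theorem LL_isStronglyLinear (hD : D.del = 0) : D.LL.IsStronglyLinear :=
  (D.LL_isLinearFrame hD).isStronglyLinear

theorem LL_d_one_tmul (hD : D.del = 0) {j l : ℤ} (h : l + 1 = j) (x : D.aux j) :
    D.LL.d j l h (1 ⊗ₜ x) =
      ∑ p, (MvPolynomial.X p : PolyS k n) • (1 ⊗ₜ[k] D.lmulAux p h x : D.LL.X l) :=
  (D.LL_isLinearFrame hD).d_apply j l h x

theorem one_tmul_mem_LL (hD : D.del = 0) {j : ℤ} {a : A} {x : D.aux j} (hx : x ∈ D.auxGr j a) :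
    (1 ⊗ₜ x : D.LL.X j) ∈ (D.LL.X j).gr a :=
  ((D.LL_isLinearFrame hD).frame j).mem a x hx

/-- A map from a graded `E`-module which is injective modulo the variables induces a split
injection of complexes. -/
theorem exists_hom_of_map (hD : D.del = 0) {φ : ∀ j, D.aux j →ₗ[k] C.X j}
    (hφ : ∀ j a, ∀ x ∈ D.auxGr j a, φ j x ∈ (C.X j).gr a)
    (hφd : ∀ {j l : ℤ} (h : l + 1 = j) (x : D.aux j), C.d j l h (φ j x) =
      ∑ p, (MvPolynomial.X p : PolyS k n) • φ l (D.lmulAux p h x))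
    (hC : ∀ j, (C.X j).IsFree) (hC' : ∀ j, (C.X j).IsBoundedBelow)
    (hinj : ∀ j x, φ j x ∈
      Ideal.span (Set.range (MvPolynomial.X : Fin (n + 1) → PolyS k n)) •
        (⊤ : Submodule (PolyS k n) (C.X j)) → x = 0) :
    ∃ Φ : Hom D.LL C, (∀ j x, Φ.f j (1 ⊗ₜ x) = φ j x) ∧
      ∀ j, ∃ r : C.X j →ₗ[PolyS k n] D.LL.X j,
        (∀ a, ∀ y ∈ (C.X j).gr a, r y ∈ (D.LL.X j).gr a) ∧ Function.Bijective (r ∘ₗ Φ.f j) := by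
  have hu := D.LL_isLinearFrame hD
  have happ : ∀ j x, (hu.frame j).lift (φ j) (1 ⊗ₜ x) = φ j x :=
    fun j x => (hu.frame j).lift_apply (φ j) x
  refine ⟨⟨fun j => (hu.frame j).lift (φ j), fun j => (hu.frame j).lift_mem (hφ j), ?_⟩, happ, ?_⟩
  · intro i j h x
    have : (hu.frame j).lift (φ j) ∘ₗ D.LL.d i j h = C.d i j h ∘ₗ (hu.frame i).lift (φ i) := by
      refine (hu.frame i).linearMap_ext fun x => ?_
      rw [LinearMap.comp_apply, LinearMap.comp_apply, hu.d_apply, (hu.frame i).lift_apply, hφd,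
        map_sum]
      exact Finset.sum_congr rfl fun p _ => by rw [map_smul, (hu.frame j).lift_apply]
    exact LinearMap.congr_fun this x
  · intro j
    obtain ⟨ι, gr, u, hu'⟩ := (hC j).exists_isFrame
    refine (hu.frame j).exists_splitting hu' (hC' j) ((hu.frame j).lift_mem (hφ j)) fun x hx => ?_
    rw [(hu.frame j).lift_apply] at hx
    exact hinj j x hx

/-- An injective map from a linear frame to a graded `E`-module induces a split injection of
complexes. -/
theorem exists_hom_to (hD : D.del = 0) {V : ℤ → Type*} [∀ j, AddCommGroup (V j)]
    [∀ j, Module k (V j)]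
    {gr : ∀ j, A → Submodule k (V j)} {u : ∀ j, V j →ₗ[k] C.X j}
    {T : Fin (n + 1) → ∀ {j l : ℤ}, l + 1 = j → (V j →ₗ[k] V l)} (hu : C.IsLinearFrame gr u T)
    {β : ∀ j, V j →ₗ[k] D.aux j} (hβ : ∀ j a, ∀ x ∈ gr j a, β j x ∈ D.auxGr j a)
    (hβT : ∀ p {j l : ℤ} (h : l + 1 = j) x, β l (T p h x) = D.lmulAux p h (β j x))
    (hinj : ∀ j, Function.Injective (β j)) :
    ∃ Φ : Hom C D.LL, ∀ j, ∃ r : D.LL.X j →ₗ[PolyS k n] C.X j,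
        (∀ a, ∀ y ∈ (D.LL.X j).gr a, r y ∈ (C.X j).gr a) ∧ Function.Bijective (r ∘ₗ Φ.f j) := by
  have hv := D.LL_isLinearFrame hD
  let g : ∀ j, V j →ₗ[k] D.LL.X j := fun j => TensorProduct.mk k (PolyS k n) (D.aux j) 1 ∘ₗ β j
  have hg : ∀ j a, ∀ x ∈ gr j a, g j x ∈ (D.LL.X j).gr a :=
    fun j a x hx => (hv.frame j).mem a _ (hβ j a x hx)
  refine ⟨⟨fun j => (hu.frame j).lift (g j), fun j => (hu.frame j).lift_mem (hg j), ?_⟩, ?_⟩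
  · intro i j h x
    have : (hu.frame j).lift (g j) ∘ₗ C.d i j h = D.LL.d i j h ∘ₗ (hu.frame i).lift (g i) := by
      refine (hu.frame i).linearMap_ext fun x => ?_
      rw [LinearMap.comp_apply, LinearMap.comp_apply, hu.d_apply, (hu.frame i).lift_apply, map_sum]
      refine Eq.trans ?_ (hv.d_apply i j h (β i x)).symm
      refine Finset.sum_congr rfl fun p _ => ?_
      rw [map_smul, (hu.frame j).lift_apply, ← hβT]
      rfl
    exact LinearMap.congr_fun this x
  · intro j
    -- The retraction need not commute with the operators, since only the terms have to split. It
    -- extends to an exact left inverse, without Nakayama.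
    obtain ⟨r, hr, hrβ⟩ := (hu.frame j).isGrading.exists_retraction (hv.frame j).isGrading (β j)
      (hβ j) (hinj j)
    refine ⟨(hv.frame j).lift (u j ∘ₗ r), (hv.frame j).lift_mem
      (fun a x hx => (hu.frame j).mem a _ (hr a x hx)), ?_⟩
    have : (hv.frame j).lift (u j ∘ₗ r) ∘ₗ (hu.frame j).lift (g j) = LinearMap.id := by
      refine (hu.frame j).linearMap_ext fun x => ?_
      rw [LinearMap.comp_apply, (hu.frame j).lift_apply]
      refine ((hv.frame j).lift_apply (u j ∘ₗ r) (β j x)).trans ?_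
      rw [LinearMap.comp_apply, hrβ]
      rfl
    change Function.Bijective ((hv.frame j).lift (u j ∘ₗ r) ∘ₗ (hu.frame j).lift (g j))
    rw [this]
    exact Function.bijective_id

end DM

namespace GrComplex.IsMinimalFreeResolution

variable {M : GrMod.{v'} k w} {d : A} {F : GrComplex.{v} k w} {ε : F.X 0 →ₗ[PolyS k n] M}

/-- A lift of the augmentation to `K_d(M)` is injective modulo the variables. -/
theorem eq_zero_of_mem (hF : F.IsMinimalFreeResolution M ε) (hM : M.IsGeneratedInDegree d)
    {θ : A →+ ℤ} (hθ : ∀ i, 0 < θ (w i)) {φ : ∀ j, (KK M d).aux j →ₗ[k] F.X j}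
    (hφ : ∀ j a, ∀ x ∈ (KK M d).auxGr j a, φ j x ∈ (F.X j).gr a)
    (hφd : ∀ {j l : ℤ} (h : l + 1 = j) (x : (KK M d).aux j), F.d j l h (φ j x) =
      ∑ p, (MvPolynomial.X p : PolyS k n) • φ l ((KK M d).lmulAux p h x))
    (hφε : ∀ x, ε (φ 0 x) = KKeval M d x) {j : ℤ} {x : (KK M d).aux j}
    (hx : φ j x ∈ Ideal.span (Set.range (MvPolynomial.X : Fin (n + 1) → PolyS k n)) •
        (⊤ : Submodule (PolyS k n) (F.X j))) : x = 0 := by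
  rcases lt_or_ge j 0 with hj | hj
  · exact KK_aux_eq_zero M d hj x
  · obtain ⟨m, rfl⟩ := Int.eq_ofNat_of_zero_le hj
    induction m with
    | zero =>
      refine KK_aux_zero_ext M d (x := x) ?_
      -- Auxiliary degree 0 of K_d(M) lies in A-degree d, the generating degree of F₀, in which 𝔪F₀
      -- vanishes.
      have h0 : φ 0 x = 0 := (hF.isGeneratedInDegree hM).eq_zero hθ
        (hφ 0 d x (mem_KK_auxGr_zero M d x)) hx
      have := hφε x
      rw [h0, map_zero] at this
      exact this.symm
    | succ m ih =>
      refine KK_aux_ext_of_ne M d (by omega) fun p l h => ?_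
      obtain rfl : l = m := by omega
      obtain ⟨ι, gr, u, hu⟩ := (hF.free m).exists_isFrame
      refine ih (hu.mem_of_coeff_zero ?_) (by omega)
      -- The constant term of φ(eₚ x) is the xₚ-coefficient of d(φ x). Since φ x is in 𝔪F and d is
      -- minimal, d(φ x) lies in 𝔪²F and has no linear coefficients.
      rw [← hu.coeff_single_sum p fun q => φ m ((KK M d).lmulAux q h x), ← hφd]
      obtain ⟨y, hy⟩ := mem_vars_smul_top.mp hx
      rw [hy, map_sum]
      simp only [map_smul]
      rw [hu.coeff_single_sum]
      exact hu.coeff_zero_of_mem (hF.minimal _ _ _ _)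

/-- A partial embedding of `K_d(M)` into a resolution extends to a split injection
`L(K_d(M)) → F`. -/
theorem exists_hom_LL (hF : F.IsMinimalFreeResolution M ε) (hM : M.IsGeneratedInDegree d)
    {θ : A →+ ℤ} (hθ : ∀ i, 0 < θ (w i))
    {V : ℤ → Type*} [∀ j, AddCommGroup (V j)] [∀ j, Module k (V j)]
    {gr : ∀ j, A → Submodule k (V j)} (hgr : ∀ j, IsGrading (gr j))
    {T : Fin (n + 1) → ∀ {j l : ℤ}, l + 1 = j → (V j →ₗ[k] V l)}
    {β : ∀ j, V j →ₗ[k] (KK M d).aux j} (hβ : ∀ j a, ∀ x ∈ gr j a, β j x ∈ (KK M d).auxGr j a)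
    (hβT : ∀ p {j l : ℤ} (h : l + 1 = j) x, β l (T p h x) = (KK M d).lmulAux p h (β j x))
    (hinj : ∀ j, Function.Injective (β j))
    {f : ∀ j, V j →ₗ[k] F.X j} (hf : ∀ j a, ∀ x ∈ gr j a, f j x ∈ (F.X j).gr a)
    (hfd : ∀ {j l : ℤ} (h : l + 1 = j) (x : V j), F.d j l h (f j x) =
      ∑ p, (MvPolynomial.X p : PolyS k n) • f l (T p h x))
    (hfε : ∀ x, ε (f 0 x) = KKeval M d (β 0 x)) :
    ∃ Φ : Hom (KK M d).LL F, (∀ x, ε (Φ.f 0 (1 ⊗ₜ x)) = KKeval M d x) ∧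
      (∀ j x, Φ.f j (1 ⊗ₜ β j x) = f j x) ∧
      ∀ j, ∃ r : F.X j →ₗ[PolyS k n] (KK M d).LL.X j,
        (∀ a, ∀ y ∈ (F.X j).gr a, r y ∈ ((KK M d).LL.X j).gr a) ∧
          Function.Bijective (r ∘ₗ Φ.f j) := by
  obtain ⟨φ, hφ, hφd, hφε, hφβ⟩ := hF.exists_lift_KK hgr hβ hβT hinj hf hfd hfε
  obtain ⟨Φ, hΦ, hr⟩ := (KK M d).exists_hom_of_map (KK_del M d) hφ hφd hF.free hF.boundedBelow
    fun j x hx => hF.eq_zero_of_mem hM hθ hφ hφd hφε hx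
  exact ⟨Φ, fun x => by rw [hΦ, hφε], fun j x => by rw [hΦ, hφβ], hr⟩

end GrComplex.IsMinimalFreeResolution

theorem GrComplex.Hom.injective_of_splitting {C : GrComplex.{v} k w} {C' : GrComplex.{v'} k w}
    {Φ : Hom C C'} (hr : ∀ j, ∃ r : C'.X j →ₗ[PolyS k n] C.X j,
        (∀ a, ∀ y ∈ (C'.X j).gr a, r y ∈ (C.X j).gr a) ∧ Function.Bijective (r ∘ₗ Φ.f j)) (j : ℤ) :
    Function.Injective (Φ.f j) := by
  obtain ⟨r, -, h⟩ := hr j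
  have := h.1
  rw [LinearMap.coe_comp] at this
  exact this.of_comp

theorem GrComplex.IsIso.isStronglyLinear {C : GrComplex.{v} k w} {C' : GrComplex.{v'} k w}
    (h : C.IsIso C') (hC : C.IsStronglyLinear) : C'.IsStronglyLinear := by
  obtain ⟨ι, gr, u, T, hu⟩ := hC.exists_isLinearFrame
  obtain ⟨u', hu'⟩ := hu.of_isIso h
  exact hu'.isStronglyLinear

namespace GrComplex.IsMinimalFreeResolution

variable {M : GrMod.{v'} k w} {d : A} {F : GrComplex.{v} k w} {ε : F.X 0 →ₗ[PolyS k n] M}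

/-- The image of `L(K_d(M))` under a split injection compatible with the augmentations is a maximal
strongly linear, quasi-split subcomplex. -/
theorem range_isMaximalStronglyLinear (hF : F.IsMinimalFreeResolution M ε)
    (hM : M.IsGeneratedInDegree d) {θ : A →+ ℤ} (hθ : ∀ i, 0 < θ (w i))
    {Φ : Hom (KK M d).LL F} (hΦ : ∀ x, ε (Φ.f 0 (1 ⊗ₜ x)) = KKeval M d x)
    (hr : ∀ j, ∃ r : F.X j →ₗ[PolyS k n] (KK M d).LL.X j,
        (∀ a, ∀ y ∈ (F.X j).gr a, r y ∈ ((KK M d).LL.X j).gr a) ∧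
          Function.Bijective (r ∘ₗ Φ.f j)) : Φ.range.IsMaximalStronglyLinear := by
  refine ⟨(Φ.isIso_of_range_eq (Hom.injective_of_splitting hr) fun j => rfl).isStronglyLinear
    ((KK M d).LL_isStronglyLinear (KK_del M d)), Φ.range_isQuasiSplit hr, ?_⟩
  intro L hL hLs hle
  obtain ⟨ι, gr, u, T, hu⟩ := hL.exists_isLinearFrame
  obtain ⟨β, hβ, hβT, hβε, hβinj⟩ := hF.exists_map_KK hM hLs hu
  have hmem : ∀ j y, Φ.f j y ∈ L.P j := fun j y => hle j ⟨y, rfl⟩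
  let Ψ : ∀ j, (KK M d).LL.X j →ₗ[PolyS k n] L.toComplex.X j := fun j =>
    (Φ.f j).codRestrict (L.P j) (hmem j)
  -- The constant term of the embedding, taken in the frame of L, is the candidate inverse of β.
  let c : ∀ j, (KK M d).aux j → (ι j →₀ k) := fun j x => (hu.frame j).coeff 0 (Ψ j (1 ⊗ₜ x))
  have hc : ∀ p {j l : ℤ} (h : l + 1 = j) x, T p h (c j x) = c l ((KK M d).lmulAux p h x) := by
    intro p j l h x
    have h1 : L.toComplex.d j l h (Ψ j (1 ⊗ₜ x)) =
        ∑ q, (MvPolynomial.X q : PolyS k n) • Ψ l (1 ⊗ₜ (KK M d).lmulAux q h x) := by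
      have h2 : L.toComplex.d j l h (Ψ j (1 ⊗ₜ x)) = Ψ l ((KK M d).LL.d j l h (1 ⊗ₜ x)) :=
        Subtype.ext (Φ.comm j l h (1 ⊗ₜ x)).symm
      rw [h2]
      have h3 := (KK M d).LL_d_one_tmul (KK_del M d) h x
      refine (congrArg (Ψ l) h3).trans ?_
      rw [map_sum]
      exact Finset.sum_congr rfl fun q _ => map_smul _ _ _
    refine (hu.apply_coeff_zero p h _).trans ?_
    rw [h1]
    exact (hu.frame l).coeff_single_sum p fun q => Ψ l (1 ⊗ₜ (KK M d).lmulAux q h x)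
  have hid : ∀ j x, β j (c j x) = x := by
    intro j x
    rcases lt_or_ge j 0 with hj | hj
    · rw [KK_aux_eq_zero M d hj (β j (c j x)), KK_aux_eq_zero M d hj x]
    · obtain ⟨m, rfl⟩ := Int.eq_ofNat_of_zero_le hj
      induction m with
      | zero =>
        rw [← sub_eq_zero]
        refine KK_aux_zero_ext M d ?_
        change KKhom M d 0 (β 0 (c 0 x) - x) 1 = 0
        rw [map_sub, LinearMap.sub_apply, hβε, ← KKeval_apply, ← hΦ]
        have h1 : (Φ.f 0 (1 ⊗ₜ x) : F.X 0) ∈ (F.X 0).gr d :=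
          Φ.mem 0 d _ ((KK M d).one_tmul_mem_LL (KK_del M d) (mem_KK_auxGr_zero M d x))
        have h2 : ((u 0 (c 0 x)).1 : F.X 0) ∈ (F.X 0).gr d :=
          (hu.frame 0).mem d _ ((hu.frame 0).coeff_zero_mem d _ h1)
        have h3 := map_mem_vars_smul_top (L.P 0).subtype
          ((hu.frame 0).sub_coeff_zero_mem (Ψ 0 (1 ⊗ₜ x)))
        -- In degree d there is no room for 𝔪F₀, so the embedding agrees in homological degree 0
        -- with its constant term, and ε can be compared.
        have h4 : Φ.f 0 (1 ⊗ₜ x) - (u 0 (c 0 x)).1 = 0 :=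
          (hF.isGeneratedInDegree hM).eq_zero hθ (sub_mem h1 h2) h3
        exact sub_eq_zero.mpr (congrArg ε (sub_eq_zero.mp h4).symm)
      | succ m ih =>
        rw [← sub_eq_zero]
        refine KK_aux_ext_of_ne M d (by omega) fun p l h => ?_
        obtain rfl : l = m := by omega
        rw [map_sub, ← hβT, hc, ih _ (by omega), sub_self]
  intro j
  refine le_antisymm ?_ (hle j)
  -- As β is injective with right inverse c, also c ∘ β is the identity. So the image of Ψ contains
  -- every element of L_j up to 𝔪L_j, and Nakayama applies.
  have htop : LinearMap.range (Ψ j) = ⊤ := by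
    refine ((hF.boundedBelow j).sub (L.homogeneous j)).eq_top
      (isHomogeneous_range ((KK M d).LL.X j).isGrading (L.toComplex.X j).isGrading
        (f := (Ψ j).restrictScalars k) (Φ.mem j)) fun x => ?_
    refine ⟨Ψ j (1 ⊗ₜ β j ((hu.frame j).coeff 0 x)), ⟨_, rfl⟩, (hu.frame j).mem_of_coeff_zero ?_⟩
    rw [map_sub, sub_eq_zero]
    exact hβinj j (hid j (β j ((hu.frame j).coeff 0 x))).symm
  intro x hx
  obtain ⟨y, hy⟩ : (⟨x, hx⟩ : L.P j) ∈ LinearMap.range (Ψ j) := htop ▸ Submodule.mem_top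
  exact ⟨y, congrArg Subtype.val hy⟩

/-- A maximal strongly linear, quasi-split subcomplex is isomorphic to `L(K_d(M))`. -/
theorem isIso_of_isMaximalStronglyLinear (hF : F.IsMinimalFreeResolution M ε)
    (hM : M.IsGeneratedInDegree d) {θ : A →+ ℤ} (hθ : ∀ i, 0 < θ (w i)) {L : F.Subcomplex}
    (hL : L.IsMaximalStronglyLinear) : L.toComplex.IsIso (KK M d).LL := by
  obtain ⟨hLl, hLs, hmax⟩ := hL
  obtain ⟨ι, gr, u, T, hu⟩ := hLl.exists_isLinearFrame
  obtain ⟨β, hβ, hβT, hβε, hβinj⟩ := hF.exists_map_KK hM hLs hu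
  -- Prescribing the lift on the image of β to be the inclusion of L forces the image of L(K_d(M))
  -- to contain L; maximality then gives equality.
  obtain ⟨Φ, hΦε, hΦβ, hr⟩ := hF.exists_hom_LL hM hθ (fun j => (hu.frame j).isGrading) hβ hβT hβinj
    (f := fun j => (L.P j).subtype.restrictScalars k ∘ₗ u j)
    (fun j a x hx => (hu.frame j).mem a x hx)
    (fun {j l} h x => by
      have := congrArg Subtype.val (hu.d_apply j l h x)
      rw [AddSubmonoidClass.coe_finsetSum] at this
      exact this)
    (fun x => (hβε x).symm)
  obtain ⟨hl, hs, -⟩ := hF.range_isMaximalStronglyLinear hM hθ hΦε hr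
  have hle : ∀ j, L.P j ≤ Φ.range.P j := by
    intro j x hx
    refine (hu.frame j).induction_on (P := fun x => x.1 ∈ Φ.range.P j) ⟨x, hx⟩ (fun s v => ?_)
      (fun x y hx hy => Submodule.add_mem _ hx hy)
    exact Submodule.smul_mem _ s ⟨_, hΦβ j v⟩
  exact (Φ.isIso_of_range_eq (Hom.injective_of_splitting hr)
    fun j => (hmax Φ.range hl hs hle j).symm).symm

end GrComplex.IsMinimalFreeResolution

end LinearStrand

end MultigradedBGG

/-! ### Assembly of the four assertions -/

theorem theorem1p2 {k : Type*} [Field k] {n : ℕ} {A : Type*} [AddCommGroup A]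
    (w : Fin (n + 1) → A) (hw : IsPositive k w)
    (M : GrMod k w) (d : A) (hM : M.IsGeneratedInDegree d)
    (F : GrComplex k w) (ε : F.X 0 →ₗ[PolyS k n] M) (hF : F.IsMinimalFreeResolution M ε) :
    -- `L(K_d(M))` is a strongly linear, quasi-split subcomplex of `F`
    ((KK M d).LL.IsStronglyLinear ∧
      ∃ L : F.Subcomplex, L.IsQuasiSplit ∧ L.toComplex.IsIso (KK M d).LL) ∧
    -- every strongly linear, quasi-split subcomplex of `F` is isomorphic to a quasi-split
    -- subcomplex of `L(K_d(M))`
    (∀ L : F.Subcomplex, L.toComplex.IsStronglyLinear → L.IsQuasiSplit →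
      ∃ L' : (KK M d).LL.Subcomplex, L'.IsQuasiSplit ∧ L.toComplex.IsIso L'.toComplex) ∧
    -- `L(K_d(M))` is, up to isomorphism, the unique maximal strongly linear, quasi-split
    -- subcomplex of `F`
    ((∃ L : F.Subcomplex, L.IsMaximalStronglyLinear ∧ L.toComplex.IsIso (KK M d).LL) ∧
      ∀ L : F.Subcomplex, L.IsMaximalStronglyLinear → L.toComplex.IsIso (KK M d).LL) ∧
    -- if `F` is strongly linear, then it is isomorphic to `L(K_d(M))`
    (F.IsStronglyLinear → F.IsIso (KK M d).LL) := by
  obtain ⟨-, θ, hθ⟩ := hw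
  -- With V = 0 nothing is prescribed, and the extension result yields just a split embedding
  -- compatible with the augmentations.
  obtain ⟨Φ, hΦ, -, hr⟩ := hF.exists_hom_LL hM hθ (V := fun _ => PUnit.{1}) (gr := fun _ _ => ⊥)
    (fun _ => ⟨fun _ => disjoint_bot_left, Subsingleton.elim _ _⟩) (T := fun _ {_ _} _ => 0)
    (β := fun _ => 0) (fun _ _ _ _ => zero_mem _) (fun _ {_ _} _ _ => (map_zero _).symm)
    (fun _ _ _ _ => Subsingleton.elim _ _) (f := fun _ => 0) (fun _ _ _ _ => zero_mem _)
    (fun _ _ => by simp) (fun _ => by simp)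
  have hinj := GrComplex.Hom.injective_of_splitting hr
  have hmax := hF.range_isMaximalStronglyLinear hM hθ hΦ hr
  have hiso : Φ.range.toComplex.IsIso (KK M d).LL := (Φ.isIso_of_range_eq hinj fun _ => rfl).symm
  refine ⟨⟨(KK M d).LL_isStronglyLinear (KK_del M d), Φ.range, hmax.2.1, hiso⟩, ?_,
    ⟨⟨Φ.range, hmax, hiso⟩, fun L hL => hF.isIso_of_isMaximalStronglyLinear hM hθ hL⟩, ?_⟩
  · intro L hL hLs
    obtain ⟨ι, gr, u, T, hu⟩ := hL.exists_isLinearFrame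
    obtain ⟨β, hβ, hβT, -, hβinj⟩ := hF.exists_map_KK hM hLs hu
    obtain ⟨Ψ, hΨ⟩ := (KK M d).exists_hom_to (KK_del M d) hu hβ hβT hβinj
    exact ⟨Ψ.range, Ψ.range_isQuasiSplit hΨ,
      Ψ.isIso_of_range_eq (GrComplex.Hom.injective_of_splitting hΨ) fun _ => rfl⟩
  · intro hl
    -- A strongly linear F is itself the largest strongly linear, quasi-split subcomplex, with
    -- complement 0, so uniqueness of the maximal one applies.
    refine F.isIso_topSubcomplex.trans (hF.isIso_of_isMaximalStronglyLinear hM hθ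
      ⟨F.isIso_topSubcomplex.isStronglyLinear hl, fun j => ⟨⊥, ?_, isCompl_top_bot⟩, ?_⟩)
    · intro x hx
      rw [(Submodule.mem_bot (PolyS k n)).mp hx]
      exact zero_mem _
    · exact fun L _ _ hle j => top_le_iff.mp (hle j)
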